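/- **Setting.** Let $M$ be a smooth $n$-dimensional manifold (Hausdorff, second countable, without boundary; no orientation is needed since densities are used instead of top-degree forms), let $T^*M$ be its cotangent bundle with canonical coordinates $(q^i,p_i)$, Poisson bracket $\{a,b\}=\sum_i\left(\frac{\partial a}{\partial q^i}\frac{\partial b}{\partial p_i}-\frac{\partial b}{\partial q^i}\frac{\partial a}{\partial p_i}\right)$ and symplectic volume $dV=dq^1\cdots dq^n\,dp_1\cdots dp_n$. Let $I\subseteq(-\tfrac12,\infty)$ be an interval containing $0$. *Kinetic side.* Let $\mathcal D_I$ be the set of strictly positive $f\in C^\infty(T^*M)$ such that for every $\xi\in I$ the functions $f^{1+\xi}$ and $f^{1+2\xi}$ decay in $p$: in the canonical coordinates of each chart of the given atlas, over each compact set of base points and for each order $j$, all $j$-th derivatives (in $q$ and $p$) are bounded by $C(1+|p|)^{-N}$ for some $C$ and some $N>n+1$. (For $M=\mathbb R^n$, Maxwellians $e^{-|p|^2/2}$ belong to $\mathcal D_I$ for every such $I$.) A variation of $f$ is a curve $f_\varepsilon$ in $\mathcal D_I$, $f_0=f$, that for $\varepsilon$ near $0$ is jointly smooth in $(\varepsilon,q,p)$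 and is constant in $\varepsilon$ outside a compact subset of $T^*M$. A functional $\tilde F:\mathcal D_I\to\mathbb R$ has functional derivative $\delta\tilde F/\delta f\in C^\infty(T^*M)$ at $f$ if $\frac{d}{d\varepsilon}\big|_0\tilde F[f_\varepsilon]=\int_{T^*M}dV\,\frac{\delta\tilde F}{\delta f}\,\frac{\partial f_\varepsilon}{\partial\varepsilon}\big|_0$ for every variation of $f$, and $\{\tilde F,\tilde G\}_{KT}[f]=\int_{T^*M}dV\,f\left\{\frac{\delta\tilde F}{\delta f},\frac{\delta\tilde G}{\delta f}\right\}$. *Fluid side.* Let $\mathfrak s_0=\mathrm{Vect}(M)\ltimes C^\infty(M)$, with $[(u,g),(v,h)]=([u,v],\mathcal L_uh-\mathcal L_vg)$. Let $\mathfrak s_0^*$ be the space of pairs $\mu=(m,\rho)$ of a smooth 1-form density and a smooth density on $M$, paired with $\mathfrak s_0$ by $\langle(m,\rho),(u,g)\rangle=\int_M(m(u)+\rho g)$. A variation of $\mu$ is a curve $\mu_\varepsilon$ in $\mathfrak s_0^*$, $\mu_0=\mu$, that for $\varepsilon$ near $0$ is jointly smooth in $(\varepsilon,q)$ and is constant in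 $\varepsilon$ outside a compact subset of $M$. A functional $F:\mathfrak s_0^*\to\mathbb R$ has functional derivative $\left(\frac{\delta F}{\delta m},\frac{\delta F}{\delta\rho}\right)\in\mathfrak s_0$ at $\mu$ if $\frac{d}{d\varepsilon}\big|_0F[\mu_\varepsilon]=\left\langle\frac{d\mu_\varepsilon}{d\varepsilon}\big|_0,\left(\frac{\delta F}{\delta m},\frac{\delta F}{\delta\rho}\right)\right\rangle$ for every variation of $\mu$, and $$\{F,G\}_{\mathfrak s_0^*}[\mu]=-\left\langle m,\left[\tfrac{\delta F}{\delta m},\tfrac{\delta G}{\delta m}\right]\right\rangle-\left\langle\rho,\mathcal L_{\delta F/\delta m}\tfrac{\delta G}{\delta\rho}-\mathcal L_{\delta G/\delta m}\tfrac{\delta F}{\delta\rho}\right\rangle.$$ **Proposition.** For each $\xi\in I$ there is a well-defined map $\mathsf J_\xi:\mathcal D_I\to\mathfrak s_0^*$, $\mathsf J_\xi[f]=(m[f],\rho_\xi[f])$, given in coordinates by the absolutely convergent integrals $$m_i[f]=\int d^np\;p_i f,\qquad \rho_\xi[f]=\int d^np\;f^{1+\xi}$$ (the latter is the Tsallis entropy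 density). It satisfies $\langle\mathsf J_\xi[f],(u,g)\rangle=\int_{T^*M}dV\left(\langle u,p\rangle f+f^{1+\xi}g\right)$ for all compactly supported $(u,g)\in\mathfrak s_0$, with both integrals absolutely convergent. It is a Poisson map: if $f\in\mathcal D_I$ and $F,G:\mathfrak s_0^*\to\mathbb R$ have functional derivatives $(u,g)$ and $(v,h)$ at $\mathsf J_\xi[f]$, then $F\circ\mathsf J_\xi$ and $G\circ\mathsf J_\xi$ have functional derivatives at $f$, and $$\{F\circ\mathsf J_\xi,\,G\circ\mathsf J_\xi\}_{KT}[f]=\{F,G\}_{\mathfrak s_0^*}\big[\mathsf J_\xi[f]\big]$$ whenever the following decay conditions hold: the integrals over $T^*M$ and over $M$ defining the two brackets converge absolutely, and there are $\chi_k\in C_c^\infty(M;[0,1])$, each compact set lying in $\{\chi_k=1\}$ for all large $k$, with $\int_M\left|d\chi_k\big(\rho_\xi[f]\,(gv-hu)\big)\right|\to0$. The decay conditions hold automatically if $(u,g)$ and $(v,h)$ are compactly supported, in particular always if $M$ is compact. -/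

import Mathlib

open scoped Manifold ContDiff Topology
open MeasureTheory Set Filter Bundle

noncomputable section

namespace KineticFluid

/-- The model space `ℝⁿ`. -/
abbrev Coord (n : ℕ) : Type := EuclideanSpace ℝ (Fin n)

section Definitions

variable (n : ℕ) (M : Type*) [TopologicalSpace M] [ChartedSpace (Coord n) M]
  [IsManifold (𝓡 n) ∞ M]

/-! ### The cotangent bundle, its canonical coordinates, volume and Poisson bracket -/

/-- The cotangent bundle `T*M`, with Mathlib's topology and smooth structure. -/
abbrev Cotangent : Type _ :=
  TotalSpace (Coord n →L[ℝ] ℝ)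
    (fun q : M => TangentSpace (𝓡 n) q →L[ℝ] Trivial M ℝ q)

/-- The model with corners of `T*M`. -/
abbrev cotModel := (𝓡 n).prod 𝓘(ℝ, Coord n →L[ℝ] ℝ)

instance : MeasurableSpace (Cotangent n M) := borel _

instance : BorelSpace (Cotangent n M) := ⟨rfl⟩

variable {n M}

/-- The standard basis of `ℝⁿ`. -/
def stdVec (i : Fin n) : Coord n := EuclideanSpace.single i 1

/-- The covector with components `v = (p₁, …, pₙ)`, i.e. `w ↦ ∑ pᵢ wⁱ`. -/
def covec (v : Coord n) : Coord n →L[ℝ] ℝ := innerSL ℝ v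

/-- The covector at `q` with components `v` in the preferred chart at `q`. -/
def cotPoint (q : M) (v : Coord n) : Cotangent n M := ⟨q, covec v⟩

/-- The domain of the preferred chart at `x`, seen in `ℝⁿ`. -/
def dom (x : M) : Set (Coord n) := (extChartAt (𝓡 n) x).target

/-- The inverse of the canonical coordinates `(q¹, …, qⁿ, p₁, …, pₙ)` on `T*U`, where `U` is the
domain of the preferred chart at `x`. -/
def canon (x : M) (w : Coord n × Coord n) : Cotangent n M :=
  (extChartAt (cotModel n) (⟨x, 0⟩ : Cotangent n M)).symm (w.1, covec w.2)

variable (n M) in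
/-- The measure of the symplectic volume `dV = ωⁿ / n!`: in every system of canonical coordinates
it is the Lebesgue measure `dq¹ ⋯ dqⁿ dp₁ ⋯ dpₙ`.  (These local measures agree on overlaps, and the
supremum glues them.) -/
def liouville : Measure (Cotangent n M) :=
  ⨆ x : M, ((volume : Measure (Coord n × Coord n)).restrict (dom x ×ˢ univ)).map (canon x)

/-- The canonical Poisson bracket `{a, b} = ∑ᵢ ∂a/∂qⁱ ∂b/∂pᵢ - ∂b/∂qⁱ ∂a/∂pᵢ` on `T*M`, computed
at `z` in the canonical coordinates around `z`. -/
def poissonBracket (a b : Cotangent n M → ℝ) (z : Cotangent n M) : ℝ :=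
  let φ := extChartAt (cotModel n) z
  let da := fderiv ℝ (a ∘ φ.symm) (φ z)
  let db := fderiv ℝ (b ∘ φ.symm) (φ z)
  ∑ i : Fin n, (da (stdVec i, 0) * db (0, covec (stdVec i))
    - db (stdVec i, 0) * da (0, covec (stdVec i)))

/-! ### Densities on `M`

A density on `M` is recorded by its component at each `q` in the preferred chart at `q` (just as
Mathlib records tangent vectors); `densityComp` gives its component in any other preferred
chart. -/

/-- The absolute value of the Jacobian determinant at `q` of the coordinate change from the
preferred chart at `x` to the preferred chart at `q`. -/
def jac (x q : M) : ℝ := |(tangentCoordChange (𝓡 n) x q q).det|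

/-- The component of the density `δ` in the chart at `x`, as a function of the coordinates. -/
def densityComp (δ : M → ℝ) (x : M) (y : Coord n) : ℝ :=
  let q := (extChartAt (𝓡 n) x).symm y
  δ q * jac (n := n) x q

/-- The components `mᵢ` of the 1-form density `m` in the chart at `x`, as a covector-valued
function of the coordinates. -/
def formDensityComp (m : (q : M) → TangentSpace (𝓡 n) q →L[ℝ] ℝ) (x : M) (y : Coord n) :
    Coord n →L[ℝ] ℝ :=
  let q := (extChartAt (𝓡 n) x).symm y
  jac (n := n) x q • ((m q : Coord n →L[ℝ] ℝ).comp (tangentCoordChange (𝓡 n) x q q))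

variable (n) in
/-- The measure on `M` given by the positive part of the density `δ`. -/
def densityMeasure [MeasurableSpace M] (δ : M → ℝ) : Measure M :=
  ⨆ x : M, (((volume : Measure (Coord n)).restrict (dom x)).withDensity
    (fun y => ENNReal.ofReal (densityComp δ x y))).map (extChartAt (𝓡 n) x).symm

variable (n) in
/-- Absolute convergence of the integral over `M` of the density `δ`. -/
def DensityIntegrable [MeasurableSpace M] (δ : M → ℝ) : Prop :=
  densityMeasure n δ univ ≠ ⊤ ∧ densityMeasure n (fun q => -δ q) univ ≠ ⊤

variable (n) in
/-- The integral over `M` of the density `δ`. -/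
def densityIntegral [MeasurableSpace M] (δ : M → ℝ) : ℝ :=
  (densityMeasure n δ univ).toReal - (densityMeasure n (fun q => -δ q) univ).toReal

/-! ### The Lie algebra `𝔰₀ = Vect(M) ⋉ C^∞(M)` and its smooth dual -/

variable (n M) in
/-- Pairs `(u, g)` of a smooth vector field and a smooth function. -/
abbrev FluidAlgebra : Type _ :=
  Cₛ^∞⟮𝓡 n; Coord n, (TangentSpace (𝓡 n) : M → Type)⟯ × C^∞⟮𝓡 n, M; 𝓘(ℝ, ℝ), ℝ⟯

/-- The Lie derivative `ℒ_u g` of a function along a vector field. -/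
def lieDeriv (u : (q : M) → TangentSpace (𝓡 n) q) (g : M → ℝ) (q : M) : ℝ :=
  (mfderiv (𝓡 n) 𝓘(ℝ, ℝ) g q : TangentSpace (𝓡 n) q →L[ℝ] ℝ) (u q)

theorem contMDiff_lieDeriv (u : Cₛ^∞⟮𝓡 n; Coord n, (TangentSpace (𝓡 n) : M → Type)⟯)
    (g : C^∞⟮𝓡 n, M; 𝓘(ℝ, ℝ), ℝ⟯) : ContMDiff (𝓡 n) 𝓘(ℝ, ℝ) ∞ (lieDeriv (n := n) u g) := by
  have h1 := g.contMDiff.contMDiff_tangentMap (m := ∞) (by simp)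
  have h2 := h1.comp u.contMDiff
  exact contMDiff_snd_tangentBundle_modelSpace ℝ 𝓘(ℝ, ℝ) |>.comp h2

theorem contMDiff_mlieBracket (u v : Cₛ^∞⟮𝓡 n; Coord n, (TangentSpace (𝓡 n) : M → Type)⟯) :
    ContMDiff (𝓡 n) (𝓡 n).tangent ∞
      (fun q => (⟨q, VectorField.mlieBracket (𝓡 n) u v q⟩ : TangentBundle (𝓡 n) M)) := by
  intro q
  have : IsManifold (𝓡 n) (minSmoothness ℝ 2) M := by
    rw [minSmoothness_of_isRCLikeNormedField]
    infer_instance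
  have : IsManifold (𝓡 n) (minSmoothness ℝ 3) M := by
    rw [minSmoothness_of_isRCLikeNormedField]
    infer_instance
  have : IsManifold (𝓡 n) (((⊤ : ℕ∞) : WithTop ℕ∞) + 1) M := ‹IsManifold (𝓡 n) ∞ M›
  exact ContMDiffAt.mlieBracket_vectorField (n := (⊤ : ℕ∞)) (m := (⊤ : ℕ∞))
    (u.contMDiff q) (v.contMDiff q) (by simp)

/-- The semidirect product Lie bracket `[(u, g), (v, h)] = ([u, v], ℒ_u h - ℒ_v g)`. -/
def fluidLie (X Y : FluidAlgebra n M) : FluidAlgebra n M :=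
  (⟨VectorField.mlieBracket (𝓡 n) X.1 Y.1, contMDiff_mlieBracket X.1 Y.1⟩,
   ⟨fun q => lieDeriv (n := n) X.1 Y.2 q - lieDeriv (n := n) Y.1 X.2 q,
    (contMDiff_lieDeriv X.1 Y.2).sub (contMDiff_lieDeriv Y.1 X.2)⟩)

/-- `(u, g)` vanishes outside a compact set. -/
def CompactlySupported (X : FluidAlgebra n M) : Prop :=
  ∃ K : Set M, IsCompact K ∧ ∀ q ∉ K, X.1 q = 0 ∧ X.2 q = 0

variable (n M) in
/-- The smooth dual `𝔰₀*`: pairs of a smooth 1-form density `m` and a smooth density `ρ`. -/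
structure FluidDual where
  m : (q : M) → TangentSpace (𝓡 n) q →L[ℝ] ℝ
  ρ : M → ℝ
  smooth_m : ∀ x : M, ContDiffOn ℝ ∞ (formDensityComp m x) (dom x)
  smooth_ρ : ∀ x : M, ContDiffOn ℝ ∞ (densityComp (n := n) ρ x) (dom x)

/-- The density `m(u) + ρ g` on `M`. -/
def pairingDensity (μ : FluidDual n M) (X : FluidAlgebra n M) (q : M) : ℝ :=
  μ.m q (X.1 q) + μ.ρ q * X.2 q

/-- The dual pairing of `𝔰₀*` with `𝔰₀`. -/
def pairing [MeasurableSpace M] (μ : FluidDual n M) (X : FluidAlgebra n M) : ℝ :=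
  densityIntegral n (pairingDensity μ X)

/-! ### Functional derivatives and the (-)-Lie–Poisson bracket on `𝔰₀*` -/

/-- `c` is, for parameters near `0`, a smooth curve in `𝔰₀*` that is constant outside a compact
subset of `M`. -/
def IsFluidVariation (c : ℝ → FluidDual n M) : Prop :=
  ∃ r > 0,
    (∀ x : M, ContDiffOn ℝ ∞ (fun s : ℝ × Coord n => formDensityComp (c s.1).m x s.2)
      (Ioo (-r) r ×ˢ dom x)) ∧
    (∀ x : M, ContDiffOn ℝ ∞ (fun s : ℝ × Coord n => densityComp (n := n) (c s.1).ρ x s.2)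
      (Ioo (-r) r ×ˢ dom x)) ∧
    ∃ K : Set M, IsCompact K ∧ ∀ ε ∈ Ioo (-r) r, ∀ q ∉ K,
      (c ε).m q = (c 0).m q ∧ (c ε).ρ q = (c 0).ρ q

/-- `X = (δF/δm, δF/δρ)` is the functional derivative of `F` at `μ`:
`d/dε F[c(ε)] = ⟨dc/dε, X⟩` at `ε = 0` along every smooth variation `c` of `μ`. -/
def HasFluidDeriv [MeasurableSpace M] (F : FluidDual n M → ℝ) (μ : FluidDual n M)
    (X : FluidAlgebra n M) : Prop :=
  ∀ c : ℝ → FluidDual n M, IsFluidVariation c → c 0 = μ →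
    HasDerivAt (fun ε => F (c ε))
      (densityIntegral n (fun q => deriv (fun ε => pairingDensity (c ε) X q) 0)) 0

/-- `F` has a functional derivative at `μ`. -/
def FluidDifferentiableAt [MeasurableSpace M] (F : FluidDual n M → ℝ) (μ : FluidDual n M) : Prop :=
  ∃ X : FluidAlgebra n M, HasFluidDeriv F μ X

/-- The functional derivative `(δF/δm, δF/δρ)` at `μ`. -/
def fluidDeriv [MeasurableSpace M] (F : FluidDual n M → ℝ) (μ : FluidDual n M) :
    FluidAlgebra n M :=
  Classical.epsilon (HasFluidDeriv F μ)

/-- The (-)-Lie–Poisson bracket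
`{F, G}[m, ρ] = -⟨m, [δF/δm, δG/δm]⟩ - ⟨ρ, ℒ_{δF/δm} δG/δρ - ℒ_{δG/δm} δF/δρ⟩` on `𝔰₀*`. -/
def fluidBracket [MeasurableSpace M] (F G : FluidDual n M → ℝ) (μ : FluidDual n M) : ℝ :=
  - pairing μ (fluidLie (fluidDeriv F μ) (fluidDeriv G μ))

/-! ### Distribution functions, functional derivatives and the kinetic bracket -/

/-- All coordinate derivatives of `k` decay in `p` faster than `|p|^{-(n+1)}` (by some positive
power), locally uniformly in `q`. -/
def FibreDecay (k : Cotangent n M → ℝ) : Prop :=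
  ∀ x : M, ∀ K ⊆ dom (n := n) x, IsCompact K → ∀ j : ℕ,
    ∃ N : ℝ, (n : ℝ) + 1 < N ∧ ∃ C : ℝ, ∀ y ∈ K, ∀ v : Coord n,
      ‖iteratedFDeriv ℝ j (k ∘ canon x) (y, v)‖ ≤ C * (1 + ‖v‖) ^ (-N)

variable (n M) in
/-- The elements of `C^∞(T*M)₊` that decay sufficiently fast in `p` for the parameters `ξ ∈ I`. -/
structure PhaseDensity (I : Set ℝ) where
  toFun : Cotangent n M → ℝ
  smooth : ContMDiff (cotModel n) 𝓘(ℝ, ℝ) ∞ toFun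
  pos : ∀ z, 0 < toFun z
  decay : ∀ ξ ∈ I, FibreDecay (fun z => toFun z ^ (1 + ξ)) ∧
    FibreDecay (fun z => toFun z ^ (1 + 2 * ξ))

variable {I : Set ℝ}

/-- `c` is, for parameters near `0`, a smooth curve of distribution functions that is constant
outside a compact subset of `T*M`. -/
def IsKineticVariation (c : ℝ → PhaseDensity n M I) : Prop :=
  ∃ r > 0,
    ContMDiffOn (𝓘(ℝ, ℝ).prod (cotModel n)) 𝓘(ℝ, ℝ) ∞
      (fun s : ℝ × Cotangent n M => (c s.1).toFun s.2) (Ioo (-r) r ×ˢ univ) ∧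
    ∃ K : Set (Cotangent n M), IsCompact K ∧ ∀ ε ∈ Ioo (-r) r, ∀ z ∉ K,
      (c ε).toFun z = (c 0).toFun z

/-- The smooth function `a = δF/δf` is the functional derivative of `F` at `f`:
`d/dε F[c(ε)] = ∫ dV a dc/dε` at `ε = 0` along every smooth variation `c` of `f`. -/
def HasKineticDeriv (F : PhaseDensity n M I → ℝ) (f : PhaseDensity n M I)
    (a : Cotangent n M → ℝ) : Prop :=
  ContMDiff (cotModel n) 𝓘(ℝ, ℝ) ∞ a ∧
  ∀ c : ℝ → PhaseDensity n M I, IsKineticVariation c → c 0 = f →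
    HasDerivAt (fun ε => F (c ε))
      (∫ z, a z * deriv (fun ε => (c ε).toFun z) 0 ∂(liouville n M)) 0

/-- `F` has a functional derivative at `f`. -/
def KineticDifferentiableAt (F : PhaseDensity n M I → ℝ) (f : PhaseDensity n M I) : Prop :=
  ∃ a, HasKineticDeriv F f a

/-- The functional derivative `δF/δf` at `f`. -/
def kineticDeriv (F : PhaseDensity n M I → ℝ) (f : PhaseDensity n M I) : Cotangent n M → ℝ :=
  Classical.epsilon (HasKineticDeriv F f)

/-- The integrand `f {δF/δf, δG/δf}` of the kinetic bracket. -/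
def kineticIntegrand (F G : PhaseDensity n M I → ℝ) (f : PhaseDensity n M I)
    (z : Cotangent n M) : ℝ :=
  f.toFun z * poissonBracket (kineticDeriv F f) (kineticDeriv G f) z

/-- The (+)-Lie–Poisson bracket `{F, G}_KT[f] = ∫ dV f {δF/δf, δG/δf}`. -/
def kineticBracket (F G : PhaseDensity n M I → ℝ) (f : PhaseDensity n M I) : ℝ :=
  ∫ z, kineticIntegrand F G f z ∂(liouville n M)

/-! ### Poisson maps -/

/-- A vector density `Z` on `M` has no flux through infinity: there are smooth cut-off functions
`χₖ` exhausting `M` with `∫ |dχₖ(Z)| → 0`. -/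
def NoFluxAtInfinity [MeasurableSpace M] (Z : (q : M) → TangentSpace (𝓡 n) q) : Prop :=
  ∃ χ : ℕ → M → ℝ,
    (∀ k, ContMDiff (𝓡 n) 𝓘(ℝ, ℝ) ∞ (χ k) ∧ HasCompactSupport (χ k) ∧
      ∀ q, χ k q ∈ Icc (0 : ℝ) 1) ∧
    (∀ K : Set M, IsCompact K → ∀ᶠ k in atTop, ∀ q ∈ K, χ k q = 1) ∧
    Tendsto (fun k => densityMeasure n (fun q => |lieDeriv Z (χ k) q|) univ) atTop (𝓝 0)

/-- The decay conditions on functionals `F`, `G` of the fluid variables at `J f`: the integrals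
defining the two brackets converge absolutely, and, with `(u, g)` and `(v, h)` the functional
derivatives of `F` and `G`, the vector density `ρ (g v - h u)` has no flux through infinity. -/
structure BracketDecay [MeasurableSpace M] (J : PhaseDensity n M I → FluidDual n M)
    (F G : FluidDual n M → ℝ) (f : PhaseDensity n M I) : Prop where
  kinetic : Integrable (kineticIntegrand (F ∘ J) (G ∘ J) f) (liouville n M)
  fluid : DensityIntegrable n
    (pairingDensity (J f) (fluidLie (fluidDeriv F (J f)) (fluidDeriv G (J f))))
  flux : NoFluxAtInfinity (n := n) (fun q => (J f).ρ q •
    ((fluidDeriv F (J f)).2 q • (fluidDeriv G (J f)).1 q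
      - (fluidDeriv G (J f)).2 q • (fluidDeriv F (J f)).1 q))

/-- `J` is a Poisson map: if `F` and `G` have functional derivatives at `J f`, then `F ∘ J` and
`G ∘ J` have functional derivatives at `f`, and `{F ∘ J, G ∘ J}_KT [f] = {F, G} (J f)` under the
decay conditions, which always hold if the derivatives of `F` and `G` are compactly supported
(as they are if `M` is compact). -/
def IsPoissonMap [MeasurableSpace M] (J : PhaseDensity n M I → FluidDual n M) : Prop :=
  ∀ (F G : FluidDual n M → ℝ) (f : PhaseDensity n M I),
    FluidDifferentiableAt F (J f) → FluidDifferentiableAt G (J f) →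
      KineticDifferentiableAt (F ∘ J) f ∧ KineticDifferentiableAt (G ∘ J) f ∧
      (CompactlySupported (fluidDeriv F (J f)) → CompactlySupported (fluidDeriv G (J f)) →
        BracketDecay J F G f) ∧
      (BracketDecay J F G f →
        kineticBracket (F ∘ J) (G ∘ J) f = fluidBracket F G (J f))

end Definitions

end KineticFluid

end

open KineticFluid

noncomputable section

namespace KineticFluid

set_option linter.unusedSectionVars false

/-! ### Charts of the cotangent bundle and canonical coordinates -/

section

variable {n : ℕ} {M : Type*} [TopologicalSpace M] [ChartedSpace (Coord n) M]

/-! Let (u, g) and (v, h) be the functional derivatives of F and G at the moments of f. The chain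
rule gives F ∘ J the functional derivative a = ⟨u, p⟩ + (1+ξ) f^ξ g (`fluidGenerator`), and likewise
b for G ∘ J. Everything then rests on one pointwise identity, `mul_poissonBracket_fluidGenerator`.
In canonical coordinates, f {a, b} = -⟨[u, v], p⟩ f + (1+ξ) (dg(v) - dh(u)) f^{1+ξ} + ξ D(f^{1+ξ}) +
c ∂_p(f^{1+2ξ}) · (h∇g - g∇h), where c = (1+ξ)²ξ/(1+2ξ) and D is the derivative along a vector field
whose position part is gv - hu and whose momentum part is linear in p.

Integrate this over a fibre. The last term is a total momentum derivative and disappears.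
Integration by parts in p turns the integral of D(f^{1+ξ}) into dρ(gv - hu) + ρ (g div v - h div u),
and together with ρ (dg(v) - dh(u)) this is the divergence of ρ(gv - hu). What is left is -m([u, v])
- ρ(ℒ_u h - ℒ_v g), the integrand of the fluid bracket. So the two bracket densities on M differ by
ξ div(ρ(gv - hu)) (`integral_mul_poissonBracket`), and this integrates to zero when there is no flux
through infinity (`integral_divergence_eq_zero_of_noFlux`).

Three supports are needed. (1) Measures: the Liouville measure and the measures of densities are
suprema of chart measures; `iSup_measure_apply` evaluates them through countably many charts, and
`integral_liouville` is the resulting Fubini theorem. (2) Analysis: decay faster than |p|^{-(n+1)}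
of all derivatives leaves room for one factor of p, which justifies smoothness of the moments,
differentiation under the integral and integration by parts. Along a variation only the deviation
from f depends on ε, and it is compactly supported in p, so no decay uniform in ε is required. (3)
Well-posedness: functional derivatives on the kinetic side are unique (`HasKineticDeriv.unique`), so
the chosen `kineticDeriv` is the generator above; and the Poisson bracket may be computed in any
preferred chart (`poissonBracket_canon`). -/

theorem isOpen_dom (x : M) : IsOpen (dom (n := n) x) := isOpen_extChartAt_target x

/-- The identification of component vectors with covectors. -/
def covecL : Coord n ≃L[ℝ] (Coord n →L[ℝ] ℝ) :=
  (InnerProductSpace.toDual ℝ (Coord n)).toContinuousLinearEquiv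

theorem covecL_apply (v : Coord n) : covecL v = covec v := rfl

theorem covec_apply (v w : Coord n) : covec v w = inner ℝ v w := rfl

theorem norm_covec (v : Coord n) : ‖covec v‖ = ‖v‖ := innerSL_apply_norm ℝ v

theorem continuous_covec : Continuous (covec : Coord n → Coord n →L[ℝ] ℝ) :=
  (covecL (n := n)).continuous

variable [IsManifold (𝓡 n) ∞ M]

theorem extChartAt_cotangent_source (x : M) :
    (extChartAt (cotModel n) (⟨x, 0⟩ : Cotangent n M)).source
      = TotalSpace.proj ⁻¹' (extChartAt (𝓡 n) x).source := by
  rw [extChartAt_source, extChartAt_source]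
  ext z
  simp only [FiberBundle.chartedSpace_chartAt, OpenPartialHomeomorph.trans_toPartialEquiv,
    PartialEquiv.trans_source, mem_inter_iff, mem_preimage]
  constructor
  · exact fun h => h.2.1
  · exact fun h => ⟨⟨h, mem_univ _⟩, h, mem_univ _⟩

theorem extChartAt_cotangent_target (x : M) :
    (extChartAt (cotModel n) (⟨x, 0⟩ : Cotangent n M)).target = dom x ×ˢ univ := by
  rw [FiberBundle.extChartAt_target, hom_trivializationAt_baseSet]
  ext z
  simp only [dom, TangentBundle.trivializationAt_baseSet,
    mem_inter_iff, mem_prod, mem_univ, and_true, mem_preimage]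
  refine ⟨fun h => h.1, fun h => ⟨h, ?_⟩⟩
  rw [← extChartAt_source (𝓡 n) x]
  exact ⟨(extChartAt (𝓡 n) x).map_target h, mem_univ _⟩

theorem extChartAt_cotangent_apply {x : M} {z : Cotangent n M}
    (hz : z.1 ∈ (extChartAt (𝓡 n) x).source) :
    extChartAt (cotModel n) (⟨x, 0⟩ : Cotangent n M) z
      = (extChartAt (𝓡 n) x z.1,
        (show Coord n →L[ℝ] ℝ from z.2).comp (tangentCoordChange (𝓡 n) x z.1 z.1)) := by
  rw [extChartAt_source] at hz
  rw [extChartAt_coe, Function.comp_apply, hom_chart]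
  simp only [ContinuousLinearMap.inCoordinates, TangentBundle.symmL_trivializationAt_eq_core hz]
  refine Prod.ext rfl ?_
  ext v
  simp
  rfl

theorem tangentCoordChange_comp_self {x y q : M} (hx : q ∈ (extChartAt (𝓡 n) x).source)
    (hy : q ∈ (extChartAt (𝓡 n) y).source) :
    (tangentCoordChange (𝓡 n) x y q).comp (tangentCoordChange (𝓡 n) y x q)
      = ContinuousLinearMap.id ℝ (Coord n) := by
  ext1 v
  rw [ContinuousLinearMap.comp_apply, tangentCoordChange_comp ⟨⟨hy, hx⟩, hy⟩,
    tangentCoordChange_self hy]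
  rfl

/-- The bundle chart at `x` reads a covector over q by composing it with the tangent coordinate
change from `x` to q. Its inverse therefore composes with the change from q to `x`, and the two
cancel. -/
theorem canon_eq {x : M} {y : Coord n} (hy : y ∈ dom x) (v : Coord n) :
    canon x (y, v) = (⟨(extChartAt (𝓡 n) x).symm y,
      (covec v).comp (tangentCoordChange (𝓡 n) ((extChartAt (𝓡 n) x).symm y) x
        ((extChartAt (𝓡 n) x).symm y))⟩ : Cotangent n M) := by
  have hq : (extChartAt (𝓡 n) x).symm y ∈ (extChartAt (𝓡 n) x).source :=
    (extChartAt (𝓡 n) x).map_target hy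
  set z := (⟨(extChartAt (𝓡 n) x).symm y,
      (covec v).comp (tangentCoordChange (𝓡 n) ((extChartAt (𝓡 n) x).symm y) x
        ((extChartAt (𝓡 n) x).symm y))⟩ : Cotangent n M) with hz
  have hs : z ∈ (extChartAt (cotModel n) (⟨x, 0⟩ : Cotangent n M)).source := by
    rw [extChartAt_cotangent_source]; exact hq
  rw [← PartialEquiv.left_inv _ hs, extChartAt_cotangent_apply hq]
  unfold canon
  congr 1
  refine Prod.ext ((extChartAt (𝓡 n) x).right_inv hy).symm ?_
  change covec v = ((covec v).comp _).comp _
  rw [ContinuousLinearMap.comp_assoc, tangentCoordChange_comp_self (mem_extChartAt_source _) hq,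
    ContinuousLinearMap.comp_id]

theorem proj_canon {x : M} {y : Coord n} (hy : y ∈ dom x) (v : Coord n) :
    (canon x (y, v)).1 = (extChartAt (𝓡 n) x).symm y := by rw [canon_eq hy]

theorem contMDiffOn_canon (x : M) :
    ContMDiffOn 𝓘(ℝ, Coord n × Coord n) (cotModel n) ∞ (canon x : _ → Cotangent n M) (dom x ×ˢ univ) := by
  have h1 := contMDiffOn_extChartAt_symm (I := cotModel n) (n := ∞) (⟨x, 0⟩ : Cotangent n M)
  rw [extChartAt_cotangent_target] at h1
  have h2 : ContMDiff 𝓘(ℝ, Coord n × Coord n) 𝓘(ℝ, Coord n × (Coord n →L[ℝ] ℝ)) ∞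
      (fun w : Coord n × Coord n => (w.1, covecL w.2)) := by
    rw [contMDiff_iff_contDiff]
    fun_prop
  exact h1.comp h2.contMDiffOn (fun w hw => ⟨hw.1, mem_univ _⟩)

theorem continuousOn_canon (x : M) : ContinuousOn (canon (n := n) x) (dom x ×ˢ univ) :=
  (contMDiffOn_canon x).continuousOn

/-- The canonical coordinates on `T*U`, where `U` is the domain of the preferred chart at `x`. -/
def canonCoord (x : M) (z : Cotangent n M) : Coord n × Coord n :=
  ((extChartAt (cotModel n) (⟨x, 0⟩ : Cotangent n M) z).1,
    covecL.symm (extChartAt (cotModel n) (⟨x, 0⟩ : Cotangent n M) z).2)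

theorem canonCoord_fst {x : M} {z : Cotangent n M} (hz : z.1 ∈ (extChartAt (𝓡 n) x).source) :
    (canonCoord x z).1 = extChartAt (𝓡 n) x z.1 := by
  rw [canonCoord, extChartAt_cotangent_apply hz]

theorem canonCoord_fst_mem {x : M} {z : Cotangent n M}
    (hz : z.1 ∈ (extChartAt (𝓡 n) x).source) : (canonCoord x z).1 ∈ dom x := by
  rw [canonCoord_fst hz]
  exact (extChartAt (𝓡 n) x).map_source hz

theorem canon_canonCoord {x : M} {z : Cotangent n M} (hz : z.1 ∈ (extChartAt (𝓡 n) x).source) :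
    canon x (canonCoord x z) = z := by
  have hs : z ∈ (extChartAt (cotModel n) (⟨x, 0⟩ : Cotangent n M)).source := by
    rw [extChartAt_cotangent_source]; exact hz
  unfold canon canonCoord
  simp only [← covecL_apply, ContinuousLinearEquiv.apply_symm_apply]
  exact PartialEquiv.left_inv _ hs

theorem canonCoord_canon {x : M} {w : Coord n × Coord n} (hw : w.1 ∈ dom x) :
    canonCoord x (canon x w) = w := by
  have ht : (w.1, covec w.2) ∈ (extChartAt (cotModel n) (⟨x, 0⟩ : Cotangent n M)).target := by
    rw [extChartAt_cotangent_target]; exact ⟨hw, mem_univ _⟩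
  unfold canon canonCoord
  rw [PartialEquiv.right_inv _ ht]
  simp [← covecL_apply]

theorem continuousOn_canonCoord (x : M) :
    ContinuousOn (canonCoord (n := n) x) (TotalSpace.proj ⁻¹' (extChartAt (𝓡 n) x).source) := by
  have h := continuousOn_extChartAt (I := cotModel n) (⟨x, 0⟩ : Cotangent n M)
  rw [extChartAt_cotangent_source] at h
  exact h.fst.prodMk ((covecL (n := n)).symm.continuous.comp_continuousOn h.snd)

theorem continuous_proj_cotangent : Continuous (TotalSpace.proj : Cotangent n M → M) :=
  FiberBundle.continuous_proj _ _

theorem det_tangentCoordChange_ne_zero {x y q : M} (hx : q ∈ (extChartAt (𝓡 n) x).source)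
    (hy : q ∈ (extChartAt (𝓡 n) y).source) : (tangentCoordChange (𝓡 n) x y q).det ≠ 0 := by
  intro h
  have h1 := congrArg ContinuousLinearMap.det (tangentCoordChange_comp_self hx hy)
  have h2 : ((tangentCoordChange (𝓡 n) x y q).comp (tangentCoordChange (𝓡 n) y x q)).det
      = (tangentCoordChange (𝓡 n) x y q).det * (tangentCoordChange (𝓡 n) y x q).det :=
    LinearMap.det_comp _ _
  rw [h2, h, zero_mul] at h1
  have h3 : (ContinuousLinearMap.id ℝ (Coord n)).det = 1 := LinearMap.det_id
  exact zero_ne_one (h1.trans h3)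

theorem jac_pos {x q : M} (hx : q ∈ (extChartAt (𝓡 n) x).source) : 0 < jac (n := n) x q :=
  abs_pos.2 (det_tangentCoordChange_ne_zero hx (mem_extChartAt_source q))

/-- Determinants are multiplicative along the cocycle of coordinate changes. This is the
transformation law that makes densities independent of the chart. -/
theorem jac_eq_mul {x y q : M} (hx : q ∈ (extChartAt (𝓡 n) x).source)
    (hy : q ∈ (extChartAt (𝓡 n) y).source) :
    jac (n := n) x q = |(tangentCoordChange (𝓡 n) x y q).det| * jac (n := n) y q := by
  have h : tangentCoordChange (𝓡 n) x q q
      = (tangentCoordChange (𝓡 n) y q q).comp (tangentCoordChange (𝓡 n) x y q) := by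
    ext1 v
    rw [ContinuousLinearMap.comp_apply,
      tangentCoordChange_comp ⟨⟨hx, hy⟩, mem_extChartAt_source q⟩]
  have h2 : ((tangentCoordChange (𝓡 n) y q q).comp (tangentCoordChange (𝓡 n) x y q)).det
      = (tangentCoordChange (𝓡 n) y q q).det * (tangentCoordChange (𝓡 n) x y q).det :=
    LinearMap.det_comp _ _
  rw [jac, h, h2, abs_mul, mul_comm, jac]

/-- The change of coordinates between two preferred charts has the expected derivative. -/
theorem hasFDerivAt_extChartAt_comp {x x' : M} {y : Coord n} (hy : y ∈ dom x)
    (hy' : (extChartAt (𝓡 n) x).symm y ∈ (extChartAt (𝓡 n) x').source) :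
    HasFDerivAt (extChartAt (𝓡 n) x' ∘ (extChartAt (𝓡 n) x).symm)
      (tangentCoordChange (𝓡 n) x x' ((extChartAt (𝓡 n) x).symm y)) y := by
  have h := hasFDerivWithinAt_tangentCoordChange (I := 𝓡 n) (x := x) (y := x')
    ⟨(extChartAt (𝓡 n) x).map_target hy, hy'⟩
  rw [(extChartAt (𝓡 n) x).right_inv hy] at h
  simpa using h

/-- The domain of the coordinate change from the chart at `x` to the chart at `x'`. -/
def overlap (x x' : M) : Set (Coord n) :=
  dom x ∩ (extChartAt (𝓡 n) x).symm ⁻¹' (extChartAt (𝓡 n) x').source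

theorem isOpen_overlap (x x' : M) : IsOpen (overlap (n := n) x x') :=
  (continuousOn_extChartAt_symm x).isOpen_inter_preimage (isOpen_dom x)
    (isOpen_extChartAt_source x')

theorem contDiffOn_coordChange (x x' : M) :
    ContDiffOn ℝ ∞ (extChartAt (𝓡 n) x' ∘ (extChartAt (𝓡 n) x).symm) (overlap x x') := by
  have h := contDiffOn_ext_coord_change (I := 𝓡 n) (n := ∞) x' x
  refine h.mono (fun y hy => ?_)
  rw [PartialEquiv.trans_source]
  exact hy

end

/-! ### Gluing of compatible local measures -/

section

section Gluing

variable {X ι : Type*} [MeasurableSpace X] {ν : ι → Measure X} {U : ι → Set X} {s : Set ι}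
  {c : X → ι}

theorem measure_eq_tsum_fibre (hs : s.Countable) (hc : ∀ z, c z ∈ s)
    (hcm : ∀ i, MeasurableSet (c ⁻¹' {i})) (μ : Measure X) {A : Set X} (hA : MeasurableSet A) :
    μ A = ∑' i : s, μ (A ∩ c ⁻¹' {(i : ι)}) := by
  have := hs.to_subtype
  rw [← measure_iUnion]
  · congr 1
    ext z
    simp [hc]
  · intro i j hij
    refine Set.disjoint_left.2 fun z hz hz' => hij ?_
    exact Subtype.ext (hz.2.symm.trans hz'.2)
  · exact fun i => hA.inter (hcm i)

/-- The fibres of `c` form a countable measurable partition, with the fibre of i inside `U i`. On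
the fibre of j the compatibility replaces `ν i` by `ν j`, so each `ν i` is bounded by the sum of the
pieces; conversely the supremum dominates `ν j` on the fibre of j. -/
theorem iSup_measure_apply (hU : ∀ i, MeasurableSet (U i)) (hν : ∀ i, ν i (U i)ᶜ = 0)
    (compat : ∀ i j A, MeasurableSet A → A ⊆ U i → A ⊆ U j → ν i A = ν j A)
    (hs : s.Countable) (hc : ∀ z, c z ∈ s) (hcm : ∀ i, MeasurableSet (c ⁻¹' {i}))
    (hcU : ∀ z, z ∈ U (c z)) {A : Set X} (hA : MeasurableSet A) :
    (⨆ i, ν i) A = ∑' i : s, ν i (A ∩ c ⁻¹' {(i : ι)}) := by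
  have := hs.to_subtype
  have hcsub : ∀ (B : Set X) (i : ι), B ∩ c ⁻¹' {i} ⊆ U i := by
    rintro B i z ⟨_, hz⟩
    have : c z = i := hz
    exact this ▸ hcU z
  refine le_antisymm ?_ ?_
  · have h : ⨆ i, ν i ≤ Measure.sum (fun i : s => (ν i).restrict (c ⁻¹' {(i : ι)})) := by
      refine iSup_le fun i => Measure.le_iff.2 fun B hB => ?_
      rw [Measure.sum_apply _ hB]
      calc ν i B = ν i (B ∩ U i) := (measure_inter_conull (hν i)).symm
        _ = ∑' j : s, ν i (B ∩ U i ∩ c ⁻¹' {(j : ι)}) :=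
            measure_eq_tsum_fibre hs hc hcm _ (hB.inter (hU i))
        _ ≤ ∑' j : s, (ν j).restrict (c ⁻¹' {(j : ι)}) B := by
            refine ENNReal.tsum_le_tsum fun j => ?_
            rw [compat i j _ ((hB.inter (hU i)).inter (hcm j))
              (fun z hz => hz.1.2) (hcsub _ _), Measure.restrict_apply hB]
            exact measure_mono (inter_subset_inter_left _ inter_subset_left)
    refine (h A).trans_eq ?_
    rw [Measure.sum_apply _ hA]
    exact tsum_congr fun i => Measure.restrict_apply hA
  · rw [measure_eq_tsum_fibre hs hc hcm (⨆ i, ν i) hA]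
    exact ENNReal.tsum_le_tsum fun i => (le_iSup ν (i : ι)) _

theorem iSup_measure_apply_of_subset (hU : ∀ i, MeasurableSet (U i)) (hν : ∀ i, ν i (U i)ᶜ = 0)
    (compat : ∀ i j A, MeasurableSet A → A ⊆ U i → A ⊆ U j → ν i A = ν j A)
    (hs : s.Countable) (hc : ∀ z, c z ∈ s) (hcm : ∀ i, MeasurableSet (c ⁻¹' {i}))
    (hcU : ∀ z, z ∈ U (c z)) {A : Set X} (hA : MeasurableSet A) {i : ι} (hAi : A ⊆ U i) :
    (⨆ i, ν i) A = ν i A := by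
  rw [iSup_measure_apply hU hν compat hs hc hcm hcU hA, measure_eq_tsum_fibre hs hc hcm (ν i) hA]
  refine tsum_congr fun j => ?_
  refine compat _ _ _ (hA.inter (hcm j)) ?_ (inter_subset_left.trans hAi)
  rintro z ⟨_, hz⟩
  have : c z = j := hz
  exact this ▸ hcU z

theorem measurable_of_fibres {Y : Type*} [MeasurableSpace Y] (hs : s.Countable)
    (hc : ∀ z, c z ∈ s) (hcm : ∀ i, MeasurableSet (c ⁻¹' {i})) {f : X → Y}
    (hf : ∀ i, ∃ g : X → Y, Measurable g ∧ ∀ z, c z = i → f z = g z) : Measurable f := by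
  choose g hg hfg using hf
  intro B hB
  have : f ⁻¹' B = ⋃ i ∈ s, (c ⁻¹' {i} ∩ g i ⁻¹' B) := by
    ext z
    simp only [mem_preimage, mem_iUnion, mem_inter_iff, mem_singleton_iff, exists_prop]
    constructor
    · exact fun h => ⟨c z, hc z, rfl, by rwa [← hfg _ z rfl]⟩
    · rintro ⟨i, _, hi, h⟩
      rwa [hfg i z hi]
  rw [this]
  exact MeasurableSet.biUnion hs fun i _ => (hcm i).inter (hg i hB)

end Gluing

/-! ### Countable choice of charts and integration of densities -/

section Charts

variable (n : ℕ) (M : Type*) [TopologicalSpace M] [SecondCountableTopology M]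
  [MeasurableSpace M] [BorelSpace M] [ChartedSpace (Coord n) M]

/-- Second countability leaves countably many chart domains that still cover. Taking the first one
in an enumeration that contains q is a measurable choice, because the domains are open. -/
theorem exists_chartIndex : ∃ (s : Set M) (c : M → M), s.Countable ∧ (∀ q, c q ∈ s) ∧
    (∀ q, q ∈ (extChartAt (𝓡 n) (c q)).source) ∧ ∀ x, MeasurableSet (c ⁻¹' {x}) := by
  obtain ⟨s, hs, hsU⟩ := TopologicalSpace.countable_cover_nhds
    (f := fun x : M => (extChartAt (𝓡 n) x).source) (fun x => extChartAt_source_mem_nhds x)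
  rcases isEmpty_or_nonempty M with hM | hM
  · exact ⟨∅, id, countable_empty, fun q => hM.elim q, fun q => hM.elim q, fun q => hM.elim q⟩
  have hne : s.Nonempty := by
    by_contra h
    rw [not_nonempty_iff_eq_empty] at h
    simp [h] at hsU
    obtain ⟨q⟩ := hM
    have : q ∈ (∅ : Set M) := hsU ▸ mem_univ q
    exact this
  obtain ⟨e, rfl⟩ := hs.exists_eq_range hne
  have hex : ∀ q : M, ∃ k, q ∈ (extChartAt (𝓡 n) (e k)).source := by
    intro q
    have : q ∈ ⋃ x ∈ range e, (extChartAt (𝓡 n) x).source := hsU ▸ mem_univ q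
    simpa using this
  classical
  have hm : Measurable fun q : M => Nat.find (hex q) :=
    measurable_find hex fun k => (isOpen_extChartAt_source (e k)).measurableSet
  refine ⟨range e, fun q => e (Nat.find (hex q)), hs, fun q => mem_range_self _,
    fun q => Nat.find_spec (hex q), fun x => ?_⟩
  exact hm (MeasurableSet.of_discrete (s := {k | e k = x}))

/-- A countable set of points whose preferred charts cover `M`. -/
def chartIndices : Set M := (exists_chartIndex n M).choose

variable {M} in
/-- A measurable choice of one of countably many preferred charts around each point. -/
def chartIndex : M → M := (exists_chartIndex n M).choose_spec.choose

theorem countable_chartIndices : (chartIndices n M).Countable :=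
  (exists_chartIndex n M).choose_spec.choose_spec.1

instance : Countable (chartIndices n M) := (countable_chartIndices n M).to_subtype

variable {M}

theorem chartIndex_mem (q : M) : chartIndex n q ∈ chartIndices n M :=
  (exists_chartIndex n M).choose_spec.choose_spec.2.1 q

theorem mem_source_chartIndex (q : M) : q ∈ (extChartAt (𝓡 n) (chartIndex n q)).source :=
  (exists_chartIndex n M).choose_spec.choose_spec.2.2.1 q

theorem measurableSet_chartIndex (x : M) : MeasurableSet (chartIndex n ⁻¹' {x} : Set M) :=
  (exists_chartIndex n M).choose_spec.choose_spec.2.2.2 x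

theorem mem_source_of_chartIndex_eq {q x : M} (h : chartIndex n q = x) :
    q ∈ (extChartAt (𝓡 n) x).source := h ▸ mem_source_chartIndex n q

variable (M) in
/-- Lebesgue measure in the charts selected by `chartIndex`. -/
def baseMeasure : Measure M :=
  Measure.sum fun x : chartIndices n M =>
    (((volume : Measure (Coord n)).restrict (dom (x : M))).map
      (extChartAt (𝓡 n) (x : M)).symm).restrict (chartIndex n ⁻¹' {(x : M)})

instance : SFinite (baseMeasure n M) := by unfold baseMeasure; infer_instance

variable {n}

theorem aemeasurable_extChartAt_symm (x : M) :
    AEMeasurable (extChartAt (𝓡 n) x).symm ((volume : Measure (Coord n)).restrict (dom x)) :=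
  (continuousOn_extChartAt_symm x).aemeasurable (isOpen_dom x).measurableSet

theorem measurableSet_dom_inter (x : M) {A : Set M} (hA : MeasurableSet A) :
    MeasurableSet (dom (n := n) x ∩ (extChartAt (𝓡 n) x).symm ⁻¹' A) := by
  have h := (continuousOn_iff_continuous_domRestrict.1
    (continuousOn_extChartAt_symm (I := 𝓡 n) x)).measurable hA
  have := (MeasurableEmbedding.subtype_coe (isOpen_dom (n := n) x).measurableSet).measurableSet_image.2 h
  convert! this using 1
  ext y
  constructor
  · rintro ⟨hy, hA⟩
    exact ⟨⟨y, hy⟩, hA, rfl⟩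
  · rintro ⟨⟨y, hy⟩, hA, rfl⟩
    exact ⟨hy, hA⟩

theorem lintegral_baseMeasure {G : M → ENNReal} (hG : Measurable G) :
    ∫⁻ q, G q ∂(baseMeasure n M) = ∑' x : chartIndices n M,
      ∫⁻ y in dom (x : M) ∩ (extChartAt (𝓡 n) (x : M)).symm ⁻¹' (chartIndex n ⁻¹' {(x : M)}),
        G ((extChartAt (𝓡 n) (x : M)).symm y) := by
  unfold baseMeasure
  rw [lintegral_sum_measure]
  refine tsum_congr fun x => ?_
  have hx := measurableSet_chartIndex n (x : M)
  rw [← lintegral_indicator hx, lintegral_map' (hG.indicator hx).aemeasurable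
    (aemeasurable_extChartAt_symm _), ← lintegral_indicator (isOpen_dom _).measurableSet,
    ← lintegral_indicator (measurableSet_dom_inter _ hx)]
  refine lintegral_congr fun y => ?_
  by_cases hy : y ∈ dom (x : M)
  · by_cases h : (extChartAt (𝓡 n) (x : M)).symm y ∈ chartIndex n ⁻¹' {(x : M)}
    · rw [indicator_of_mem hy, indicator_of_mem h, indicator_of_mem (mem_inter hy h)]
    · rw [indicator_of_mem hy, indicator_of_notMem h, indicator_of_notMem fun hh => h hh.2]
  · rw [indicator_of_notMem hy, indicator_of_notMem fun hh => hy hh.1]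

/-- Change of variables along the transition map: its Jacobian times `jac` in the new chart is `jac`
in the old one. The function `G` is arbitrary so that this serves densities and, with `G` the volume
of a fibre slice, the Liouville measure. -/
theorem lintegral_overlap [IsManifold (𝓡 n) ∞ M] (G : M → ENNReal) {x x' : M} {A : Set M}
    (hA : MeasurableSet A) (hx : A ⊆ (extChartAt (𝓡 n) x).source)
    (hx' : A ⊆ (extChartAt (𝓡 n) x').source) :
    ∫⁻ y in dom x ∩ (extChartAt (𝓡 n) x).symm ⁻¹' A,
        ENNReal.ofReal (jac (n := n) x ((extChartAt (𝓡 n) x).symm y))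
          * G ((extChartAt (𝓡 n) x).symm y)
      = ∫⁻ y in dom x' ∩ (extChartAt (𝓡 n) x').symm ⁻¹' A,
        ENNReal.ofReal (jac (n := n) x' ((extChartAt (𝓡 n) x').symm y))
          * G ((extChartAt (𝓡 n) x').symm y) := by
  set τ := extChartAt (𝓡 n) x' ∘ (extChartAt (𝓡 n) x).symm with hτ
  have hinv : ∀ y ∈ dom x ∩ (extChartAt (𝓡 n) x).symm ⁻¹' A,
      (extChartAt (𝓡 n) x').symm (τ y) = (extChartAt (𝓡 n) x).symm y :=
    fun y hy => (extChartAt (𝓡 n) x').left_inv (hx' hy.2)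
  have himg : dom x' ∩ (extChartAt (𝓡 n) x').symm ⁻¹' A
      = τ '' (dom x ∩ (extChartAt (𝓡 n) x).symm ⁻¹' A) := by
    ext y'
    constructor
    · rintro ⟨h1, h2⟩
      have h3 := hx h2
      refine ⟨extChartAt (𝓡 n) x ((extChartAt (𝓡 n) x').symm y'),
        ⟨(extChartAt (𝓡 n) x).map_source h3, ?_⟩, ?_⟩
      · rw [mem_preimage, (extChartAt (𝓡 n) x).left_inv h3]
        exact h2
      · rw [hτ, Function.comp_apply, (extChartAt (𝓡 n) x).left_inv h3,
          (extChartAt (𝓡 n) x').right_inv h1]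
    · rintro ⟨y, hy, rfl⟩
      refine ⟨(extChartAt (𝓡 n) x').map_source (hx' hy.2), ?_⟩
      rw [mem_preimage, hinv y hy]
      exact hy.2
  rw [himg, lintegral_image_eq_lintegral_abs_det_fderiv_mul volume
    (measurableSet_dom_inter x hA)
    (fun y hy => (hasFDerivAt_extChartAt_comp hy.1 (hx' hy.2)).hasFDerivWithinAt)]
  · refine setLIntegral_congr_fun (measurableSet_dom_inter x hA) fun y hy => ?_
    rw [hinv y hy, ← mul_assoc, ← ENNReal.ofReal_mul (abs_nonneg _),
      ← jac_eq_mul (hx hy.2) (hx' hy.2)]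
  · intro y hy y' hy' h
    have := congrArg (extChartAt (𝓡 n) x').symm h
    rw [hinv y hy, hinv y' hy'] at this
    have h2 := congrArg (extChartAt (𝓡 n) x) this
    rwa [(extChartAt (𝓡 n) x).right_inv hy.1, (extChartAt (𝓡 n) x).right_inv hy'.1] at h2

variable [IsManifold (𝓡 n) ∞ M]

theorem isOpen_source (x : M) : IsOpen (extChartAt (𝓡 n) x).source := isOpen_extChartAt_source x

/-! ### Densities -/

variable (n) in
/-- The measure in the chart at `x` of the positive part of a density. -/
def localDensityMeasure (δ : M → ℝ) (x : M) : Measure M :=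
  (((volume : Measure (Coord n)).restrict (dom x)).withDensity
    (fun y => ENNReal.ofReal (densityComp δ x y))).map (extChartAt (𝓡 n) x).symm

theorem localDensityMeasure_apply (δ : M → ℝ) (x : M) {A : Set M} (hA : MeasurableSet A) :
    localDensityMeasure n δ x A = ∫⁻ y in dom x ∩ (extChartAt (𝓡 n) x).symm ⁻¹' A,
      ENNReal.ofReal (densityComp δ x y) := by
  have hd := (isOpen_dom (n := n) x).measurableSet
  unfold localDensityMeasure
  rw [Measure.map_apply_of_aemeasurable
    ((aemeasurable_extChartAt_symm x).mono_ac (withDensity_absolutelyContinuous _ _)) hA,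
    ← restrict_withDensity hd, Measure.restrict_apply' hd, inter_comm,
    withDensity_apply _ (measurableSet_dom_inter x hA)]

theorem ofReal_densityComp (δ : M → ℝ) (x : M) (y : Coord n) :
    ENNReal.ofReal (densityComp δ x y)
      = ENNReal.ofReal (jac (n := n) x ((extChartAt (𝓡 n) x).symm y))
        * ENNReal.ofReal (δ ((extChartAt (𝓡 n) x).symm y)) := by
  rw [mul_comm]
  exact ENNReal.ofReal_mul' (abs_nonneg _)

theorem localDensityMeasure_compl (δ : M → ℝ) (x : M) :
    localDensityMeasure n δ x (extChartAt (𝓡 n) x).sourceᶜ = 0 := by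
  rw [localDensityMeasure_apply δ x (isOpen_source x).measurableSet.compl]
  have : dom (n := n) x ∩ (extChartAt (𝓡 n) x).symm ⁻¹' (extChartAt (𝓡 n) x).sourceᶜ = ∅ := by
    ext y
    simp only [mem_inter_iff, mem_preimage, mem_compl_iff, mem_empty_iff_false, iff_false, not_and,
      not_not]
    exact fun hy => (extChartAt (𝓡 n) x).map_target hy
  rw [this, Measure.restrict_empty, lintegral_zero_measure]

theorem localDensityMeasure_compat (δ : M → ℝ) (x x' : M) (A : Set M) (hA : MeasurableSet A)
    (hx : A ⊆ (extChartAt (𝓡 n) x).source) (hx' : A ⊆ (extChartAt (𝓡 n) x').source) :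
    localDensityMeasure n δ x A = localDensityMeasure n δ x' A := by
  simp only [localDensityMeasure_apply _ _ hA, ofReal_densityComp]
  exact lintegral_overlap (fun q => ENNReal.ofReal (δ q)) hA hx hx'

theorem densityMeasure_apply (δ : M → ℝ) {A : Set M} (hA : MeasurableSet A) :
    densityMeasure n δ A = ∑' x : chartIndices n M,
      localDensityMeasure n δ x (A ∩ chartIndex n ⁻¹' {(x : M)}) :=
  iSup_measure_apply (ν := localDensityMeasure n δ) (fun x => (isOpen_source x).measurableSet)
    (localDensityMeasure_compl δ) (localDensityMeasure_compat δ) (countable_chartIndices n M)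
    (chartIndex_mem n) (measurableSet_chartIndex n) (mem_source_chartIndex n) hA

theorem densityMeasure_apply_of_subset (δ : M → ℝ) {A : Set M} (hA : MeasurableSet A) {x : M}
    (hx : A ⊆ (extChartAt (𝓡 n) x).source) :
    densityMeasure n δ A = ∫⁻ y in dom x ∩ (extChartAt (𝓡 n) x).symm ⁻¹' A,
      ENNReal.ofReal (densityComp δ x y) := by
  rw [← localDensityMeasure_apply δ x hA]
  exact iSup_measure_apply_of_subset (ν := localDensityMeasure n δ)
    (fun x => (isOpen_source x).measurableSet)
    (localDensityMeasure_compl δ) (localDensityMeasure_compat δ) (countable_chartIndices n M)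
    (chartIndex_mem n) (measurableSet_chartIndex n) (mem_source_chartIndex n) hA hx

theorem densityMeasure_eq_zero {δ : M → ℝ} {A : Set M} (hA : MeasurableSet A)
    (h : ∀ q ∈ A, δ q = 0) : densityMeasure n δ A = 0 := by
  rw [densityMeasure_apply δ hA]
  refine ENNReal.tsum_eq_zero.2 fun x => ?_
  have hA' := hA.inter (measurableSet_chartIndex n (x : M))
  rw [localDensityMeasure_apply _ _ hA',
    setLIntegral_congr_fun (g := 0) (measurableSet_dom_inter _ hA') fun y hy => ?_]
  · simp
  · rw [ofReal_densityComp, h _ hy.2.1]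
    simp

variable (n) in
/-- The component of a density in the chart selected by `chartIndex`. -/
def baseDensity (δ : M → ℝ) (q : M) : ℝ := δ q * jac (n := n) (chartIndex n q) q

variable (n) in
/-- A density with continuous components. -/
def ContinuousDensity (δ : M → ℝ) : Prop :=
  ∀ x : M, ContinuousOn (densityComp (n := n) δ x) (dom x)

theorem densityComp_extChartAt (δ : M → ℝ) {x q : M} (hq : q ∈ (extChartAt (𝓡 n) x).source) :
    densityComp δ x (extChartAt (𝓡 n) x q) = δ q * jac (n := n) x q := by
  simp only [densityComp, (extChartAt (𝓡 n) x).left_inv hq]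

theorem ContinuousDensity.measurable {δ : M → ℝ} (h : ContinuousDensity n δ) :
    Measurable (baseDensity n δ) := by
  classical
  refine measurable_of_fibres (countable_chartIndices n M) (chartIndex_mem n)
    (measurableSet_chartIndex n) fun x => ?_
  refine ⟨(extChartAt (𝓡 n) x).source.piecewise
    (fun q => densityComp (n := n) δ x (extChartAt (𝓡 n) x q)) 0, ?_, fun q hq => ?_⟩
  · exact ContinuousOn.measurable_piecewise
      ((h x).comp (continuousOn_extChartAt x) (fun q hq => (extChartAt (𝓡 n) x).map_source hq))
      continuousOn_const (isOpen_source x).measurableSet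
  · have hs := mem_source_of_chartIndex_eq n hq
    rw [Set.piecewise_eq_of_mem _ _ _ hs, densityComp_extChartAt δ hs, baseDensity, hq]

/-- Positive and negative parts of every density are expressed through a single measure that does
not depend on `δ`. Densities can from here on be handled as functions integrable against
`baseMeasure`. -/
theorem densityMeasure_univ {δ : M → ℝ} (h : Measurable (baseDensity n δ)) :
    densityMeasure n δ univ = ∫⁻ q, ENNReal.ofReal (baseDensity n δ q) ∂(baseMeasure n M) := by
  rw [densityMeasure_apply δ MeasurableSet.univ, lintegral_baseMeasure h.ennreal_ofReal]
  refine tsum_congr fun x => ?_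
  have hx := measurableSet_chartIndex n (x : M)
  rw [univ_inter, localDensityMeasure_apply _ _ hx]
  refine setLIntegral_congr_fun (measurableSet_dom_inter _ hx) fun y hy => ?_
  have : chartIndex n ((extChartAt (𝓡 n) (x : M)).symm y) = x := hy.2
  simp only [densityComp, baseDensity, this]

theorem baseDensity_neg (δ : M → ℝ) : baseDensity n (fun q => -δ q) = -baseDensity n δ := by
  ext q; simp [baseDensity]

theorem densityIntegrable_iff {δ : M → ℝ} (h : Measurable (baseDensity n δ)) :
    DensityIntegrable n δ ↔ Integrable (baseDensity n δ) (baseMeasure n M) := by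
  have h' : Measurable (baseDensity n fun q => -δ q) := by rw [baseDensity_neg]; exact h.neg
  rw [DensityIntegrable, densityMeasure_univ h, densityMeasure_univ h', baseDensity_neg]
  constructor
  · rintro ⟨h1, h2⟩
    refine ⟨h.aestronglyMeasurable, lt_of_le_of_lt (lintegral_mono fun q => ?_)
      ((lintegral_add_left h.ennreal_ofReal _).trans_lt
        (ENNReal.add_lt_top.2 ⟨h1.lt_top, h2.lt_top⟩))⟩
    rw [Real.enorm_eq_ofReal_abs]
    rcases le_total 0 (baseDensity n δ q) with h0 | h0
    · rw [abs_of_nonneg h0]; exact le_self_add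
    · rw [abs_of_nonpos h0]; exact le_add_self
  · exact fun hi => ⟨hi.lintegral_lt_top.ne, hi.neg.lintegral_lt_top.ne⟩

theorem densityIntegral_eq {δ : M → ℝ} (h : Measurable (baseDensity n δ))
    (hi : Integrable (baseDensity n δ) (baseMeasure n M)) :
    densityIntegral n δ = ∫ q, baseDensity n δ q ∂(baseMeasure n M) := by
  have h' : Measurable (baseDensity n fun q => -δ q) := by rw [baseDensity_neg]; exact h.neg
  rw [densityIntegral, densityMeasure_univ h, densityMeasure_univ h', baseDensity_neg,
    integral_eq_lintegral_pos_part_sub_lintegral_neg_part hi]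
  rfl

theorem densityIntegral_of_support {δ : M → ℝ} {x : M} (h : Measurable (baseDensity n δ))
    (hs : ∀ q ∉ (extChartAt (𝓡 n) x).source, δ q = 0)
    (hi : IntegrableOn (densityComp (n := n) δ x) (dom x)) :
    Integrable (baseDensity n δ) (baseMeasure n M) ∧
      ∫ q, baseDensity n δ q ∂(baseMeasure n M) = ∫ y in dom x, densityComp (n := n) δ x y := by
  have key : ∀ η : M → ℝ, (∀ q ∉ (extChartAt (𝓡 n) x).source, η q = 0) →
      densityMeasure n η univ = ∫⁻ y in dom x, ENNReal.ofReal (densityComp (n := n) η x y) := by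
    intro η hη
    have hU := (isOpen_source (n := n) x).measurableSet
    rw [← measure_add_measure_compl hU, densityMeasure_eq_zero hU.compl hη, add_zero,
      densityMeasure_apply_of_subset η hU subset_rfl]
    congr 2
    exact inter_eq_left.2 fun y hy => (extChartAt (𝓡 n) x).map_target hy
  have hneg : ∀ y, densityComp (fun q => -δ q) x y = -densityComp (n := n) δ x y := fun y => by
    simp [densityComp]
  have h1 := key δ hs
  have h2 := key (fun q => -δ q) (fun q hq => by simp [hs q hq])
  simp only [hneg] at h2
  have hint : Integrable (baseDensity n δ) (baseMeasure n M) := by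
    rw [← densityIntegrable_iff h, DensityIntegrable, h1, h2]
    exact ⟨hi.lintegral_lt_top.ne, hi.neg.lintegral_lt_top.ne⟩
  refine ⟨hint, ?_⟩
  rw [← densityIntegral_eq h hint, densityIntegral, h1, h2,
    integral_eq_lintegral_pos_part_sub_lintegral_neg_part hi]

/-- Finiteness passes to subsets and finite unions, so by compactness only a small neighbourhood of
each point matters. There the component of `δ` is continuous on a compact subset of one chart. -/
theorem densityMeasure_lt_top_of_isCompact {δ : M → ℝ} (h : ContinuousDensity n δ) [T2Space M]
    {K : Set M} (hK : IsCompact K) : densityMeasure n δ K < ⊤ := by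
  refine IsCompact.induction_on (p := fun S => densityMeasure n δ S < ⊤) hK (by simp)
    (fun s t hst ht => (measure_mono hst).trans_lt ht)
    (fun s t hs ht => (measure_union_le s t).trans_lt (ENNReal.add_lt_top.2 ⟨hs, ht⟩))
    fun q _ => ?_
  obtain ⟨C, hCn, hCs, hC⟩ : ∃ C ∈ 𝓝 (extChartAt (𝓡 n) q q), C ⊆ dom (n := n) q ∧ IsCompact C :=
    local_compact_nhds ((isOpen_dom q).mem_nhds (mem_extChartAt_target q))
  refine ⟨(extChartAt (𝓡 n) q).symm '' C, mem_nhdsWithin_of_mem_nhds ?_, ?_⟩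
  · have : (extChartAt (𝓡 n) q).source ∩ extChartAt (𝓡 n) q ⁻¹' C ∈ 𝓝 q :=
      inter_mem (extChartAt_source_mem_nhds q) ((continuousAt_extChartAt q).preimage_mem_nhds hCn)
    filter_upwards [this] with p hp
    exact ⟨_, hp.2, (extChartAt (𝓡 n) q).left_inv hp.1⟩
  · have hcomp : IsCompact ((extChartAt (𝓡 n) q).symm '' C) :=
      hC.image_of_continuousOn ((continuousOn_extChartAt_symm q).mono hCs)
    have hsub : (extChartAt (𝓡 n) q).symm '' C ⊆ (extChartAt (𝓡 n) q).source := by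
      rintro _ ⟨y, hy, rfl⟩
      exact (extChartAt (𝓡 n) q).map_target (hCs hy)
    rw [densityMeasure_apply_of_subset δ hcomp.measurableSet hsub]
    have heq : dom q ∩ (extChartAt (𝓡 n) q).symm ⁻¹' ((extChartAt (𝓡 n) q).symm '' C) = C := by
      ext y
      constructor
      · rintro ⟨hy, y', hy', h⟩
        have := congrArg (extChartAt (𝓡 n) q) h
        rw [(extChartAt (𝓡 n) q).right_inv (hCs hy'), (extChartAt (𝓡 n) q).right_inv hy] at this
        exact this ▸ hy'
      · exact fun hy => ⟨hCs hy, mem_image_of_mem _ hy⟩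
    rw [heq]
    exact (((h q).mono hCs).integrableOn_compact hC).lintegral_lt_top

theorem ContinuousDensity.neg {δ : M → ℝ} (h : ContinuousDensity n δ) :
    ContinuousDensity n fun q => -δ q := fun x => by
  have : densityComp (n := n) (fun q => -δ q) x = -densityComp (n := n) δ x := by
    ext y; simp [densityComp]
  rw [this]
  exact (h x).neg

theorem ContinuousDensity.integrable_of_compact {δ : M → ℝ} (h : ContinuousDensity n δ)
    [T2Space M] {K : Set M} (hK : IsCompact K) (hs : ∀ q ∉ K, δ q = 0) :
    Integrable (baseDensity n δ) (baseMeasure n M) := by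
  rw [← densityIntegrable_iff h.measurable]
  have key : ∀ η : M → ℝ, ContinuousDensity n η → (∀ q ∉ K, η q = 0) →
      densityMeasure n η univ ≠ ⊤ := by
    intro η hη hsη
    rw [← measure_add_measure_compl hK.measurableSet,
      densityMeasure_eq_zero hK.measurableSet.compl hsη, add_zero]
    exact (densityMeasure_lt_top_of_isCompact hη hK).ne
  exact ⟨key δ h hs, key _ h.neg fun q hq => by simp [hs q hq]⟩

end Charts

end

/-! ### The Liouville measure and integration over the fibres -/

section

variable {n : ℕ} {M : Type*} [TopologicalSpace M] [ChartedSpace (Coord n) M]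
  [IsManifold (𝓡 n) ∞ M]

theorem det_adjoint_coord (A : Coord n →L[ℝ] Coord n) :
    (ContinuousLinearMap.adjoint A).det = A.det := by
  have h : ∀ B : Coord n →L[ℝ] Coord n, B.det = (LinearMap.toMatrix
      (EuclideanSpace.basisFun (Fin n) ℝ).toBasis (EuclideanSpace.basisFun (Fin n) ℝ).toBasis
      (B : Coord n →ₗ[ℝ] Coord n)).det := fun B => (LinearMap.det_toMatrix _ _).symm
  have h2 : ((ContinuousLinearMap.adjoint A : Coord n →L[ℝ] Coord n) : Coord n →ₗ[ℝ] Coord n)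
      = LinearMap.adjoint (A : Coord n →ₗ[ℝ] Coord n) := rfl
  rw [h, h, h2, LinearMap.toMatrix_adjoint, Matrix.det_conjTranspose]
  simp

theorem covec_comp (A : Coord n →L[ℝ] Coord n) (v : Coord n) :
    (covec v).comp A = covec (ContinuousLinearMap.adjoint A v) := by
  ext w
  simp only [ContinuousLinearMap.comp_apply, covec_apply]
  exact (ContinuousLinearMap.adjoint_inner_left A w v).symm

theorem canon_eq_cotPoint {x : M} {y : Coord n} (hy : y ∈ dom x) (v : Coord n) :
    canon x (y, v) = cotPoint ((extChartAt (𝓡 n) x).symm y)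
      (ContinuousLinearMap.adjoint (tangentCoordChange (𝓡 n) ((extChartAt (𝓡 n) x).symm y) x
        ((extChartAt (𝓡 n) x).symm y)) v) := by
  rw [canon_eq hy]
  exact congrArg (fun p : Coord n →L[ℝ] ℝ =>
    (⟨(extChartAt (𝓡 n) x).symm y, p⟩ : Cotangent n M)) (covec_comp _ v)

theorem cotPoint_eq_canon (q : M) (v : Coord n) :
    cotPoint q v = canon q (extChartAt (𝓡 n) q q, v) := by
  have h : tangentCoordChange (𝓡 n) q q q = ContinuousLinearMap.id ℝ (Coord n) := by
    ext1 w
    rw [tangentCoordChange_self (mem_extChartAt_source q)]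
    rfl
  rw [canon_eq (mem_extChartAt_target q), extChartAt_to_inv, h]
  exact congrArg (fun p : Coord n →L[ℝ] ℝ => (⟨q, p⟩ : Cotangent n M))
    (ContinuousLinearMap.comp_id (covec v)).symm

theorem continuous_canon_right {x : M} {y : Coord n} (hy : y ∈ dom x) :
    Continuous fun v : Coord n => canon x (y, v) := by
  refine (continuousOn_canon x).comp_continuous (by fun_prop) fun v => ⟨hy, mem_univ _⟩

theorem continuous_cotPoint (q : M) : Continuous (cotPoint (n := n) q) := by
  have : cotPoint (n := n) q = fun v => canon q (extChartAt (𝓡 n) q q, v) :=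
    funext (cotPoint_eq_canon q)
  rw [this]
  exact continuous_canon_right (mem_extChartAt_target q)

theorem abs_det_tangentCoordChange_symm {x q : M} (hx : q ∈ (extChartAt (𝓡 n) x).source) :
    |(tangentCoordChange (𝓡 n) q x q).det| = (jac (n := n) x q)⁻¹ := by
  have h1 := congrArg ContinuousLinearMap.det
    (tangentCoordChange_comp_self hx (mem_extChartAt_source (I := 𝓡 n) q))
  have h2 : ((tangentCoordChange (𝓡 n) x q q).comp (tangentCoordChange (𝓡 n) q x q)).det
      = (tangentCoordChange (𝓡 n) x q q).det * (tangentCoordChange (𝓡 n) q x q).det :=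
    LinearMap.det_comp _ _
  have h3 : (ContinuousLinearMap.id ℝ (Coord n)).det = 1 := LinearMap.det_id
  rw [h2, h3] at h1
  refine eq_inv_of_mul_eq_one_right ?_
  rw [jac, ← abs_mul, h1, abs_one]

/-- Momentum coordinates change by the adjoint of the coordinate change from q to `x`. Its
determinant has absolute value the inverse of `jac`, so the image of Lebesgue measure acquires the
factor `jac`. -/
theorem map_fibre {x q : M} (hx : q ∈ (extChartAt (𝓡 n) x).source) :
    (volume : Measure (Coord n)).map
      (ContinuousLinearMap.adjoint (tangentCoordChange (𝓡 n) q x q)) =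
      ENNReal.ofReal (jac (n := n) x q) • volume := by
  have hd : (ContinuousLinearMap.adjoint (tangentCoordChange (𝓡 n) q x q)).det ≠ 0 := by
    rw [det_adjoint_coord]
    exact det_tangentCoordChange_ne_zero (mem_extChartAt_source q) hx
  have := Measure.map_linearMap_addHaar_eq_smul_addHaar (volume : Measure (Coord n)) hd
  refine this.trans ?_
  congr 2
  change |(ContinuousLinearMap.adjoint (tangentCoordChange (𝓡 n) q x q)).det⁻¹| = _
  rw [det_adjoint_coord, abs_inv, abs_det_tangentCoordChange_symm hx, inv_inv]

theorem measurableEmbedding_fibre {x q : M} (hx : q ∈ (extChartAt (𝓡 n) x).source) :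
    MeasurableEmbedding (ContinuousLinearMap.adjoint (tangentCoordChange (𝓡 n) q x q)) := by
  have hd : (ContinuousLinearMap.adjoint (tangentCoordChange (𝓡 n) q x q)).det ≠ 0 := by
    rw [det_adjoint_coord]
    exact det_tangentCoordChange_ne_zero (mem_extChartAt_source q) hx
  have hk : LinearMap.ker ((ContinuousLinearMap.adjoint (tangentCoordChange (𝓡 n) q x q) :
      Coord n →L[ℝ] Coord n) : Coord n →ₗ[ℝ] Coord n) = ⊥ := by
    by_contra h
    exact hd (LinearMap.det_eq_zero_iff_ker_ne_bot.2 h)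
  exact (LinearMap.isClosedEmbedding_of_injective hk).measurableEmbedding

theorem integral_canon {E : Type*} [NormedAddCommGroup E] [NormedSpace ℝ E]
    (Φ : Cotangent n M → E) {x : M} {y : Coord n} (hy : y ∈ dom x) :
    ∫ v, Φ (canon x (y, v)) = jac (n := n) x ((extChartAt (𝓡 n) x).symm y) •
      ∫ v, Φ (cotPoint ((extChartAt (𝓡 n) x).symm y) v) := by
  have hq := (extChartAt (𝓡 n) x).map_target hy
  simp only [canon_eq_cotPoint hy]
  rw [← (measurableEmbedding_fibre hq).integral_map
    (fun v => Φ (cotPoint ((extChartAt (𝓡 n) x).symm y) v)), map_fibre hq, integral_smul_measure,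
    ENNReal.toReal_ofReal (jac_pos hq).le]

theorem densityComp_fibreIntegral (Φ : Cotangent n M → ℝ) {x : M} {y : Coord n} (hy : y ∈ dom x) :
    densityComp (fun q => ∫ v, Φ (cotPoint q v)) x y = ∫ v, Φ (canon x (y, v)) := by
  rw [integral_canon Φ hy, smul_eq_mul, mul_comm]
  rfl

variable (M) in
/-- The symplectic volume of `T*U`, where `U` is the domain of the preferred chart at `x`. -/
def localLiouville (x : M) : Measure (Cotangent n M) :=
  ((volume : Measure (Coord n × Coord n)).restrict (dom x ×ˢ univ)).map (canon x)

theorem measurableSet_dom_prod (x : M) : MeasurableSet (dom (n := n) x ×ˢ (univ : Set (Coord n))) :=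
  (isOpen_dom x).measurableSet.prod MeasurableSet.univ

theorem measurableSet_canon_preimage (x : M) {A : Set (Cotangent n M)} (hA : MeasurableSet A) :
    MeasurableSet ((dom x ×ˢ univ) ∩ canon x ⁻¹' A) := by
  have h := (continuousOn_iff_continuous_domRestrict.1 (continuousOn_canon x)).measurable hA
  have := (MeasurableEmbedding.subtype_coe (measurableSet_dom_prod x)).measurableSet_image.2 h
  convert! this using 1
  ext y
  constructor
  · rintro ⟨hy, hA⟩
    exact ⟨⟨y, hy⟩, hA, rfl⟩
  · rintro ⟨⟨y, hy⟩, hA, rfl⟩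
    exact ⟨hy, hA⟩

theorem localLiouville_apply (x : M) {A : Set (Cotangent n M)} (hA : MeasurableSet A) :
    localLiouville M x A = ∫⁻ y in dom x, volume {v : Coord n | canon x (y, v) ∈ A} := by
  have hd := (isOpen_dom (n := n) x).measurableSet
  unfold localLiouville
  rw [Measure.map_apply_of_aemeasurable
    ((continuousOn_canon x).aemeasurable (measurableSet_dom_prod x)) hA,
    Measure.restrict_apply' (measurableSet_dom_prod x), inter_comm, Measure.volume_eq_prod,
    Measure.prod_apply (measurableSet_canon_preimage x hA), ← lintegral_indicator hd]
  refine lintegral_congr fun y => ?_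
  by_cases hy : y ∈ dom x
  · rw [indicator_of_mem hy]
    congr 1
    ext v
    simp [hy]
  · rw [indicator_of_notMem hy]
    convert! measure_empty (μ := (volume : Measure (Coord n)))
    ext v
    simp [hy]

theorem volume_canon_preimage {x : M} {y : Coord n} (hy : y ∈ dom x) (A : Set (Cotangent n M))
    (hA : MeasurableSet A) :
    volume {v : Coord n | canon x (y, v) ∈ A}
      = ENNReal.ofReal (jac (n := n) x ((extChartAt (𝓡 n) x).symm y)) *
        volume {v : Coord n | cotPoint ((extChartAt (𝓡 n) x).symm y) v ∈ A} := by
  have hq := (extChartAt (𝓡 n) x).map_target hy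
  have hm : MeasurableSet {v : Coord n | cotPoint ((extChartAt (𝓡 n) x).symm y) v ∈ A} :=
    (continuous_cotPoint _).measurable hA
  have := congrArg (fun μ : Measure (Coord n) =>
    μ {v : Coord n | cotPoint ((extChartAt (𝓡 n) x).symm y) v ∈ A}) (map_fibre hq)
  rw [Measure.map_apply (by fun_prop) hm] at this
  simp only [Measure.smul_apply, smul_eq_mul] at this
  rw [← this]
  simp only [canon_eq_cotPoint hy]
  rfl

/-- Momenta transform contragrediently to positions, so expressing fibre volumes intrinsically
produces exactly the density factor handled by `lintegral_overlap`. This is why dq dp is the same in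
all canonical coordinates. -/
theorem localLiouville_eq (x : M) {A : Set (Cotangent n M)} (hA : MeasurableSet A) :
    localLiouville M x A = ∫⁻ y in dom x,
      ENNReal.ofReal (jac (n := n) x ((extChartAt (𝓡 n) x).symm y)) *
        volume {v : Coord n | cotPoint ((extChartAt (𝓡 n) x).symm y) v ∈ A} := by
  rw [localLiouville_apply x hA]
  exact setLIntegral_congr_fun (isOpen_dom x).measurableSet fun y hy =>
    volume_canon_preimage hy A hA

variable [SecondCountableTopology M] [MeasurableSpace M] [BorelSpace M]

theorem measurable_proj_cotangent : Measurable (TotalSpace.proj : Cotangent n M → M) :=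
  continuous_proj_cotangent.measurable

theorem localLiouville_eq_inter (x : M) {A : Set (Cotangent n M)} (hA : MeasurableSet A)
    {B : Set M} (hAB : A ⊆ TotalSpace.proj ⁻¹' B) (hB : MeasurableSet B) :
    localLiouville M x A = ∫⁻ y in dom x ∩ (extChartAt (𝓡 n) x).symm ⁻¹' B,
      ENNReal.ofReal (jac (n := n) x ((extChartAt (𝓡 n) x).symm y)) *
        volume {v : Coord n | cotPoint ((extChartAt (𝓡 n) x).symm y) v ∈ A} := by
  rw [localLiouville_eq x hA, ← lintegral_indicator (isOpen_dom x).measurableSet,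
    ← lintegral_indicator (measurableSet_dom_inter x hB)]
  refine lintegral_congr fun y => ?_
  by_cases hy : y ∈ dom x
  · by_cases h : (extChartAt (𝓡 n) x).symm y ∈ B
    · rw [indicator_of_mem hy, indicator_of_mem (mem_inter hy h)]
    · rw [indicator_of_mem hy, indicator_of_notMem fun hh => h hh.2]
      convert! mul_zero _
      convert! measure_empty (μ := (volume : Measure (Coord n)))
      ext v
      simp only [mem_ofPred_eq, mem_empty_iff_false, iff_false]
      exact fun hv => h (hAB hv)
  · rw [indicator_of_notMem hy, indicator_of_notMem fun hh => hy hh.1]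

theorem localLiouville_compat (x x' : M) (A : Set (Cotangent n M)) (hA : MeasurableSet A)
    (hx : A ⊆ TotalSpace.proj ⁻¹' (extChartAt (𝓡 n) x).source)
    (hx' : A ⊆ TotalSpace.proj ⁻¹' (extChartAt (𝓡 n) x').source) :
    localLiouville M x A = localLiouville M x' A := by
  have hB := (isOpen_source (n := n) x).inter (isOpen_source (n := n) x')
  have hAB : A ⊆ TotalSpace.proj ⁻¹' ((extChartAt (𝓡 n) x).source ∩ (extChartAt (𝓡 n) x').source) :=
    fun z hz => ⟨hx hz, hx' hz⟩
  rw [localLiouville_eq_inter x hA hAB hB.measurableSet,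
    localLiouville_eq_inter x' hA hAB hB.measurableSet]
  exact lintegral_overlap (fun q => volume {v : Coord n | cotPoint q v ∈ A}) hB.measurableSet
    inter_subset_left inter_subset_right

theorem measurableSet_proj_source (x : M) : MeasurableSet
    (TotalSpace.proj ⁻¹' (extChartAt (𝓡 n) x).source : Set (Cotangent n M)) :=
  measurable_proj_cotangent (isOpen_source x).measurableSet

theorem localLiouville_compl (x : M) : localLiouville M x
    (TotalSpace.proj ⁻¹' (extChartAt (𝓡 n) x).source : Set (Cotangent n M))ᶜ = 0 := by
  rw [localLiouville_eq_inter x (measurableSet_proj_source x).compl subset_rfl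
    (isOpen_source x).measurableSet.compl]
  have : dom (n := n) x ∩ (extChartAt (𝓡 n) x).symm ⁻¹' (extChartAt (𝓡 n) x).sourceᶜ = ∅ := by
    ext y
    simp only [mem_inter_iff, mem_preimage, mem_compl_iff, mem_empty_iff_false, iff_false, not_and,
      not_not]
    exact fun hy => (extChartAt (𝓡 n) x).map_target hy
  rw [this, Measure.restrict_empty, lintegral_zero_measure]

theorem liouville_apply {A : Set (Cotangent n M)} (hA : MeasurableSet A) :
    liouville n M A = ∑' x : chartIndices n M, localLiouville M (x : M)
      (A ∩ (fun z => chartIndex n z.1) ⁻¹' {(x : M)}) :=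
  iSup_measure_apply (ν := localLiouville M) measurableSet_proj_source
    localLiouville_compl localLiouville_compat (countable_chartIndices n M)
    (fun z => chartIndex_mem n z.1)
    (fun x => measurable_proj_cotangent (measurableSet_chartIndex n x))
    (fun z => mem_source_chartIndex n z.1) hA

theorem liouville_apply_of_subset {A : Set (Cotangent n M)} (hA : MeasurableSet A) {x : M}
    (hx : A ⊆ TotalSpace.proj ⁻¹' (extChartAt (𝓡 n) x).source) :
    liouville n M A = localLiouville M x A :=
  iSup_measure_apply_of_subset (ν := localLiouville M) measurableSet_proj_source
    localLiouville_compl localLiouville_compat (countable_chartIndices n M)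
    (fun z => chartIndex_mem n z.1)
    (fun x => measurable_proj_cotangent (measurableSet_chartIndex n x))
    (fun z => mem_source_chartIndex n z.1) hA hx

/-- The identification of `M × ℝⁿ` with `T*M` by the charts selected by `chartIndex`. -/
def indexedCanon (w : M × Coord n) : Cotangent n M :=
  canon (chartIndex n w.1) (extChartAt (𝓡 n) (chartIndex n w.1) w.1, w.2)

theorem measurable_indexedCanon : Measurable (indexedCanon (n := n) (M := M)) := by
  classical
  refine measurable_of_fibres (c := fun w : M × Coord n => chartIndex n w.1)
    (countable_chartIndices n M) (fun w => chartIndex_mem n w.1)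
    (fun x => measurable_fst (measurableSet_chartIndex n x)) fun x => ?_
  rcases isEmpty_or_nonempty (M × Coord n) with hE | ⟨⟨w₀⟩⟩
  · exact ⟨fun w => (hE.elim w), measurable_of_empty _, fun w => hE.elim w⟩
  have hs := (isOpen_source (n := n) x).prod (isOpen_univ (X := Coord n))
  refine ⟨((extChartAt (𝓡 n) x).source ×ˢ univ).piecewise
    (fun w : M × Coord n => canon x (extChartAt (𝓡 n) x w.1, w.2))
    (fun _ => indexedCanon w₀), ?_, fun w hw => ?_⟩
  · refine ContinuousOn.measurable_piecewise ?_ continuousOn_const hs.measurableSet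
    refine (continuousOn_canon x).comp (ContinuousOn.prodMk ?_ continuous_snd.continuousOn)
      (fun w hw => mem_prod.2 ⟨(extChartAt (𝓡 n) x).map_source hw.1, mem_univ _⟩)
    exact (continuousOn_extChartAt x).comp continuous_fst.continuousOn fun w hw => hw.1
  · have hm := mem_source_of_chartIndex_eq n hw
    rw [Set.piecewise_eq_of_mem _ _ _ (mem_prod.2 ⟨hm, mem_univ _⟩), indexedCanon, hw]

/-- The selected charts trivialise T*M measurably, though not continuously in general. The Liouville
measure becomes the image of a product measure, which makes Fubini available. -/
theorem liouville_eq_map :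
    liouville n M = ((baseMeasure n M).prod volume).map indexedCanon := by
  ext A hA
  have hA' := measurable_indexedCanon hA
  rw [liouville_apply hA, Measure.map_apply measurable_indexedCanon hA,
    Measure.prod_apply hA', lintegral_baseMeasure (measurable_measure_prodMk_left hA')]
  refine tsum_congr fun x => ?_
  have hx := measurableSet_chartIndex n (x : M)
  have hx' : MeasurableSet ((fun z : Cotangent n M => chartIndex n z.1) ⁻¹' {(x : M)}) :=
    measurable_proj_cotangent hx
  rw [localLiouville_eq_inter (x : M) (hA.inter hx') (B := chartIndex n ⁻¹' {(x : M)})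
    (fun z hz => hz.2) hx]
  refine setLIntegral_congr_fun (measurableSet_dom_inter _ hx) fun y hy => ?_
  rw [← volume_canon_preimage hy.1 _ (hA.inter hx')]
  have h : chartIndex n ((extChartAt (𝓡 n) (x : M)).symm y) = x := hy.2
  congr 1
  ext v
  simp only [mem_inter_iff, mem_preimage, mem_singleton_iff, mem_ofPred_eq, proj_canon hy.1, h,
    and_true, indexedCanon, (extChartAt (𝓡 n) (x : M)).right_inv hy.1]

theorem integral_indexedCanon (Φ : Cotangent n M → ℝ) (q : M) :
    ∫ v, Φ (indexedCanon (q, v)) = baseDensity n (fun q => ∫ v, Φ (cotPoint q v)) q := by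
  have hq := mem_source_chartIndex n q
  unfold indexedCanon
  rw [integral_canon Φ ((extChartAt (𝓡 n) _).map_source hq), (extChartAt (𝓡 n) _).left_inv hq,
    smul_eq_mul, mul_comm, baseDensity]

/-- Integration over the fibres of `T*M`. -/
theorem integral_liouville {Φ : Cotangent n M → ℝ} (h : Integrable Φ (liouville n M)) :
    Integrable (baseDensity n fun q => ∫ v, Φ (cotPoint q v)) (baseMeasure n M) ∧
    ∫ z, Φ z ∂(liouville n M)
      = ∫ q, baseDensity n (fun q => ∫ v, Φ (cotPoint q v)) q ∂(baseMeasure n M) := by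
  rw [liouville_eq_map] at h ⊢
  have h' : Integrable (fun w => Φ (indexedCanon w)) ((baseMeasure n M).prod volume) :=
    h.comp_measurable measurable_indexedCanon
  rw [integral_map measurable_indexedCanon.aemeasurable h.aestronglyMeasurable,
    integral_prod _ h']
  have hb := h'.integral_prod_left
  simp only [integral_indexedCanon] at hb ⊢
  exact ⟨hb, trivial⟩

end

/-! ### Compact sets of T*M and local integrability -/

section

variable {n : ℕ} {M : Type*} [TopologicalSpace M] [ChartedSpace (Coord n) M]
  [IsManifold (𝓡 n) ∞ M]

theorem isOpen_proj_source (x : M) : IsOpen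
    (TotalSpace.proj ⁻¹' (extChartAt (𝓡 n) x).source : Set (Cotangent n M)) :=
  (isOpen_extChartAt_source x).preimage continuous_proj_cotangent

theorem isOpen_dom_prod (x : M) : IsOpen (dom (n := n) x ×ˢ (univ : Set (Coord n))) :=
  (isOpen_dom x).prod isOpen_univ

/-- Points over different base points are separated by the projection, points over the same one by
canonical coordinates. Compact supports and bump functions on T*M depend on this. -/
theorem t2Space_cotangent [T2Space M] : T2Space (Cotangent n M) := by
  refine ⟨fun z z' hne => ?_⟩
  by_cases h : z.1 = z'.1
  · set x := z.1
    have hz : z ∈ (TotalSpace.proj ⁻¹' (extChartAt (𝓡 n) x).source : Set (Cotangent n M)) :=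
      mem_extChartAt_source (I := 𝓡 n) x
    have hz' : z' ∈ (TotalSpace.proj ⁻¹' (extChartAt (𝓡 n) x).source : Set (Cotangent n M)) := by
      rw [mem_preimage, ← h]; exact hz
    have hc : canonCoord x z ≠ canonCoord x z' := fun hc => hne (by
      rw [← canon_canonCoord hz, hc, canon_canonCoord hz'])
    obtain ⟨u, v, hu, hv, hzu, hzv, huv⟩ := t2_separation hc
    refine ⟨_, _, (continuousOn_canonCoord x).isOpen_inter_preimage (isOpen_proj_source x) hu,
      (continuousOn_canonCoord x).isOpen_inter_preimage (isOpen_proj_source x) hv,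
      ⟨hz, hzu⟩, ⟨hz', hzv⟩, ?_⟩
    exact Set.disjoint_left.2 fun w hw hw' => Set.disjoint_left.1 huv hw.2 hw'.2
  · obtain ⟨u, v, hu, hv, hzu, hzv, huv⟩ := t2_separation h
    exact ⟨_, _, hu.preimage continuous_proj_cotangent, hv.preimage continuous_proj_cotangent,
      hzu, hzv, huv.preimage _⟩

/-- Over a compact set of base points, a compact subset of `T*M` has bounded momenta. -/
theorem exists_momentum_bound [T2Space M] {S : Set (Cotangent n M)} (hS : IsCompact S) {x : M}
    {K : Set (Coord n)} (hK : IsCompact K) (hKx : K ⊆ dom x) :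
    ∃ r : ℝ, ∀ y ∈ K, ∀ v : Coord n, canon x (y, v) ∈ S → ‖v‖ ≤ r := by
  have := t2Space_cotangent (n := n) (M := M)
  have hN : IsCompact ((extChartAt (𝓡 n) x).symm '' K) :=
    hK.image_of_continuousOn ((continuousOn_extChartAt_symm x).mono hKx)
  have hS' : IsCompact (S ∩ TotalSpace.proj ⁻¹' ((extChartAt (𝓡 n) x).symm '' K)) :=
    hS.inter_right (hN.isClosed.preimage continuous_proj_cotangent)
  have himg : IsCompact (canonCoord x '' (S ∩ TotalSpace.proj ⁻¹' ((extChartAt (𝓡 n) x).symm '' K))) := by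
    refine hS'.image_of_continuousOn ((continuousOn_canonCoord x).mono ?_)
    rintro z ⟨_, y, hy, hz⟩
    rw [mem_preimage, ← hz]
    exact (extChartAt (𝓡 n) x).map_target (hKx hy)
  obtain ⟨r, hr⟩ := himg.isBounded.exists_norm_le
  refine ⟨r, fun y hy v hv => ?_⟩
  have h1 : (y, v) ∈ canonCoord x '' (S ∩ TotalSpace.proj ⁻¹' ((extChartAt (𝓡 n) x).symm '' K)) := by
    refine ⟨canon x (y, v), ⟨hv, y, hy, ?_⟩, canonCoord_canon (w := (y, v)) (hKx hy)⟩
    rw [proj_canon (hKx hy)]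
  exact (norm_snd_le (y, v)).trans (hr _ h1)

theorem localLiouville_apply' (x : M) {A : Set (Cotangent n M)} (hA : MeasurableSet A) :
    localLiouville M x A = volume ((dom x ×ˢ univ) ∩ canon x ⁻¹' A) := by
  unfold localLiouville
  rw [Measure.map_apply_of_aemeasurable
    ((continuousOn_canon x).aemeasurable (measurableSet_dom_prod x)) hA,
    Measure.restrict_apply' (measurableSet_dom_prod x), inter_comm]

variable [SecondCountableTopology M] [MeasurableSpace M] [BorelSpace M]

theorem liouville_restrict_chart [T2Space M] {x : M} {C : Set (Coord n)} (hC : IsCompact C)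
    (hCx : C ⊆ dom x) :
    (liouville n M).restrict (TotalSpace.proj ⁻¹' ((extChartAt (𝓡 n) x).symm '' C))
      = ((volume : Measure (Coord n × Coord n)).restrict (C ×ˢ univ)).map (canon x) := by
  have hN : IsCompact ((extChartAt (𝓡 n) x).symm '' C) :=
    hC.image_of_continuousOn ((continuousOn_extChartAt_symm x).mono hCx)
  have hNm : MeasurableSet (TotalSpace.proj ⁻¹' ((extChartAt (𝓡 n) x).symm '' C) :
      Set (Cotangent n M)) := measurable_proj_cotangent hN.measurableSet
  have hCm : MeasurableSet (C ×ˢ (univ : Set (Coord n))) := hC.measurableSet.prod .univ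
  ext A hA
  rw [Measure.restrict_apply hA, liouville_apply_of_subset (hA.inter hNm) (x := x),
    localLiouville_apply' x (hA.inter hNm), Measure.map_apply_of_aemeasurable _ hA,
    Measure.restrict_apply' hCm]
  · congr 1
    ext ⟨y, v⟩
    simp only [mem_inter_iff, mem_prod, mem_univ, and_true, mem_preimage, mem_image]
    constructor
    · rintro ⟨hy, hA, y', hy', h⟩
      rw [proj_canon hy] at h
      have := congrArg (extChartAt (𝓡 n) x) h
      rw [(extChartAt (𝓡 n) x).right_inv (hCx hy'), (extChartAt (𝓡 n) x).right_inv hy] at this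
      exact ⟨hA, this ▸ hy'⟩
    · rintro ⟨hA, hy⟩
      exact ⟨hCx hy, hA, y, hy, (proj_canon (hCx hy) v).symm⟩
  · exact ((continuousOn_canon x).mono (prod_mono hCx subset_rfl)).aemeasurable hCm
  · rintro z ⟨_, y, hy, hz⟩
    rw [mem_preimage, ← hz]
    exact (extChartAt (𝓡 n) x).map_target (hCx hy)

/-- Local finiteness makes continuous compactly supported functions integrable. With positivity on
open sets, proved next, it underlies the uniqueness of functional derivatives. -/
instance isLocallyFiniteMeasure_liouville : IsLocallyFiniteMeasure (liouville n M) := by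
  refine ⟨fun z => ?_⟩
  set x := z.1
  have hz : z.1 ∈ (extChartAt (𝓡 n) x).source := mem_extChartAt_source x
  obtain ⟨C, hC, hCn⟩ := exists_compact_mem_nhds (canonCoord x z)
  have hA : TotalSpace.proj ⁻¹' (extChartAt (𝓡 n) x).source ∩ canonCoord x ⁻¹' (interior C) ∈ 𝓝 z :=
    ((continuousOn_canonCoord x).isOpen_inter_preimage (isOpen_proj_source x)
      isOpen_interior).mem_nhds ⟨hz, mem_interior_iff_mem_nhds.2 hCn⟩
  refine ⟨_, hA, ?_⟩
  have hAm := ((continuousOn_canonCoord x).isOpen_inter_preimage (isOpen_proj_source (n := n) x)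
      (isOpen_interior (s := C))).measurableSet
  rw [liouville_apply_of_subset hAm inter_subset_left, localLiouville_apply' x hAm]
  refine (measure_mono ?_).trans_lt hC.measure_lt_top
  rintro w ⟨hw, hw'⟩
  have h := hw'.2
  rw [mem_preimage, canonCoord_canon hw.1] at h
  exact interior_subset h

instance isOpenPosMeasure_liouville : (liouville n M).IsOpenPosMeasure := by
  refine ⟨fun A hA hne => ?_⟩
  obtain ⟨z, hzA⟩ := hne
  set x := z.1
  have hz : z.1 ∈ (extChartAt (𝓡 n) x).source := mem_extChartAt_source x
  have hB := hA.inter (isOpen_proj_source (n := n) x)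
  refine ne_of_gt (lt_of_lt_of_le ?_ (measure_mono (inter_subset_left (s := A)
    (t := TotalSpace.proj ⁻¹' (extChartAt (𝓡 n) x).source))))
  rw [liouville_apply_of_subset hB.measurableSet inter_subset_right,
    localLiouville_apply' x hB.measurableSet]
  refine ((continuousOn_canon x).isOpen_inter_preimage (isOpen_dom_prod x) hB).measure_pos _ ?_
  refine ⟨canonCoord x z, mem_prod.2 ⟨canonCoord_fst_mem hz, mem_univ _⟩, ?_⟩
  rw [mem_preimage, canon_canonCoord hz]
  exact ⟨hzA, hz⟩

/-- Each point has a compact neighbourhood inside its chart. -/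
theorem exists_compact_chart_nhds (q : M) : ∃ C ⊆ dom (n := n) q, IsCompact C ∧
    (extChartAt (𝓡 n) q).symm '' C ∈ 𝓝 q := by
  obtain ⟨C, hCn, hCs, hC⟩ : ∃ C ∈ 𝓝 (extChartAt (𝓡 n) q q), C ⊆ dom (n := n) q ∧ IsCompact C :=
    local_compact_nhds ((isOpen_dom q).mem_nhds (mem_extChartAt_target q))
  refine ⟨C, hCs, hC, ?_⟩
  have : (extChartAt (𝓡 n) q).source ∩ extChartAt (𝓡 n) q ⁻¹' C ∈ 𝓝 q :=
    inter_mem (extChartAt_source_mem_nhds q) ((continuousAt_extChartAt q).preimage_mem_nhds hCn)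
  filter_upwards [this] with p hp
  exact ⟨_, hp.2, (extChartAt (𝓡 n) q).left_inv hp.1⟩

/-- Compactness is available only in the base, so the localisation covers `K` by finitely many
compact pieces of charts, while the hypothesis in each chart still concerns all momenta. -/
theorem integrable_liouville_of_chart [T2Space M] {Φ : Cotangent n M → ℝ} (hΦ : Continuous Φ)
    {K : Set M} (hK : IsCompact K) (hs : ∀ z : Cotangent n M, z.1 ∉ K → Φ z = 0)
    (h : ∀ x : M, ∀ C ⊆ dom (n := n) x, IsCompact C →
      IntegrableOn (fun w => Φ (canon x w)) (C ×ˢ univ)) :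
    Integrable Φ (liouville n M) := by
  have hsupp : Function.support Φ ⊆ TotalSpace.proj ⁻¹' K := fun z hz => by
    by_contra hzK
    exact hz (hs z hzK)
  rw [← integrableOn_iff_integrable_of_support_subset hsupp]
  refine IsCompact.induction_on
    (p := fun S => IntegrableOn Φ (TotalSpace.proj ⁻¹' S) (liouville n M)) hK (by simp)
    (fun s t hst ht => ht.mono_set (preimage_mono hst))
    (fun s t hs ht => by rw [preimage_union]; exact hs.union ht) fun q _ => ?_
  obtain ⟨C, hCs, hC, hCn⟩ := exists_compact_chart_nhds (n := n) q
  refine ⟨_, mem_nhdsWithin_of_mem_nhds hCn, ?_⟩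
  rw [IntegrableOn, liouville_restrict_chart hC hCs,
    integrable_map_measure hΦ.aestronglyMeasurable
      (((continuousOn_canon q).mono (prod_mono hCs subset_rfl)).aemeasurable
        (hC.measurableSet.prod .univ))]
  exact h q C hCs hC

end

/-! ### Smooth dependence of integrals on parameters -/

section

section Parametric

variable {E V : Type} [NormedAddCommGroup E] [NormedSpace ℝ E] [NormedAddCommGroup V]
  [NormedSpace ℝ V]

/-- All derivatives of `F`, weighted by `w`, are locally uniformly bounded by integrable functions
of the second variable. -/
def LocallyDominated [MeasureSpace V] {H : Type} [NormedAddCommGroup H] [NormedSpace ℝ H]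
    (w : V → ℝ) (s : Set E) (F : E × V → H) : Prop :=
  ∀ y₀ ∈ s, ∀ j : ℕ, ∃ U ∈ 𝓝 y₀, ∃ b : V → ℝ, Integrable (fun v => |w v| * b v) ∧
    ∀ y ∈ U, ∀ v, ‖iteratedFDeriv ℝ j F (y, v)‖ ≤ b v

variable [MeasureSpace V] [FiniteDimensional ℝ V] [BorelSpace V]
  {w : V → ℝ} {s : Set E}

section Deriv

variable {H : Type} [NormedAddCommGroup H] [NormedSpace ℝ H] {F : E × V → H}

theorem LocallyDominated.integrable (hF : ContDiffOn ℝ ∞ F (s ×ˢ univ)) (hw : Continuous w)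
    (hd : LocallyDominated w s F) {y : E} (hy : y ∈ s) :
    Integrable fun v => w v • F (y, v) := by
  obtain ⟨U, hU, b, hb, hbd⟩ := hd y hy 0
  refine hb.mono' ?_ (Eventually.of_forall fun v => ?_)
  · refine Continuous.aestronglyMeasurable (hw.smul ?_)
    exact hF.continuousOn.comp_continuous (by fun_prop) fun v => ⟨hy, mem_univ _⟩
  · rw [norm_smul, Real.norm_eq_abs]
    have := hbd y (mem_of_mem_nhds hU) v
    rw [norm_iteratedFDeriv_zero] at this
    gcongr

theorem contDiffAt_of_prod (hs : IsOpen s) (hF : ContDiffOn ℝ ∞ F (s ×ˢ univ)) {y : E}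
    (hy : y ∈ s) (v : V) : ContDiffAt ℝ ∞ F (y, v) :=
  hF.contDiffAt ((hs.prod isOpen_univ).mem_nhds ⟨hy, mem_univ _⟩)

/-- Differentiation in the first variable. -/
def partialDeriv (F : E × V → H) (z : E × V) : E →L[ℝ] H :=
  (fderiv ℝ F z).comp (ContinuousLinearMap.inl ℝ E V)

theorem contDiffOn_partialDeriv (hs : IsOpen s) (hF : ContDiffOn ℝ ∞ F (s ×ˢ univ)) :
    ContDiffOn ℝ ∞ (partialDeriv F) (s ×ˢ univ) := by
  have h1 : ContDiffOn ℝ ∞ (fderiv ℝ F) (s ×ˢ univ) :=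
    hF.fderiv_of_isOpen (hs.prod isOpen_univ) (by simp)
  exact h1.clm_comp contDiffOn_const

/-- Domination is required at all orders so that it survives differentiation: order j of the partial
derivative is controlled by order j + 1 of `F`, up to the norm of restriction to the first factor.
-/
theorem LocallyDominated.partialDeriv (hs : IsOpen s) (hF : ContDiffOn ℝ ∞ F (s ×ˢ univ))
    (hd : LocallyDominated w s F) : LocallyDominated w s (partialDeriv F) := by
  intro y₀ hy₀ j
  obtain ⟨U, hU, b, hb, hbd⟩ := hd y₀ hy₀ (j + 1)
  set L : (E × V →L[ℝ] H) →L[ℝ] (E →L[ℝ] H) :=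
    (ContinuousLinearMap.compL ℝ E (E × V) H).flip (ContinuousLinearMap.inl ℝ E V)
  refine ⟨U ∩ s, inter_mem hU (hs.mem_nhds hy₀), fun v => ‖L‖ * b v, ?_, fun y hy v => ?_⟩
  · convert hb.const_mul ‖L‖ using 2
    ring
  · have h1 : ContDiffAt ℝ ∞ (fderiv ℝ F) (y, v) :=
      (contDiffAt_of_prod hs hF hy.2 v).fderiv_right (by simp)
    refine (L.norm_iteratedFDeriv_comp_left h1 (mod_cast le_top)).trans ?_
    rw [norm_iteratedFDeriv_fderiv]
    exact mul_le_mul_of_nonneg_left (hbd y hy.1 v) (norm_nonneg L)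

theorem hasFDerivAt_integral_of_locallyDominated (hs : IsOpen s)
    (hF : ContDiffOn ℝ ∞ F (s ×ˢ univ)) (hw : Continuous w) (hd : LocallyDominated w s F)
    {y₀ : E} (hy₀ : y₀ ∈ s) :
    HasFDerivAt (fun y => ∫ v, w v • F (y, v)) (∫ v, w v • KineticFluid.partialDeriv F (y₀, v)) y₀ := by
  obtain ⟨U, hU, b, hb, hbd⟩ := hd.partialDeriv hs hF y₀ hy₀ 0
  refine hasFDerivAt_integral_of_dominated_of_fderiv_le (s := U ∩ s)
    (F' := fun y v => w v • KineticFluid.partialDeriv F (y, v)) (bound := fun v => |w v| * b v)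
    (inter_mem hU (hs.mem_nhds hy₀)) ?_ (hd.integrable hF hw hy₀) ?_ ?_ hb ?_
  · filter_upwards [hs.mem_nhds hy₀] with y hy
    exact (hd.integrable hF hw hy).aestronglyMeasurable
  · exact ((hd.partialDeriv hs hF).integrable (contDiffOn_partialDeriv hs hF) hw
      hy₀).aestronglyMeasurable
  · refine Eventually.of_forall fun v y hy => ?_
    rw [norm_smul, Real.norm_eq_abs]
    have := hbd y hy.1 v
    rw [norm_iteratedFDeriv_zero] at this
    gcongr
  · refine Eventually.of_forall fun v y hy => ?_
    have h1 := ((contDiffAt_of_prod hs hF hy.2 v).differentiableAt (by simp)).hasFDerivAt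
    exact (h1.comp y (hasFDerivAt_prodMk_left y v)).const_smul (w v)

end Deriv

/-- The derivative of the integral is an integral of the same kind with values in `E →L[ℝ] H`. The
target space must therefore vary in the induction on the order. -/
theorem contDiffOn_nat_integral_of_locallyDominated (hs : IsOpen s) (hw : Continuous w) (k : ℕ) :
    ∀ {H : Type} [NormedAddCommGroup H] [NormedSpace ℝ H] {F : E × V → H},
      ContDiffOn ℝ ∞ F (s ×ˢ univ) → LocallyDominated w s F →
      ContDiffOn ℝ k (fun y => ∫ v, w v • F (y, v)) s := by
  induction k with
  | zero =>
    intro H _ _ F hF hd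
    refine contDiffOn_zero.2 fun y hy => ?_
    exact (hasFDerivAt_integral_of_locallyDominated hs hF hw hd hy).continuousAt.continuousWithinAt
  | succ k ih =>
    intro H _ _ F hF hd
    have hder := fun y (hy : y ∈ s) => hasFDerivAt_integral_of_locallyDominated hs hF hw hd hy
    push_cast
    refine (contDiffOn_succ_iff_fderiv_of_isOpen hs).2
      ⟨fun y hy => (hder y hy).differentiableAt.differentiableWithinAt, by simp, ?_⟩
    exact (ih (contDiffOn_partialDeriv hs hF) (hd.partialDeriv hs hF)).congr
      fun y hy => (hder y hy).fderiv

theorem contDiffOn_integral_of_locallyDominated (hs : IsOpen s) (hw : Continuous w)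
    {H : Type} [NormedAddCommGroup H] [NormedSpace ℝ H] {F : E × V → H}
    (hF : ContDiffOn ℝ ∞ F (s ×ˢ univ)) (hd : LocallyDominated w s F) :
    ContDiffOn ℝ ∞ (fun y => ∫ v, w v • F (y, v)) s :=
  contDiffOn_infty.2 fun k => contDiffOn_nat_integral_of_locallyDominated hs hw k hF hd

/-- Bounds on the derivatives of a function that vanishes for large values of the second
variable. -/
theorem exists_iteratedFDeriv_bound {H : Type} [NormedAddCommGroup H] [NormedSpace ℝ H]
    {F : E × V → H} (hs : IsOpen s) (hF : ContDiffOn ℝ ∞ F (s ×ˢ univ)) {C : Set E}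
    (hC : IsCompact C) (hCs : C ⊆ s) {r : ℝ}
    (hr : ∀ y ∈ C, ∀ v, r < ‖v‖ → (y, v) ∉ tsupport F) (j : ℕ) :
    ∃ B : ℝ, 0 ≤ B ∧ ∀ y ∈ C, ∀ v : V, ‖iteratedFDeriv ℝ j F (y, v)‖
      ≤ (Metric.closedBall (0 : V) r).indicator (fun _ => B) v := by
  have hcomp : IsCompact (C ×ˢ Metric.closedBall (0 : V) r) := hC.prod (isCompact_closedBall _ _)
  have hcont : ContinuousOn (iteratedFDeriv ℝ j F) (s ×ˢ univ) := by
    refine (hF.continuousOn_iteratedFDerivWithin (m := j) (mod_cast le_top)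
      (hs.prod isOpen_univ).uniqueDiffOn).congr fun z hz => ?_
    exact (iteratedFDerivWithin_of_isOpen j (hs.prod isOpen_univ) hz).symm
  obtain ⟨B, hB⟩ := hcomp.exists_bound_of_continuousOn
    (hcont.mono (prod_mono hCs (subset_univ _)))
  refine ⟨|B|, abs_nonneg _, fun y hy v => ?_⟩
  by_cases hv : v ∈ Metric.closedBall (0 : V) r
  · rw [indicator_of_mem hv]
    exact (hB _ ⟨hy, hv⟩).trans (le_abs_self _)
  · rw [indicator_of_notMem hv]
    have hv' : r < ‖v‖ := by simpa using hv
    have h0 : (y, v) ∉ Function.support (iteratedFDeriv ℝ j F) := fun h =>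
      hr y hy v hv' (support_iteratedFDeriv_subset j h)
    rw [Function.notMem_support.1 h0, norm_zero]

theorem locallyDominated_of_support {H : Type} [NormedAddCommGroup H] [NormedSpace ℝ H]
    [IsFiniteMeasureOnCompacts (volume : Measure V)] [LocallyCompactSpace E]
    {F : E × V → H} (hs : IsOpen s) (hF : ContDiffOn ℝ ∞ F (s ×ˢ univ)) (hw : Continuous w)
    (hr : ∀ C ⊆ s, IsCompact C → ∃ r : ℝ, ∀ y ∈ C, ∀ v, r < ‖v‖ → F (y, v) = 0) :
    LocallyDominated w s F := by
  intro y₀ hy₀ j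
  obtain ⟨C, hCn, hCs, hC⟩ : ∃ C ∈ 𝓝 y₀, C ⊆ s ∧ IsCompact C :=
    local_compact_nhds (hs.mem_nhds hy₀)
  -- Near a point of the smaller set `C'` with ‖v‖ > r the function vanishes on a whole
  -- neighbourhood, so the point lies off the closed support and all derivatives are zero there.
  obtain ⟨C', hC'n, hC's, hC'⟩ : ∃ C' ∈ 𝓝 y₀, C' ⊆ interior C ∧ IsCompact C' :=
    local_compact_nhds (interior_mem_nhds.2 hCn)
  obtain ⟨r, hr⟩ := hr C hCs hC
  obtain ⟨B, hB, hbd⟩ := exists_iteratedFDeriv_bound hs hF hC'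
    (hC's.trans (interior_subset.trans hCs)) (r := r) (fun y hy v hv => by
      rw [notMem_tsupport_iff_eventuallyEq]
      have : interior C ×ˢ {v : V | r < ‖v‖} ∈ 𝓝 (y, v) :=
        (isOpen_interior.prod (isOpen_lt continuous_const continuous_norm)).mem_nhds ⟨hC's hy, hv⟩
      filter_upwards [this] with z hz
      exact hr z.1 (interior_subset hz.1) z.2 hz.2) j
  refine ⟨C', hC'n, _, ?_, hbd⟩
  have : (fun v => |w v| * (Metric.closedBall (0 : V) r).indicator (fun _ => B) v)
      = (Metric.closedBall (0 : V) r).indicator (fun v => |w v| * B) := by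
    ext v; by_cases hv : v ∈ Metric.closedBall (0 : V) r <;> simp [hv]
  rw [this, integrable_indicator_iff Metric.isClosed_closedBall.measurableSet]
  have : ContinuousOn (fun v => |w v| * B) (Metric.closedBall 0 r) := by fun_prop
  exact this.integrableOn_compact (isCompact_closedBall _ _)

end Parametric

end

/-! ### Local representatives and smoothness of the fluid moments -/

section

variable {n : ℕ} {M : Type*} [TopologicalSpace M] [ChartedSpace (Coord n) M]
  [IsManifold (𝓡 n) ∞ M]

theorem contMDiffOn_canonCoord (x : M) :
    ContMDiffOn (cotModel n) 𝓘(ℝ, Coord n × Coord n) ∞ (canonCoord (n := n) x)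
      (TotalSpace.proj ⁻¹' (extChartAt (𝓡 n) x).source) := by
  have h1 := contMDiffOn_extChartAt (I := cotModel n) (n := ∞) (x := (⟨x, 0⟩ : Cotangent n M))
  rw [← extChartAt_source (cotModel n), extChartAt_cotangent_source] at h1
  have h2 : ContMDiff 𝓘(ℝ, Coord n × (Coord n →L[ℝ] ℝ)) 𝓘(ℝ, Coord n × Coord n) ∞
      (fun w : Coord n × (Coord n →L[ℝ] ℝ) => (w.1, (covecL (n := n)).symm w.2)) := by
    rw [contMDiff_iff_contDiff]
    fun_prop
  exact h2.comp_contMDiffOn h1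

theorem contMDiff_of_canon {Φ : Cotangent n M → ℝ}
    (h : ∀ x : M, ContDiffOn ℝ ∞ (fun w => Φ (canon x w)) (dom x ×ˢ univ)) :
    ContMDiff (cotModel n) 𝓘(ℝ, ℝ) ∞ Φ := by
  intro z
  have hz : z ∈ (TotalSpace.proj ⁻¹' (extChartAt (𝓡 n) z.1).source : Set (Cotangent n M)) :=
    mem_extChartAt_source (I := 𝓡 n) z.1
  have h1 := (contMDiffOn_iff_contDiffOn.2 (h z.1)).comp (contMDiffOn_canonCoord z.1)
    (fun w hw => mem_prod.2 ⟨canonCoord_fst_mem hw, mem_univ _⟩)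
  refine (h1.congr fun w hw => ?_).contMDiffAt ((isOpen_proj_source z.1).mem_nhds hz)
  simp only [Function.comp_apply]
  rw [canon_canonCoord hw]

theorem contDiffOn_comp_canon {Φ : Cotangent n M → ℝ} (h : ContMDiff (cotModel n) 𝓘(ℝ, ℝ) ∞ Φ)
    (x : M) : ContDiffOn ℝ ∞ (fun w => Φ (canon x w)) (dom x ×ˢ univ) :=
  contMDiffOn_iff_contDiffOn.1 (h.comp_contMDiffOn (contMDiffOn_canon x))

/-! ### Local representatives -/

/-- The components of a vector field in the chart at `x`. -/
def localVec (u : (q : M) → TangentSpace (𝓡 n) q) (x : M) (y : Coord n) : Coord n :=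
  tangentCoordChange (𝓡 n) ((extChartAt (𝓡 n) x).symm y) x ((extChartAt (𝓡 n) x).symm y)
    (u ((extChartAt (𝓡 n) x).symm y))

/-- The local representative of a function in the chart at `x`. -/
def localFun (n : ℕ) {M : Type*} [TopologicalSpace M] [ChartedSpace (Coord n) M]
    (g : M → ℝ) (x : M) (y : Coord n) : ℝ := g ((extChartAt (𝓡 n) x).symm y)

theorem contDiffOn_localFun {g : M → ℝ} (hg : ContMDiff (𝓡 n) 𝓘(ℝ, ℝ) ∞ g) (x : M) :
    ContDiffOn ℝ ∞ (localFun n g x) (dom x) :=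
  contMDiffOn_iff_contDiffOn.1 (hg.comp_contMDiffOn (contMDiffOn_extChartAt_symm x))

theorem contDiffOn_localVec (u : Cₛ^∞⟮𝓡 n; Coord n, (TangentSpace (𝓡 n) : M → Type)⟯) (x : M) :
    ContDiffOn ℝ ∞ (localVec (n := n) u x) (dom x) := by
  have h1 : ContMDiffOn (𝓡 n) 𝓘(ℝ, Coord n) ∞
      (fun q => (trivializationAt (Coord n) (TangentSpace (𝓡 n) : M → Type) x
        (⟨q, u q⟩ : TangentBundle (𝓡 n) M)).2) (extChartAt (𝓡 n) x).source := by
    rw [extChartAt_source]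
    exact ((trivializationAt (Coord n) (TangentSpace (𝓡 n) : M → Type) x)
      ).contMDiffOn_section_baseSet_iff.1 u.contMDiff.contMDiffOn
  have h2 := contMDiffOn_iff_contDiffOn.1 (h1.comp (contMDiffOn_extChartAt_symm x)
    (fun y hy => (extChartAt (𝓡 n) x).map_target hy))
  refine h2.congr fun y hy => ?_
  simp only [Function.comp_apply, TangentBundle.trivializationAt_apply]
  rfl

theorem canon_snd_apply {x : M} {y : Coord n} (hy : y ∈ dom x) (v : Coord n)
    (u : (q : M) → TangentSpace (𝓡 n) q) :
    (canon x (y, v)).2 (u (canon x (y, v)).1) = inner ℝ v (localVec u x y) := by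
  rw [canon_eq hy]
  rfl

theorem canon_fst_apply {x : M} {y : Coord n} (hy : y ∈ dom x) (v : Coord n) (g : M → ℝ) :
    g (canon x (y, v)).1 = localFun n g x y := by rw [proj_canon hy]; rfl

/-! ### Decaying functions -/

theorem FibreDecay.exists_bound {k : Cotangent n M → ℝ} (h : FibreDecay k) {x : M}
    {C : Set (Coord n)} (hCx : C ⊆ dom x) (hC : IsCompact C) (j : ℕ) :
    ∃ N : ℝ, (n : ℝ) + 1 < N ∧ ∃ B : ℝ, 0 ≤ B ∧ ∀ y ∈ C, ∀ v : Coord n,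
      ‖iteratedFDeriv ℝ j (fun w => k (canon x w)) (y, v)‖ ≤ B * (1 + ‖v‖) ^ (-N) := by
  obtain ⟨N, hN, B, hB⟩ := h x C hCx hC j
  refine ⟨N, hN, |B|, abs_nonneg _, fun y hy v => (hB y hy v).trans ?_⟩
  gcongr
  exact le_abs_self B

/-- The weight consumes one power of 1 + ‖v‖, leaving the exponent N - 1 > n, the threshold of
integrability on ℝⁿ. This accounts for the bound N > n + 1 in `FibreDecay`. -/
theorem integrable_growth_mul_decay {w : Coord n → ℝ} (hw : Continuous w) {c : ℝ}
    (hc : ∀ v, |w v| ≤ c * (1 + ‖v‖)) {N : ℝ} (hN : (n : ℝ) + 1 < N) (B : ℝ) :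
    Integrable fun v : Coord n => |w v| * (B * (1 + ‖v‖) ^ (-N)) := by
  have h1 : Integrable (fun v : Coord n => (1 + ‖v‖) ^ (-(N - 1))) :=
    integrable_one_add_norm (by rw [finrank_euclideanSpace_fin]; linarith)
  refine (h1.const_mul (c * |B|)).mono' ?_ (Eventually.of_forall fun v => ?_)
  · have : Continuous fun v : Coord n => (1 + ‖v‖) ^ (-N) :=
      Continuous.rpow_const (by fun_prop) fun v => Or.inl (by positivity)
    exact (hw.abs.mul (continuous_const.mul this)).aestronglyMeasurable
  · have hpos : 0 < 1 + ‖v‖ := by positivity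
    have e : (1 + ‖v‖) ^ (-(N - 1)) = (1 + ‖v‖) * (1 + ‖v‖) ^ (-N) := by
      rw [show -(N - 1) = 1 + -N by ring, Real.rpow_add hpos, Real.rpow_one]
    have hp : 0 ≤ (1 + ‖v‖) ^ (-N) := Real.rpow_nonneg hpos.le _
    rw [e, Real.norm_eq_abs, abs_mul, abs_abs, abs_mul, abs_of_nonneg hp]
    calc |w v| * (|B| * (1 + ‖v‖) ^ (-N)) ≤ c * (1 + ‖v‖) * (|B| * (1 + ‖v‖) ^ (-N)) := by
          gcongr; exact hc v
      _ = _ := by ring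

theorem FibreDecay.locallyDominated {k : Cotangent n M → ℝ} (h : FibreDecay k) {w : Coord n → ℝ}
    (hw : Continuous w) {c : ℝ} (hc : ∀ v, |w v| ≤ c * (1 + ‖v‖)) (x : M) :
    LocallyDominated w (dom x) (fun z => k (canon x z)) := by
  intro y₀ hy₀ j
  obtain ⟨C, hCn, hCs, hC⟩ : ∃ C ∈ 𝓝 y₀, C ⊆ dom x ∧ IsCompact C :=
    local_compact_nhds ((isOpen_dom x).mem_nhds hy₀)
  obtain ⟨N, hN, B, hB, hbd⟩ := h.exists_bound hCs hC j
  exact ⟨C, hCn, _, integrable_growth_mul_decay hw hc hN B, hbd⟩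

theorem growth_one : ∀ v : Coord n, |(fun _ => (1 : ℝ)) v| ≤ 1 * (1 + ‖v‖) := fun v => by
  have := norm_nonneg v
  simp

theorem growth_inner (e : Coord n) : ∀ v : Coord n, |inner ℝ v e| ≤ ‖e‖ * (1 + ‖v‖) := fun v => by
  have h1 := abs_real_inner_le_norm v e
  have h2 := norm_nonneg e
  nlinarith

theorem continuous_inner_left (e : Coord n) : Continuous fun v : Coord n => (inner ℝ v e : ℝ) := by
  fun_prop

/-- The momentum density of a function on `T*M`. -/
def momentumDensity (k : Cotangent n M → ℝ) (q : M) : TangentSpace (𝓡 n) q →L[ℝ] ℝ :=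
  (∫ v : Coord n, k (cotPoint q v) • covec v : Coord n →L[ℝ] ℝ)

/-- The fibre integral of a function on `T*M`. -/
def massDensity (k : Cotangent n M → ℝ) (q : M) : ℝ := ∫ v : Coord n, k (cotPoint q v)

theorem FibreDecay.integrable_canon {k : Cotangent n M → ℝ}
    (hd : FibreDecay k) (hk : ContMDiff (cotModel n) 𝓘(ℝ, ℝ) ∞ k) {w : Coord n → ℝ}
    (hw : Continuous w) {c : ℝ} (hc : ∀ v, |w v| ≤ c * (1 + ‖v‖)) {x : M} {y : Coord n}
    (hy : y ∈ dom x) : Integrable fun v => w v * k (canon x (y, v)) :=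
  (hd.locallyDominated hw hc x).integrable (contDiffOn_comp_canon hk x) hw hy

theorem FibreDecay.integrable_covec_canon {k : Cotangent n M → ℝ}
    (hd : FibreDecay k) (hk : ContMDiff (cotModel n) 𝓘(ℝ, ℝ) ∞ k) {x : M} {y : Coord n} (hy : y ∈ dom x) :
    Integrable fun v => k (canon x (y, v)) • covec v := by
  have h1 := hd.integrable_canon hk (w := fun v => ‖v‖) continuous_norm (c := 1)
    (fun v => by rw [abs_norm]; linarith [norm_nonneg v]) hy
  have hcont : Continuous fun v => k (canon x (y, v)) :=
    hk.continuous.comp (continuous_canon_right hy)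
  refine h1.norm.mono' (hcont.smul continuous_covec).aestronglyMeasurable
    (Eventually.of_forall fun v => ?_)
  rw [norm_smul, norm_covec, norm_mul, norm_norm, mul_comm]

theorem FibreDecay.contDiffOn_massDensity {k : Cotangent n M → ℝ}
    (hd : FibreDecay k) (hk : ContMDiff (cotModel n) 𝓘(ℝ, ℝ) ∞ k) (x : M) :
    ContDiffOn ℝ ∞ (densityComp (n := n) (massDensity k) x) (dom x) := by
  have h := contDiffOn_integral_of_locallyDominated (isOpen_dom x) continuous_const
    (contDiffOn_comp_canon hk x) (hd.locallyDominated continuous_const growth_one x)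
  refine h.congr fun y hy => ?_
  unfold massDensity
  rw [densityComp_fibreIntegral k hy]
  simp

theorem FibreDecay.formDensityComp_eq {k : Cotangent n M → ℝ}
    (hd : FibreDecay k) (hk : ContMDiff (cotModel n) 𝓘(ℝ, ℝ) ∞ k) {x : M} {y : Coord n} (hy : y ∈ dom x) :
    formDensityComp (momentumDensity k) x y
      = ∫ v, k (canon x (y, v)) • covec v := by
  set q := (extChartAt (𝓡 n) x).symm y with hq
  have hqs : q ∈ (extChartAt (𝓡 n) x).source := (extChartAt (𝓡 n) x).map_target hy
  -- `Φ` multiplies `k` by the covector of z read in the chart at `x`. Over y this is `k` times p in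
  -- that chart, while in the preferred chart at q it is a fixed linear image of `k` times p;
  -- `integral_canon` compares the two and supplies the Jacobian.
  set Φ : Cotangent n M → (Coord n →L[ℝ] ℝ) := fun z =>
    k z • (show Coord n →L[ℝ] ℝ from z.2).comp (tangentCoordChange (𝓡 n) x q q)
  have h1 : ∀ v, Φ (canon x (y, v)) = k (canon x (y, v)) • covec v := fun v => by
    simp only [Φ]
    congr 1
    rw [canon_eq hy]
    change ((covec v).comp _).comp _ = _
    rw [ContinuousLinearMap.comp_assoc, tangentCoordChange_comp_self (mem_extChartAt_source _) hqs,
      ContinuousLinearMap.comp_id]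
  have h2 : ∀ v, Φ (cotPoint q v) = ((ContinuousLinearMap.compL ℝ (Coord n) (Coord n) ℝ).flip
      (tangentCoordChange (𝓡 n) x q q)) (k (cotPoint q v) • covec v) := fun v => by
    rw [map_smul]; rfl
  have hint : Integrable fun v => k (cotPoint q v) • covec v := by
    simp only [cotPoint_eq_canon]
    exact hd.integrable_covec_canon hk (mem_extChartAt_target q)
  have h3 := integral_canon Φ hy
  simp only [h1] at h3
  rw [h3, ← hq]
  simp only [h2]
  rw [ContinuousLinearMap.integral_comp_comm _ hint]
  rfl

theorem FibreDecay.contDiffOn_momentumDensity {k : Cotangent n M → ℝ}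
    (hd : FibreDecay k) (hk : ContMDiff (cotModel n) 𝓘(ℝ, ℝ) ∞ k) (x : M) :
    ContDiffOn ℝ ∞ (formDensityComp (momentumDensity k) x)
      (dom x) := by
  rw [contDiffOn_clm_apply]
  intro e
  have h := contDiffOn_integral_of_locallyDominated (isOpen_dom x) (continuous_inner_left e)
    (contDiffOn_comp_canon hk x)
    (hd.locallyDominated (continuous_inner_left e) (growth_inner e) x)
  refine h.congr fun y hy => ?_
  rw [hd.formDensityComp_eq hk hy, ContinuousLinearMap.integral_apply
    (hd.integrable_covec_canon hk hy)]
  refine integral_congr_ae (Eventually.of_forall fun v => ?_)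
  simp [covec_apply, mul_comm]

variable {I : Set ℝ}

theorem PhaseDensity.contMDiff_rpow (f : PhaseDensity n M I) (σ : ℝ) :
    ContMDiff (cotModel n) 𝓘(ℝ, ℝ) ∞ (fun z => f.toFun z ^ σ) := by
  refine contMDiff_of_canon fun x => ?_
  exact (contDiffOn_comp_canon f.smooth x).rpow_const_of_ne fun w _ => (f.pos _).ne'

theorem PhaseDensity.fibreDecay (f : PhaseDensity n M I) (h0 : (0 : ℝ) ∈ I) :
    FibreDecay f.toFun := by
  simpa using (f.decay 0 h0).1

/-- The momentum density and the Tsallis entropy density of `f`. -/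
def fluidMoments (h0 : (0 : ℝ) ∈ I) {ξ : ℝ} (hξ : ξ ∈ I) (f : PhaseDensity n M I) :
    FluidDual n M where
  m := momentumDensity f.toFun
  ρ := massDensity fun z => f.toFun z ^ (1 + ξ)
  smooth_m := (f.fibreDecay h0).contDiffOn_momentumDensity f.smooth
  smooth_ρ := (f.decay ξ hξ).1.contDiffOn_massDensity (f.contMDiff_rpow _)

end

/-! ### The pairing of the moments with the fluid algebra -/

section

variable {n : ℕ} {M : Type*} [TopologicalSpace M] [ChartedSpace (Coord n) M]
  [IsManifold (𝓡 n) ∞ M]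

/-- The majorant is the constant 1 on `C` times an integrable function of v. The order j is free
because the brackets involve functions (j = 0) as well as their first derivatives (j = 1), each with
at most linear growth in the coefficients. -/
theorem integrableOn_of_decay {k : Cotangent n M → ℝ} (hd : FibreDecay k) {x : M}
    {C : Set (Coord n)} (hCx : C ⊆ dom x) (hC : IsCompact C) {Φ : Coord n × Coord n → ℝ}
    (hΦ : ContinuousOn Φ (C ×ˢ univ)) (j : ℕ) {A : ℝ} (hA : 0 ≤ A)
    (hb : ∀ y ∈ C, ∀ v, |Φ (y, v)| ≤
      A * (1 + ‖v‖) * ‖iteratedFDeriv ℝ j (fun w => k (canon x w)) (y, v)‖) :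
    IntegrableOn Φ (C ×ˢ univ) := by
  obtain ⟨N, hN, B, hB, hbd⟩ := hd.exists_bound hCx hC j
  have h1 := integrable_growth_mul_decay (w := fun v : Coord n => A * (1 + ‖v‖)) (by fun_prop)
    (c := A) (fun v => (abs_of_nonneg (by positivity)).le) hN B
  have h2 : Integrable (fun _ : Coord n => (1 : ℝ)) (volume.restrict C) :=
    integrableOn_const (hs := hC.measure_lt_top.ne)
  have h3 := h2.mul_prod h1
  have hm : MeasurableSet (C ×ˢ (univ : Set (Coord n))) := hC.measurableSet.prod .univ
  have hμ : (volume.restrict C).prod (volume : Measure (Coord n))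
      = (volume : Measure (Coord n × Coord n)).restrict (C ×ˢ univ) := by
    have := Measure.prod_restrict (μ := (volume : Measure (Coord n)))
      (ν := (volume : Measure (Coord n))) C univ
    rwa [Measure.restrict_univ] at this
  rw [hμ] at h3
  refine h3.mono' (hΦ.aestronglyMeasurable hm) ?_
  filter_upwards [ae_restrict_mem hm] with z hz
  rw [Real.norm_eq_abs, one_mul, abs_of_nonneg (by positivity : 0 ≤ A * (1 + ‖z.2‖))]
  refine (hb z.1 hz.1 z.2).trans ?_
  gcongr
  exact hbd z.1 hz.1 z.2

theorem contMDiff_momentum (u : Cₛ^∞⟮𝓡 n; Coord n, (TangentSpace (𝓡 n) : M → Type)⟯) :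
    ContMDiff (cotModel n) 𝓘(ℝ, ℝ) ∞ (fun z : Cotangent n M => z.2 (u z.1)) := by
  refine contMDiff_of_canon fun x => ?_
  have h : ContDiffOn ℝ ∞ (fun w : Coord n × Coord n => inner ℝ w.2 (localVec u x w.1))
      (dom x ×ˢ univ) :=
    contDiffOn_snd.inner ℝ ((contDiffOn_localVec u x).comp contDiffOn_fst fun w hw => hw.1)
  exact h.congr fun w hw => canon_snd_apply hw.1 w.2 u

theorem contMDiff_basic {g : M → ℝ} (hg : ContMDiff (𝓡 n) 𝓘(ℝ, ℝ) ∞ g) :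
    ContMDiff (cotModel n) 𝓘(ℝ, ℝ) ∞ (fun z : Cotangent n M => g z.1) := by
  refine contMDiff_of_canon fun x => ?_
  have h : ContDiffOn ℝ ∞ (fun w : Coord n × Coord n => localFun n g x w.1) (dom x ×ˢ univ) :=
    (contDiffOn_localFun hg x).comp contDiffOn_fst fun w hw => hw.1
  exact h.congr fun w hw => canon_fst_apply hw.1 w.2 g

theorem formDensityComp_localVec (m : (q : M) → TangentSpace (𝓡 n) q →L[ℝ] ℝ)
    (u : (q : M) → TangentSpace (𝓡 n) q) {x : M} {y : Coord n} (hy : y ∈ dom x) :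
    formDensityComp m x y (localVec u x y) = jac (n := n) x ((extChartAt (𝓡 n) x).symm y) *
      m ((extChartAt (𝓡 n) x).symm y) (u ((extChartAt (𝓡 n) x).symm y)) := by
  have h : tangentCoordChange (𝓡 n) x ((extChartAt (𝓡 n) x).symm y) ((extChartAt (𝓡 n) x).symm y)
      (localVec u x y) = u ((extChartAt (𝓡 n) x).symm y) :=
    DFunLike.congr_fun (tangentCoordChange_comp_self ((extChartAt (𝓡 n) x).map_target hy)
      (mem_extChartAt_source _)) _
  exact congrArg (fun e : Coord n => jac (n := n) x ((extChartAt (𝓡 n) x).symm y) *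
    (m ((extChartAt (𝓡 n) x).symm y) : Coord n →L[ℝ] ℝ) e) h

theorem densityComp_pairingDensity (μ : FluidDual n M) (X : FluidAlgebra n M) {x : M} {y : Coord n}
    (hy : y ∈ dom x) : densityComp (pairingDensity μ X) x y
      = formDensityComp μ.m x y (localVec X.1 x y)
        + densityComp (n := n) μ.ρ x y * localFun n X.2 x y := by
  rw [formDensityComp_localVec μ.m X.1 hy]
  simp only [densityComp, pairingDensity, localFun]
  ring

theorem contDiffOn_pairingDensity (μ : FluidDual n M) (X : FluidAlgebra n M) (x : M) :
    ContDiffOn ℝ ∞ (densityComp (n := n) (pairingDensity μ X) x) (dom x) :=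
  (((μ.smooth_m x).clm_apply (contDiffOn_localVec X.1 x)).add
    ((μ.smooth_ρ x).mul (contDiffOn_localFun X.2.contMDiff x))).congr
      fun _ hy => densityComp_pairingDensity μ X hy

theorem continuousDensity_pairingDensity (μ : FluidDual n M) (X : FluidAlgebra n M) :
    ContinuousDensity n (pairingDensity μ X) :=
  fun x => (contDiffOn_pairingDensity μ X x).continuousOn

section Moments

variable {I : Set ℝ} (h0 : (0 : ℝ) ∈ I) {ξ : ℝ} (hξ : ξ ∈ I)

/-- The integrand on `T*M` of the pairing of the fluid moments of `f` with `X`. -/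
def momentIntegrand (ξ : ℝ) (X : FluidAlgebra n M) (f : PhaseDensity n M I) (z : Cotangent n M) :
    ℝ :=
  z.2 (X.1 z.1) * f.toFun z + f.toFun z ^ (1 + ξ) * X.2 z.1

theorem integrable_momentum_cotPoint (f : PhaseDensity n M I) (h0 : (0 : ℝ) ∈ I) (q : M) :
    Integrable fun v : Coord n => f.toFun (cotPoint q v) • covec v := by
  simp only [cotPoint_eq_canon]
  exact (f.fibreDecay h0).integrable_covec_canon f.smooth (mem_extChartAt_target q)

theorem integrable_mass_cotPoint (f : PhaseDensity n M I) (hξ : ξ ∈ I) (q : M) :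
    Integrable fun v : Coord n => f.toFun (cotPoint q v) ^ (1 + ξ) := by
  simp only [cotPoint_eq_canon]
  have := (f.decay ξ hξ).1.integrable_canon (f.contMDiff_rpow _) continuous_const growth_one
    (mem_extChartAt_target q)
  simpa using this

theorem pairingDensity_fluidMoments (X : FluidAlgebra n M) (f : PhaseDensity n M I) (q : M) :
    pairingDensity (fluidMoments h0 hξ f) X q = ∫ v, momentIntegrand ξ X f (cotPoint q v) := by
  have h1 := integrable_momentum_cotPoint f h0 q
  have h2 := integrable_mass_cotPoint f hξ q
  obtain ⟨e, he⟩ : ∃ e : Coord n, e = X.1 q := ⟨_, rfl⟩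
  have h3 : Integrable fun v : Coord n => (f.toFun (cotPoint q v) • covec v) e :=
    (ContinuousLinearMap.apply ℝ ℝ e).integrable_comp h1
  have h4 : ∀ v, momentIntegrand ξ X f (cotPoint q v) = (f.toFun (cotPoint q v) • covec v) e
      + f.toFun (cotPoint q v) ^ (1 + ξ) * X.2 q := fun v => by
    rw [momentIntegrand, mul_comm, he]
    rfl
  simp only [h4]
  rw [integral_add h3 (h2.mul_const _), integral_mul_const, ← ContinuousLinearMap.integral_apply h1,
    he]
  rfl

theorem contMDiff_momentIntegrand (X : FluidAlgebra n M) (f : PhaseDensity n M I) :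
    ContMDiff (cotModel n) 𝓘(ℝ, ℝ) ∞ (momentIntegrand ξ X f) :=
  ((contMDiff_momentum X.1).mul f.smooth).add
    ((f.contMDiff_rpow _).mul (contMDiff_basic X.2.contMDiff))

variable [T2Space M] [SecondCountableTopology M] [MeasurableSpace M] [BorelSpace M]

theorem integrable_momentIntegrand (X : FluidAlgebra n M) (hX : CompactlySupported X)
    (f : PhaseDensity n M I) (h0 : (0 : ℝ) ∈ I) (hξ : ξ ∈ I) :
    Integrable (momentIntegrand ξ X f) (liouville n M) := by
  obtain ⟨K, hK, hKX⟩ := hX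
  refine integrable_liouville_of_chart (contMDiff_momentIntegrand X f).continuous hK
    (fun z hz => ?_) fun x C hCx hC => ?_
  · rw [momentIntegrand, (hKX _ hz).1, (hKX _ hz).2]
    simp
  have hu := (contDiffOn_localVec X.1 x).continuousOn.mono hCx
  have hg := (contDiffOn_localFun X.2.contMDiff x).continuousOn.mono hCx
  obtain ⟨A, hA⟩ := hC.exists_bound_of_continuousOn hu
  obtain ⟨B, hB⟩ := hC.exists_bound_of_continuousOn hg
  have hsub : C ×ˢ (univ : Set (Coord n)) ⊆ dom x ×ˢ univ := prod_mono hCx subset_rfl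
  have hf := (contDiffOn_comp_canon f.smooth x).continuousOn.mono hsub
  have hfξ := (contDiffOn_comp_canon (f.contMDiff_rpow (1 + ξ)) x).continuousOn.mono hsub
  have h1 : IntegrableOn (fun w : Coord n × Coord n =>
      inner ℝ w.2 (localVec X.1 x w.1) * f.toFun (canon x w)) (C ×ˢ univ) := by
    refine integrableOn_of_decay (f.fibreDecay h0) hCx hC
      ((continuous_snd.continuousOn.inner (hu.comp continuous_fst.continuousOn fun w hw => hw.1)).mul
        hf) 0 (abs_nonneg A) fun y hy v => ?_
    rw [norm_iteratedFDeriv_zero, abs_mul, Real.norm_eq_abs]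
    gcongr
    refine (abs_real_inner_le_norm _ _).trans ?_
    rw [mul_comm]
    have := (hA y hy).trans (le_abs_self A)
    gcongr
    linarith
  have h2 : IntegrableOn (fun w : Coord n × Coord n =>
      f.toFun (canon x w) ^ (1 + ξ) * localFun n X.2 x w.1) (C ×ˢ univ) := by
    refine integrableOn_of_decay (f.decay ξ hξ).1 hCx hC
      (hfξ.mul (hg.comp continuous_fst.continuousOn fun w hw => hw.1)) 0 (abs_nonneg B)
      fun y hy v => ?_
    rw [norm_iteratedFDeriv_zero, abs_mul, Real.norm_eq_abs, mul_comm]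
    gcongr
    have h3 := (hB y hy).trans (le_abs_self B)
    rw [Real.norm_eq_abs] at h3
    nlinarith [norm_nonneg v, abs_nonneg B]
  refine (h1.add h2).congr_fun (fun w hw => ?_) (hC.measurableSet.prod .univ)
  simp only [Pi.add_apply, momentIntegrand]
  rw [canon_snd_apply (hCx hw.1) w.2, canon_fst_apply (hCx hw.1) w.2 X.2]

/-- Pairing with X at a point is linear, so it passes inside the fibre integral; compact support of
X gives integrability on T*M, and Fubini identifies the two sides. -/
theorem pairing_fluidMoments (X : FluidAlgebra n M) (hX : CompactlySupported X)
    (f : PhaseDensity n M I) :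
    DensityIntegrable n (pairingDensity (fluidMoments h0 hξ f) X) ∧
      pairing (fluidMoments h0 hξ f) X = ∫ z, momentIntegrand ξ X f z ∂(liouville n M) := by
  have hi := integral_liouville (integrable_momentIntegrand X hX f h0 hξ)
  have heq : (fun q => ∫ v, momentIntegrand ξ X f (cotPoint q v))
      = pairingDensity (fluidMoments h0 hξ f) X :=
    funext fun q => (pairingDensity_fluidMoments h0 hξ X f q).symm
  rw [heq] at hi
  have hm := (continuousDensity_pairingDensity (fluidMoments h0 hξ f) X).measurable
  exact ⟨(densityIntegrable_iff hm).2 hi.1, by rw [hi.2, pairing, densityIntegral_eq hm hi.1]⟩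

end Moments

end

/-! ### Differentiation of moments along compactly supported curves -/

section

variable {n : ℕ} {M : Type*} [TopologicalSpace M] [ChartedSpace (Coord n) M]
  [IsManifold (𝓡 n) ∞ M]

/-- A smooth curve of functions on `T*M`, constant outside a compact set. -/
structure IsCompactVariation (κ : ℝ × Cotangent n M → ℝ) (r : ℝ) : Prop where
  pos : 0 < r
  smooth : ContMDiffOn (𝓘(ℝ, ℝ).prod (cotModel n)) 𝓘(ℝ, ℝ) ∞ κ (Ioo (-r) r ×ˢ univ)
  compact : ∃ K : Set (Cotangent n M), IsCompact K ∧ ∀ ε ∈ Ioo (-r) r, ∀ z ∉ K, κ (ε, z) = κ (0, z)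

namespace IsCompactVariation

variable {κ : ℝ × Cotangent n M → ℝ} {r : ℝ}

theorem zero_mem (h : IsCompactVariation κ r) : (0 : ℝ) ∈ Ioo (-r) r := ⟨by linarith [h.pos], h.pos⟩

/-- The curve f_ε enters the momentum and f_ε^{1+ξ} the entropy density; closure under powers lets
one argument treat both. -/
theorem rpow (h : IsCompactVariation κ r) (hp : ∀ s, 0 < κ s) (σ : ℝ) :
    IsCompactVariation (fun s => κ s ^ σ) r where
  pos := h.pos
  smooth := fun s hs => by
    have h1 : ContDiffAt ℝ ∞ (fun t : ℝ => t ^ σ) (κ s) :=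
      Real.contDiffAt_rpow_const_of_ne (hp s).ne'
    exact h1.contMDiffAt.comp_contMDiffWithinAt s (h.smooth s hs)
  compact := by
    obtain ⟨K, hK, h⟩ := h.compact
    exact ⟨K, hK, fun ε hε z hz => by simp only [h ε hε z hz]⟩

/-- The curve in canonical coordinates. -/
def coordCurve (κ : ℝ × Cotangent n M → ℝ) (x : M) (s : (ℝ × Coord n) × Coord n) : ℝ :=
  κ (s.1.1, canon x (s.1.2, s.2))

theorem isOpen_params (r : ℝ) (x : M) : IsOpen (Ioo (-r) r ×ˢ dom (n := n) x) :=
  isOpen_Ioo.prod (isOpen_dom x)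

theorem contDiffOn_coordCurve (h : IsCompactVariation κ r) (x : M) :
    ContDiffOn ℝ ∞ (coordCurve κ x) ((Ioo (-r) r ×ˢ dom x) ×ˢ univ) := by
  rw [← contMDiffOn_iff_contDiffOn]
  have h1 : ContMDiffOn 𝓘(ℝ, (ℝ × Coord n) × Coord n) 𝓘(ℝ, ℝ) ∞
      (fun s : (ℝ × Coord n) × Coord n => s.1.1) ((Ioo (-r) r ×ˢ dom x) ×ˢ univ) :=
    contMDiffOn_iff_contDiffOn.2 (by fun_prop)
  have h2 : ContMDiffOn 𝓘(ℝ, (ℝ × Coord n) × Coord n) 𝓘(ℝ, Coord n × Coord n) ∞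
      (fun s : (ℝ × Coord n) × Coord n => (s.1.2, s.2)) ((Ioo (-r) r ×ˢ dom x) ×ˢ univ) :=
    contMDiffOn_iff_contDiffOn.2 (by fun_prop)
  have h3 := (contMDiffOn_canon x).comp h2 fun s hs => mem_prod.2 ⟨hs.1.2, mem_univ _⟩
  exact h.smooth.comp (h1.prodMk h3) fun s hs => mem_prod.2 ⟨hs.1.1, mem_univ _⟩

theorem contMDiff_zero (h : IsCompactVariation κ r) :
    ContMDiff (cotModel n) 𝓘(ℝ, ℝ) ∞ (fun z => κ (0, z)) := by
  refine contMDiff_of_canon fun x => ?_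
  exact (h.contDiffOn_coordCurve x).comp (f := fun w : Coord n × Coord n => ((0, w.1), w.2))
    (by fun_prop) fun w hw => mem_prod.2 ⟨mem_prod.2 ⟨h.zero_mem, hw.1⟩, mem_univ _⟩

/-- The deviation of the curve from its value at `0`, in canonical coordinates. -/
def deviation (κ : ℝ × Cotangent n M → ℝ) (x : M) (s : (ℝ × Coord n) × Coord n) : ℝ :=
  coordCurve κ x s - κ (0, canon x (s.1.2, s.2))

theorem contDiffOn_deviation (h : IsCompactVariation κ r) (x : M) :
    ContDiffOn ℝ ∞ (deviation κ x) ((Ioo (-r) r ×ˢ dom x) ×ˢ univ) := by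
  refine (h.contDiffOn_coordCurve x).sub ?_
  exact (contDiffOn_comp_canon h.contMDiff_zero x).comp
    (f := fun s : (ℝ × Coord n) × Coord n => (s.1.2, s.2)) (by fun_prop)
    fun s hs => mem_prod.2 ⟨hs.1.2, mem_univ _⟩

/-- Over a compact set of parameters the compact set carrying the variation has bounded momenta, so
the deviation vanishes for large v. Hence decay is needed only for the value of the curve at 0, not
uniformly along it. -/
theorem locallyDominated_deviation [T2Space M] (h : IsCompactVariation κ r) (x : M)
    {w : Coord n → ℝ} (hw : Continuous w) :
    LocallyDominated w (Ioo (-r) r ×ˢ dom x) (deviation κ x) := by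
  obtain ⟨K, hK, hκ⟩ := h.compact
  refine locallyDominated_of_support (isOpen_params r x) (h.contDiffOn_deviation x) hw
    fun C hCs hC => ?_
  obtain ⟨R, hR⟩ := exists_momentum_bound hK (hC.image continuous_snd) (x := x) (by
    rintro _ ⟨s, hs, rfl⟩
    exact (hCs hs).2)
  refine ⟨R, fun s hs v hv => sub_eq_zero.2 (hκ _ (hCs hs).1 _ fun hk => ?_)⟩
  exact absurd (hR s.2 (mem_image_of_mem _ hs) v hk) (not_le.2 hv)

variable [T2Space M] {w : Coord n → ℝ} {c : ℝ}

theorem integral_eq (h : IsCompactVariation κ r) (hd : FibreDecay fun z => κ (0, z))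
    (hw : Continuous w) (hc : ∀ v, |w v| ≤ c * (1 + ‖v‖)) {x : M} {s : ℝ × Coord n}
    (hs : s ∈ Ioo (-r) r ×ˢ dom x) : ∫ v, w v * κ (s.1, canon x (s.2, v))
      = (∫ v, w v • deviation κ x (s, v)) + ∫ v, w v • κ (0, canon x (s.2, v)) := by
  rw [← integral_add ((h.locallyDominated_deviation x hw).integrable (h.contDiffOn_deviation x) hw
    hs) ((hd.locallyDominated hw hc x).integrable (contDiffOn_comp_canon h.contMDiff_zero x) hw
      hs.2)]
  refine integral_congr_ae (Eventually.of_forall fun v => ?_)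
  simp only [deviation, coordCurve, smul_eq_mul]
  ring

theorem contDiffOn_integral (h : IsCompactVariation κ r) (hd : FibreDecay fun z => κ (0, z))
    (hw : Continuous w) (hc : ∀ v, |w v| ≤ c * (1 + ‖v‖)) (x : M) :
    ContDiffOn ℝ ∞ (fun s : ℝ × Coord n => ∫ v, w v * κ (s.1, canon x (s.2, v)))
      (Ioo (-r) r ×ˢ dom x) := by
  have h1 := contDiffOn_integral_of_locallyDominated (isOpen_params r x) hw
    (h.contDiffOn_deviation x) (h.locallyDominated_deviation x hw)
  have h2 := contDiffOn_integral_of_locallyDominated (isOpen_dom x) hw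
    (contDiffOn_comp_canon h.contMDiff_zero x) (hd.locallyDominated hw hc x)
  exact (h1.add (h2.comp contDiffOn_snd fun s hs => hs.2)).congr
    fun s hs => h.integral_eq hd hw hc hs

/-- The derivative of the curve at `0`. -/
def velocity (κ : ℝ × Cotangent n M → ℝ) (z : Cotangent n M) : ℝ := deriv (fun ε => κ (ε, z)) 0

theorem hasDerivAt_coordCurve (h : IsCompactVariation κ r) {x : M} {y : Coord n} (hy : y ∈ dom x)
    (v : Coord n) : HasDerivAt (fun ε => κ (ε, canon x (y, v)))
      (fderiv ℝ (coordCurve κ x) ((0, y), v) ((1, 0), 0)) 0 := by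
  have h1 := ((contDiffAt_of_prod (isOpen_params r x) (h.contDiffOn_coordCurve x)
    (y := ((0 : ℝ), y)) (mem_prod.2 ⟨h.zero_mem, hy⟩) v).differentiableAt (by simp)).hasFDerivAt
  have h2 : HasDerivAt (fun ε : ℝ => ((ε, y), v)) ((1, 0), 0) 0 :=
    ((hasDerivAt_id 0).prodMk (hasDerivAt_const _ _)).prodMk (hasDerivAt_const _ _)
  exact h1.comp_hasDerivAt 0 h2

theorem velocity_canon (h : IsCompactVariation κ r) {x : M} {y : Coord n} (hy : y ∈ dom x)
    (v : Coord n) : velocity κ (canon x (y, v))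
      = fderiv ℝ (coordCurve κ x) ((0, y), v) ((1, 0), 0) :=
  (h.hasDerivAt_coordCurve hy v).deriv

theorem hasDerivAt_velocity (h : IsCompactVariation κ r) (z : Cotangent n M) :
    HasDerivAt (fun ε => κ (ε, z)) (velocity κ z) 0 := by
  have hz : z.1 ∈ (extChartAt (𝓡 n) z.1).source := mem_extChartAt_source z.1
  have h1 := h.hasDerivAt_coordCurve (canonCoord_fst_mem hz) (canonCoord z.1 z).2
  rw [Prod.mk.eta, canon_canonCoord hz] at h1
  exact h1.differentiableAt.hasDerivAt

theorem contMDiff_velocity (h : IsCompactVariation κ r) :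
    ContMDiff (cotModel n) 𝓘(ℝ, ℝ) ∞ (velocity κ) := by
  refine contMDiff_of_canon fun x => ?_
  have h1 : ContDiffOn ℝ ∞ (fderiv ℝ (coordCurve κ x)) ((Ioo (-r) r ×ˢ dom x) ×ˢ univ) :=
    (h.contDiffOn_coordCurve x).fderiv_of_isOpen ((isOpen_params r x).prod isOpen_univ) (by simp)
  have h2 : ContDiffOn ℝ ∞ (fun w : Coord n × Coord n =>
      fderiv ℝ (coordCurve κ x) ((0, w.1), w.2) ((1, 0), 0)) (dom x ×ˢ univ) :=
    (h1.comp (f := fun w : Coord n × Coord n => ((0, w.1), w.2)) (by fun_prop)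
      fun w hw => mem_prod.2 ⟨mem_prod.2 ⟨h.zero_mem, hw.1⟩, mem_univ _⟩).clm_apply
      contDiffOn_const
  exact h2.congr fun w hw => h.velocity_canon hw.1 w.2

theorem velocity_eq_zero (h : IsCompactVariation κ r) {z : Cotangent n M}
    (hz : ∀ ε ∈ Ioo (-r) r, κ (ε, z) = κ (0, z)) : velocity κ z = 0 := by
  have : (fun ε => κ (ε, z)) =ᶠ[𝓝 0] fun _ => κ (0, z) := by
    filter_upwards [Ioo_mem_nhds h.zero_mem.1 h.zero_mem.2] with ε hε using hz ε hε
  rw [velocity, this.deriv_eq, deriv_const]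

theorem hasCompactSupport_velocity (h : IsCompactVariation κ r) :
    HasCompactSupport (velocity κ) := by
  obtain ⟨K, hK, hκ⟩ := h.compact
  have := t2Space_cotangent (n := n) (M := M)
  exact HasCompactSupport.intro hK fun z hz => h.velocity_eq_zero fun ε hε => hκ ε hε z hz

/-- Differentiation of the moments of a curve under the integral sign. -/
theorem hasDerivAt_integral (h : IsCompactVariation κ r) (hd : FibreDecay fun z => κ (0, z))
    (hw : Continuous w) (hc : ∀ v, |w v| ≤ c * (1 + ‖v‖)) {x : M} {y : Coord n} (hy : y ∈ dom x) :
    Integrable (fun v => w v * velocity κ (canon x (y, v))) ∧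
    HasDerivAt (fun ε => ∫ v, w v * κ (ε, canon x (y, v)))
      (∫ v, w v * velocity κ (canon x (y, v))) 0 := by
  have hs : ((0 : ℝ), y) ∈ Ioo (-r) r ×ˢ dom x := mem_prod.2 ⟨h.zero_mem, hy⟩
  -- The subtracted term does not depend on ε, so the deviation and the curve have the same
  -- ε-derivative.
  have hp : ∀ v, KineticFluid.partialDeriv (deviation κ x) ((0, y), v) (1, 0)
      = velocity κ (canon x (y, v)) := fun v => by
    have h1 := ((contDiffAt_of_prod (isOpen_params r x) (h.contDiffOn_deviation x) hs
      v).differentiableAt (by simp)).hasFDerivAt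
    have h2 : HasDerivAt (fun ε : ℝ => ((ε, y), v)) ((1, 0), 0) 0 :=
      ((hasDerivAt_id 0).prodMk (hasDerivAt_const _ _)).prodMk (hasDerivAt_const _ _)
    have h3 := h1.comp_hasDerivAt 0 h2
    have h4 := (h.hasDerivAt_velocity (canon x (y, v))).sub_const (κ (0, canon x (y, v)))
    exact h3.unique h4
  have hi := ((h.locallyDominated_deviation x hw).partialDeriv (isOpen_params r x)
    (h.contDiffOn_deviation x)).integrable (contDiffOn_partialDeriv (isOpen_params r x)
    (h.contDiffOn_deviation x)) hw hs
  have hder := hasFDerivAt_integral_of_locallyDominated (isOpen_params r x)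
    (h.contDiffOn_deviation x) hw (h.locallyDominated_deviation x hw) hs
  have h2 : HasDerivAt (fun ε : ℝ => (ε, y)) ((1 : ℝ), (0 : Coord n)) 0 :=
    (hasDerivAt_id 0).prodMk (hasDerivAt_const _ _)
  have h3 := hder.comp_hasDerivAt 0 h2
  rw [ContinuousLinearMap.integral_apply hi] at h3
  simp only [smul_apply, hp, smul_eq_mul] at h3
  have hi' := (ContinuousLinearMap.apply ℝ ℝ ((1 : ℝ), (0 : Coord n))).integrable_comp hi
  refine ⟨?_, ?_⟩
  · refine hi'.congr (Eventually.of_forall fun v => ?_)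
    simp [hp]
  · refine (h3.add_const (∫ v, w v • κ (0, canon x (y, v)))).congr_of_eventuallyEq ?_
    filter_upwards [Ioo_mem_nhds h.zero_mem.1 h.zero_mem.2] with ε hε
    exact h.integral_eq hd hw hc (s := (ε, y)) (mem_prod.2 ⟨hε, hy⟩)

end IsCompactVariation

end

/-! ### Functional derivatives of F ∘ J and their uniqueness -/

section

variable {n : ℕ} {M : Type*} [TopologicalSpace M] [ChartedSpace (Coord n) M]
  [IsManifold (𝓡 n) ∞ M] {I : Set ℝ}

theorem IsKineticVariation.exists_isCompactVariation {c : ℝ → PhaseDensity n M I}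
    (h : IsKineticVariation c) :
    ∃ r, IsCompactVariation (fun s : ℝ × Cotangent n M => (c s.1).toFun s.2) r := by
  obtain ⟨r, hr, hs, hK⟩ := h
  exact ⟨r, hr, hs, hK⟩

variable (h0 : (0 : ℝ) ∈ I) {ξ : ℝ} (hξ : ξ ∈ I)

theorem formDensityComp_fluidMoments (f : PhaseDensity n M I) {x : M} {y : Coord n}
    (hy : y ∈ dom x) (e : Coord n) : formDensityComp (fluidMoments h0 hξ f).m x y e
      = ∫ v, inner ℝ v e * f.toFun (canon x (y, v)) := by
  have h1 := (f.fibreDecay h0).formDensityComp_eq f.smooth hy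
  have h2 := (f.fibreDecay h0).integrable_covec_canon f.smooth hy
  change formDensityComp (momentumDensity f.toFun) x y e = _
  rw [h1, ContinuousLinearMap.integral_apply h2]
  exact integral_congr_ae (Eventually.of_forall fun v => mul_comm _ _)

theorem densityComp_fluidMoments (f : PhaseDensity n M I) {x : M} {y : Coord n} (hy : y ∈ dom x) :
    densityComp (n := n) (fluidMoments h0 hξ f).ρ x y
      = ∫ v, (fun _ => (1 : ℝ)) v * f.toFun (canon x (y, v)) ^ (1 + ξ) := by
  simp only [one_mul]
  exact densityComp_fibreIntegral (fun z => f.toFun z ^ (1 + ξ)) hy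

/-- The functional derivative on the kinetic side that corresponds to `X`. -/
def fluidGenerator (ξ : ℝ) (X : FluidAlgebra n M) (f : PhaseDensity n M I) (z : Cotangent n M) :
    ℝ :=
  z.2 (X.1 z.1) + (1 + ξ) * f.toFun z ^ ξ * X.2 z.1

theorem contMDiff_fluidGenerator (X : FluidAlgebra n M) (f : PhaseDensity n M I) :
    ContMDiff (cotModel n) 𝓘(ℝ, ℝ) ∞ (fluidGenerator ξ X f) :=
  (contMDiff_momentum X.1).add
    ((contMDiff_const.mul (f.contMDiff_rpow _)).mul (contMDiff_basic X.2.contMDiff))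

section Variation

variable [T2Space M]

/-- F can be differentiated only along admissible curves of fluid variables. Smoothness is
differentiation under the integral; outside the projection of the compact set the fibres never meet
it, so there the moments are constant. -/
theorem isFluidVariation_fluidMoments {c : ℝ → PhaseDensity n M I} (hc : IsKineticVariation c) :
    IsFluidVariation fun ε => fluidMoments h0 hξ (c ε) := by
  obtain ⟨r, h⟩ := hc.exists_isCompactVariation
  have hp := h.rpow (fun s => (c s.1).pos s.2) (1 + ξ)
  refine ⟨r, h.pos, fun x => ?_, fun x => ?_, ?_⟩
  · rw [contDiffOn_clm_apply]
    intro e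
    refine (h.contDiffOn_integral ((c 0).fibreDecay h0) (continuous_inner_left e) (growth_inner e)
      x).congr fun s hs => ?_
    exact formDensityComp_fluidMoments h0 hξ (c s.1) hs.2 e
  · refine (hp.contDiffOn_integral ((c 0).decay ξ hξ).1 continuous_const growth_one
      x).congr fun s hs => ?_
    exact densityComp_fluidMoments h0 hξ (c s.1) hs.2
  · obtain ⟨K, hK, hκ⟩ := h.compact
    refine ⟨TotalSpace.proj '' K, hK.image continuous_proj_cotangent, fun ε hε q hq => ?_⟩
    have heq : ∀ v, (c ε).toFun (cotPoint q v) = (c 0).toFun (cotPoint q v) := fun v =>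
      hκ ε hε _ fun hk => hq ⟨_, hk, rfl⟩
    constructor
    · change (∫ v : Coord n, _ : Coord n →L[ℝ] ℝ) = (∫ v : Coord n, _ : Coord n →L[ℝ] ℝ)
      simp only [heq]
    · change (∫ v : Coord n, (c ε).toFun (cotPoint q v) ^ (1 + ξ)) = (∫ v : Coord n, _)
      simp only [heq]

/-- The ε-derivative of f_ε^{1+ξ} is (1+ξ) f^ξ times that of f_ε. This is the source of the second
summand of `fluidGenerator`. -/
theorem hasDerivAt_pairingDensity {c : ℝ → PhaseDensity n M I} {r : ℝ}
    (h : IsCompactVariation (fun s : ℝ × Cotangent n M => (c s.1).toFun s.2) r)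
    (X : FluidAlgebra n M) (q : M) :
    HasDerivAt (fun ε => pairingDensity (fluidMoments h0 hξ (c ε)) X q)
      (∫ v, fluidGenerator ξ X (c 0) (cotPoint q v) *
        IsCompactVariation.velocity (fun s : ℝ × Cotangent n M => (c s.1).toFun s.2)
          (cotPoint q v)) 0 := by
  set κ := fun s : ℝ × Cotangent n M => (c s.1).toFun s.2 with hκ
  have hp := h.rpow (fun s => (c s.1).pos s.2) (1 + ξ)
  obtain ⟨e, he⟩ : ∃ e : Coord n, e = X.1 q := ⟨_, rfl⟩
  have hy := mem_extChartAt_target (I := 𝓡 n) q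
  obtain ⟨i1, d1⟩ := h.hasDerivAt_integral ((c 0).fibreDecay h0) (continuous_inner_left e)
    (growth_inner e) hy
  obtain ⟨i2, d2⟩ := hp.hasDerivAt_integral ((c 0).decay ξ hξ).1 continuous_const growth_one hy
  simp only [← cotPoint_eq_canon] at i1 i2 d1 d2
  have hv : ∀ z, IsCompactVariation.velocity (fun s => κ s ^ (1 + ξ)) z
      = (1 + ξ) * (c 0).toFun z ^ ξ * IsCompactVariation.velocity κ z := fun z => by
    have h1 := (h.hasDerivAt_velocity z).rpow_const (p := 1 + ξ) (Or.inl ((c 0).pos z).ne')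
    rw [IsCompactVariation.velocity, h1.deriv]
    simp only [add_sub_cancel_left]
    ring
  have d3 := d1.add (d2.mul_const (X.2 q))
  rw [← integral_mul_const, ← integral_add i1 (i2.mul_const _)] at d3
  convert! d3 using 1
  · ext ε
    rw [pairingDensity_fluidMoments]
    have i3 := integrable_momentum_cotPoint (c ε) h0 q
    have i4 := integrable_mass_cotPoint (c ε) hξ q
    have i5 : Integrable fun v : Coord n => inner ℝ v e * (c ε).toFun (cotPoint q v) := by
      refine ((ContinuousLinearMap.apply ℝ ℝ e).integrable_comp i3).congr
        (Eventually.of_forall fun v => ?_)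
      exact mul_comm _ _
    simp only [Pi.add_apply, one_mul]
    rw [← integral_mul_const, ← integral_add i5 (i4.mul_const _)]
    refine integral_congr_ae (Eventually.of_forall fun v => ?_)
    simp only [momentIntegrand, he]
    rfl
  · refine integral_congr_ae (Eventually.of_forall fun v => ?_)
    simp only [hv, fluidGenerator, he, one_mul]
    change (inner ℝ v (X.1 q) + (1 + ξ) * (c 0).toFun (cotPoint q v) ^ ξ * X.2 q) * _ = _
    ring

variable [SecondCountableTopology M] [MeasurableSpace M] [BorelSpace M]

theorem measurable_baseDensity_fibreIntegral {Φ : Cotangent n M → ℝ} (hΦ : Continuous Φ) :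
    Measurable (baseDensity n fun q => ∫ v, Φ (cotPoint q v)) := by
  have h : StronglyMeasurable fun w : M × Coord n => Φ (indexedCanon w) :=
    (hΦ.measurable.comp measurable_indexedCanon).stronglyMeasurable
  have h2 := (StronglyMeasurable.integral_prod_right' (ν := (volume : Measure (Coord n))) h).measurable
  simp only [integral_indexedCanon] at h2
  exact h2

/-- Chain rule: F is differentiated along the induced fluid variation, and the resulting integral
over M is unfolded to T*M by Fubini. The integrand there has compact support because the velocity of
the variation does. -/
theorem hasKineticDeriv_comp_fluidMoments {F : FluidDual n M → ℝ} {f : PhaseDensity n M I}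
    {X : FluidAlgebra n M} (hF : HasFluidDeriv F (fluidMoments h0 hξ f) X) :
    HasKineticDeriv (F ∘ fluidMoments h0 hξ) f (fluidGenerator ξ X f) := by
  refine ⟨contMDiff_fluidGenerator X f, fun c hc hcf => ?_⟩
  have h1 := hF _ (isFluidVariation_fluidMoments h0 hξ hc) (by rw [hcf])
  obtain ⟨r, h⟩ := hc.exists_isCompactVariation
  have h2 : (fun q => deriv (fun ε => pairingDensity (fluidMoments h0 hξ (c ε)) X q) 0)
      = fun q => ∫ v, (fun z => fluidGenerator ξ X f z *
        IsCompactVariation.velocity (fun s : ℝ × Cotangent n M => (c s.1).toFun s.2) z)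
          (cotPoint q v) := funext fun q => by
    rw [(hasDerivAt_pairingDensity h0 hξ h X q).deriv, hcf]
  have hcont : Continuous fun z => fluidGenerator ξ X f z *
        IsCompactVariation.velocity (fun s : ℝ × Cotangent n M => (c s.1).toFun s.2) z :=
    (contMDiff_fluidGenerator X f).continuous.mul h.contMDiff_velocity.continuous
  have h3 := integral_liouville (hcont.integrable_of_hasCompactSupport (μ := liouville n M)
    h.hasCompactSupport_velocity.mul_left)
  rw [h2, densityIntegral_eq (measurable_baseDensity_fibreIntegral hcont) h3.1, ← h3.2] at h1
  exact h1

/-! ### Uniqueness of functional derivatives -/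

/-- The difference of the two functions vanishes for large momenta over compact sets of base points,
hence decays at any rate. This keeps compactly supported perturbations inside `PhaseDensity`. -/
theorem FibreDecay.congr_compact {k k' : Cotangent n M → ℝ} (hd : FibreDecay k)
    (hk : ContMDiff (cotModel n) 𝓘(ℝ, ℝ) ∞ k) (hk' : ContMDiff (cotModel n) 𝓘(ℝ, ℝ) ∞ k')
    {K : Set (Cotangent n M)} (hK : IsCompact K) (h : ∀ z ∉ K, k' z = k z) : FibreDecay k' := by
  intro x C hCx hC j
  obtain ⟨N, hN, B, hB, hbd⟩ := hd.exists_bound hCx hC j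
  refine ⟨N, hN, ?_⟩
  have hs := contDiffOn_comp_canon hk x
  have hs' := contDiffOn_comp_canon hk' x
  set D : Coord n × Coord n → ℝ := fun w => k' (canon x w) - k (canon x w) with hD
  have hDs : ContDiffOn ℝ ∞ D (dom x ×ˢ univ) := hs'.sub hs
  obtain ⟨C', hC', hCC', hC'x⟩ := exists_compact_between hC (isOpen_dom x) hCx
  obtain ⟨R, hR⟩ := exists_momentum_bound hK hC' hC'x
  obtain ⟨B', hB', hbd'⟩ := exists_iteratedFDeriv_bound (isOpen_dom x) hDs hC hCx (r := R)
    (fun y hy v hv => by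
      rw [notMem_tsupport_iff_eventuallyEq]
      have : interior C' ×ˢ {v : Coord n | R < ‖v‖} ∈ 𝓝 (y, v) :=
        (isOpen_interior.prod (isOpen_lt continuous_const continuous_norm)).mem_nhds ⟨hCC' hy, hv⟩
      filter_upwards [this] with z hz
      refine sub_eq_zero.2 (h _ fun hzK => ?_)
      exact absurd (hR z.1 (interior_subset hz.1) z.2 hzK) (not_le.2 hz.2)) j
  have hN0 : 0 ≤ N := by have : (0 : ℝ) ≤ n := n.cast_nonneg; linarith
  -- On the ball of radius R the factor (1 + ‖v‖)^(-N) is at least (1 + |R|)^(-N), so this constant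
  -- absorbs the plain bound `B'`; outside the ball the difference contributes nothing.
  refine ⟨B + B' * (1 + |R|) ^ N, fun y hy v => ?_⟩
  have hpos : 0 < 1 + ‖v‖ := by positivity
  have hpw : 0 ≤ (1 + ‖v‖) ^ (-N) := Real.rpow_nonneg hpos.le _
  have h1 : k' ∘ canon x = (fun w => k (canon x w)) + D := by
    ext w; simp [hD]
  have c1 : ContDiffAt ℝ j (fun w => k (canon x w)) (y, v) :=
    (contDiffAt_of_prod (isOpen_dom x) hs (hCx hy) v).of_le (mod_cast le_top)
  have c2 : ContDiffAt ℝ j D (y, v) :=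
    (contDiffAt_of_prod (isOpen_dom x) hDs (hCx hy) v).of_le (mod_cast le_top)
  rw [h1, iteratedFDeriv_add_apply c1 c2]
  refine (norm_add_le _ _).trans ?_
  rw [add_mul]
  refine add_le_add (hbd y hy v) ((hbd' y hy v).trans ?_)
  by_cases hv : v ∈ Metric.closedBall (0 : Coord n) R
  · rw [indicator_of_mem hv, mul_assoc, Real.rpow_neg hpos.le]
    have hvR : ‖v‖ ≤ |R| := (by simpa using hv : ‖v‖ ≤ R).trans (le_abs_self R)
    refine le_mul_of_one_le_right hB' ?_
    rw [← div_eq_mul_inv, one_le_div (Real.rpow_pos_of_pos hpos _)]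
    gcongr
  · rw [indicator_of_notMem hv]
    positivity

/-- The curve `ε ↦ f exp(ε φ)` of distribution functions. -/
def expVariation (f : PhaseDensity n M I) {φ : Cotangent n M → ℝ}
    (hφ : ContMDiff (cotModel n) 𝓘(ℝ, ℝ) ∞ φ) (hc : HasCompactSupport φ) (ε : ℝ) :
    PhaseDensity n M I where
  toFun z := f.toFun z * Real.exp (ε * φ z)
  smooth := f.smooth.mul (Real.contDiff_exp.contMDiff.comp (contMDiff_const.mul hφ))
  pos z := mul_pos (f.pos z) (Real.exp_pos _)
  decay := fun ξ hξ => by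
    have key : ∀ σ : ℝ, FibreDecay (fun z => f.toFun z ^ σ) →
        FibreDecay (fun z => (f.toFun z * Real.exp (ε * φ z)) ^ σ) := fun σ hσ => by
      have hs : ContMDiff (cotModel n) 𝓘(ℝ, ℝ) ∞
          (fun z => (f.toFun z * Real.exp (ε * φ z)) ^ σ) := fun z => by
        have h1 : ContDiffAt ℝ ∞ (fun t : ℝ => t ^ σ) (f.toFun z * Real.exp (ε * φ z)) :=
          Real.contDiffAt_rpow_const_of_ne (mul_pos (f.pos z) (Real.exp_pos _)).ne'
        exact h1.contMDiffAt.comp z (f.smooth.mul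
          (Real.contDiff_exp.contMDiff.comp (contMDiff_const.mul hφ)) z)
      refine hσ.congr_compact (f.contMDiff_rpow σ) hs hc fun z hz => ?_
      rw [image_eq_zero_of_notMem_tsupport hz]
      simp
    exact ⟨key _ (f.decay ξ hξ).1, key _ (f.decay ξ hξ).2⟩

theorem isKineticVariation_expVariation (f : PhaseDensity n M I) {φ : Cotangent n M → ℝ}
    (hφ : ContMDiff (cotModel n) 𝓘(ℝ, ℝ) ∞ φ) (hc : HasCompactSupport φ) :
    IsKineticVariation (expVariation f hφ hc) := by
  refine ⟨1, one_pos, ?_, tsupport φ, hc, fun ε _ z hz => ?_⟩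
  · refine ContMDiff.contMDiffOn ?_
    exact (f.smooth.comp contMDiff_snd).mul
      (Real.contDiff_exp.contMDiff.comp (contMDiff_fst.mul (hφ.comp contMDiff_snd)))
  · simp [expVariation, image_eq_zero_of_notMem_tsupport hz]

/-- The fundamental lemma of the calculus of variations. The exponential curves stay positive and
have velocity f ψ; taking ψ = (a - b) φ with a bump φ at a point where a and b differ makes the
integral of (a - b)² f φ both zero and positive. -/
theorem HasKineticDeriv.unique {F : PhaseDensity n M I → ℝ} {f : PhaseDensity n M I}
    {a b : Cotangent n M → ℝ} (ha : HasKineticDeriv F f a) (hb : HasKineticDeriv F f b) :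
    a = b := by
  have := t2Space_cotangent (n := n) (M := M)
  by_contra hne
  obtain ⟨z, hz⟩ : ∃ z, a z ≠ b z := by
    by_contra h
    exact hne (funext fun z => not_not.1 fun hz => h ⟨z, hz⟩)
  obtain ⟨φ, hφ⟩ : ∃ φ : SmoothBumpFunction (cotModel n) z, True := exists_true_iff_nonempty.2 inferInstance
  have key : ∀ ψ : Cotangent n M → ℝ, ContMDiff (cotModel n) 𝓘(ℝ, ℝ) ∞ ψ → HasCompactSupport ψ →
      ∫ w, (a w - b w) * (f.toFun w * ψ w) ∂(liouville n M) = 0 := by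
    intro ψ hψ hc
    have hv := isKineticVariation_expVariation f hψ hc
    have h0 : expVariation f hψ hc 0 = f := by
      cases f; simp [expVariation]
    have hd : ∀ w, deriv (fun ε => (expVariation f hψ hc ε).toFun w) 0 = f.toFun w * ψ w := by
      intro w
      have h1 : HasDerivAt (fun ε : ℝ => ε * ψ w) (ψ w) 0 := by
        simpa using (hasDerivAt_id (0 : ℝ)).mul_const (ψ w)
      have h2 := (h1.exp).const_mul (f.toFun w)
      simp only [zero_mul, Real.exp_zero, one_mul] at h2
      exact h2.deriv
    have e := (ha.2 _ hv h0).unique (hb.2 _ hv h0)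
    simp only [hd] at e
    have hint : ∀ g : Cotangent n M → ℝ, ContMDiff (cotModel n) 𝓘(ℝ, ℝ) ∞ g →
        Integrable (fun w => g w * (f.toFun w * ψ w)) (liouville n M) := fun g hg =>
      (hg.continuous.mul (f.smooth.continuous.mul hψ.continuous)).integrable_of_hasCompactSupport
        (hc.mul_left.mul_left)
    simp only [sub_mul]
    rw [integral_sub (hint a ha.1) (hint b hb.1), e, sub_self]
  have hs : ContMDiff (cotModel n) 𝓘(ℝ, ℝ) ∞ (fun w => (a w - b w) * φ w) :=
    (ha.1.sub hb.1).mul φ.contMDiff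
  have hcs : HasCompactSupport fun w => (a w - b w) * φ w := φ.hasCompactSupport.mul_left
  have h0 := key _ hs hcs
  have hpos : 0 < ∫ w, (a w - b w) * (f.toFun w * ((a w - b w) * φ w)) ∂(liouville n M) := by
    refine Continuous.integral_pos_of_hasCompactSupport_nonneg_nonzero (x := z)
      ((ha.1.sub hb.1).continuous.mul (f.smooth.continuous.mul hs.continuous))
      (hcs.mul_left.mul_left) (fun w => ?_) ?_
    · have : (a w - b w) * (f.toFun w * ((a w - b w) * φ w))
          = (a w - b w) ^ 2 * f.toFun w * φ w := by ring
      rw [this]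
      exact mul_nonneg (mul_nonneg (sq_nonneg _) (f.pos w).le) φ.nonneg
    · rw [φ.eq_one, mul_one]
      exact mul_ne_zero (sub_ne_zero.2 hz) (mul_ne_zero (f.pos z).ne' (sub_ne_zero.2 hz))
  exact hpos.ne' h0

/-- Uniqueness identifies the arbitrarily chosen derivative with the explicit one. The fluid side
can do without such a statement, as its chosen derivatives are carried along as they are. -/
theorem kineticDeriv_eq {F : PhaseDensity n M I → ℝ} {f : PhaseDensity n M I}
    {a : Cotangent n M → ℝ} (ha : HasKineticDeriv F f a) : kineticDeriv F f = a :=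
  (Classical.epsilon_spec (p := HasKineticDeriv F f) ⟨a, ha⟩).unique ha

end Variation

end

section

variable {n : ℕ}

/-! ### The canonical bracket in linear coordinates -/

theorem sum_inner_stdVec (u : Coord n) : ∑ i, inner ℝ (stdVec i) u • stdVec i = u := by
  have h := (EuclideanSpace.basisFun (Fin n) ℝ).sum_repr u
  simpa [stdVec, EuclideanSpace.inner_single_left] using h

/-- The momentum part of a covector on phase space, as a vector of positions. -/
def momentumGrad (γ : Coord n × Coord n →L[ℝ] ℝ) : Coord n := ∑ i, γ (0, stdVec i) • stdVec i

theorem inner_momentumGrad (γ : Coord n × Coord n →L[ℝ] ℝ) (u : Coord n) :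
    inner ℝ (momentumGrad γ) u = γ (0, u) := by
  have h : γ (0, u) = (γ.comp (ContinuousLinearMap.inr ℝ (Coord n) (Coord n))) u := by simp
  rw [h]
  conv_rhs => rw [← sum_inner_stdVec u]
  rw [map_sum, momentumGrad, sum_inner]
  refine Finset.sum_congr rfl fun i _ => ?_
  rw [map_smul, inner_smul_left]
  simp [mul_comm]

/-- The canonical Poisson bracket of two covectors on phase space. -/
def canonicalBracket (α β : Coord n × Coord n →L[ℝ] ℝ) : ℝ :=
  α (momentumGrad β, 0) - β (momentumGrad α, 0)

theorem apply_momentumGrad (α β : Coord n × Coord n →L[ℝ] ℝ) :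
    α (momentumGrad β, 0) = ∑ i, α (stdVec i, 0) * β (0, stdVec i) := by
  have h : ∀ u, α (u, 0) = (α.comp (ContinuousLinearMap.inl ℝ (Coord n) (Coord n))) u := by simp
  simp only [h, momentumGrad, map_sum, map_smul, smul_eq_mul, mul_comm]

/-- Point transformations, lifted to momenta, preserve the canonical bracket. -/
theorem canonicalBracket_comp (α β : Coord n × Coord n →L[ℝ] ℝ)
    {D : Coord n × Coord n →L[ℝ] Coord n × Coord n} {L S : Coord n →L[ℝ] Coord n}
    {H : Coord n →L[ℝ] Coord n →L[ℝ] Coord n} {v : Coord n} (hLS : ∀ u, L (S u) = u)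
    (hH : ∀ u w, H u w = H w u) (h1 : ∀ w κ, (D (w, κ)).1 = L w)
    (h2 : ∀ w κ u, inner ℝ (D (w, κ)).2 u = inner ℝ κ (S u) + inner ℝ v (H (L w) u)) :
    canonicalBracket (α.comp D) (β.comp D) = canonicalBracket α β := by
  have hm : ∀ γ : Coord n × Coord n →L[ℝ] ℝ, momentumGrad (γ.comp D) = S (momentumGrad γ) := by
    intro γ
    refine ext_inner_right ℝ fun u => ?_
    have h3 : D (0, u) = (0, (D (0, u)).2) := Prod.ext (by simp [h1]) rfl
    rw [inner_momentumGrad, ContinuousLinearMap.comp_apply, h3, ← inner_momentumGrad,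
      real_inner_comm, h2]
    simp [real_inner_comm]
  -- Differentiating the momentum transformation in the position variable produces a
  -- second-derivative term. It is symmetric in the two momentum gradients, so it cancels in the
  -- antisymmetric bracket.
  have ha : ∀ γ : Coord n × Coord n →L[ℝ] ℝ, ∀ b, (γ.comp D) (S b, 0)
      = γ (b, 0) + inner ℝ v (H b (momentumGrad γ)) := by
    intro γ b
    have h3 : D (S b, 0) = (b, 0) + (0, (D (S b, 0)).2) := Prod.ext (by simp [h1, hLS]) (by simp)
    rw [ContinuousLinearMap.comp_apply, h3, map_add, ← inner_momentumGrad, real_inner_comm, h2]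
    simp [hLS]
  rw [canonicalBracket, hm, hm, ha, ha, canonicalBracket, hH]
  ring

variable {M : Type*} [TopologicalSpace M] [ChartedSpace (Coord n) M] [IsManifold (𝓡 n) ∞ M]

theorem poissonBracket_eq_self (a b : Cotangent n M → ℝ) (z : Cotangent n M) :
    poissonBracket a b z = canonicalBracket (fderiv ℝ (a ∘ canon z.1) (canonCoord z.1 z))
      (fderiv ℝ (b ∘ canon z.1) (canonCoord z.1 z)) := by
  set E : (Coord n × Coord n) ≃L[ℝ] (Coord n × (Coord n →L[ℝ] ℝ)) :=
    (ContinuousLinearEquiv.refl ℝ (Coord n)).prodCongr covecL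
  have hE : E (canonCoord z.1 z) = extChartAt (cotModel n) z z :=
    Prod.ext rfl (covecL.apply_symm_apply _)
  have h : ∀ c : Cotangent n M → ℝ, fderiv ℝ (c ∘ canon z.1) (canonCoord z.1 z)
      = (fderiv ℝ (c ∘ (extChartAt (cotModel n) z).symm) (extChartAt (cotModel n) z z)).comp
        (E : Coord n × Coord n →L[ℝ] Coord n × (Coord n →L[ℝ] ℝ)) := fun c => by
    rw [← hE, ← E.comp_right_fderiv]
    rfl
  rw [canonicalBracket, apply_momentumGrad, apply_momentumGrad, ← Finset.sum_sub_distrib, h, h]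
  refine Finset.sum_congr rfl fun i _ => ?_
  have e1 : E (stdVec i, 0) = (stdVec i, 0) := Prod.ext rfl (map_zero covecL)
  have e2 : E (0, stdVec i) = (0, covec (stdVec i)) := rfl
  simp only [ContinuousLinearMap.comp_apply, ContinuousLinearEquiv.coe_coe, e1, e2]

/-- The change of coordinates on `M`. -/
def coordChange (x x' : M) : Coord n → Coord n := extChartAt (𝓡 n) x' ∘ (extChartAt (𝓡 n) x).symm

/-- The change of canonical coordinates on `T*M`. -/
def canonChange (x x' : M) (w : Coord n × Coord n) : Coord n × Coord n :=
  (coordChange x x' w.1,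
    covecL.symm ((covecL w.2).comp (fderiv ℝ (coordChange x' x) (coordChange x x' w.1))))

theorem fderiv_coordChange {x x' : M} {y : Coord n} (hy : y ∈ overlap x x') :
    fderiv ℝ (coordChange x x') y = tangentCoordChange (𝓡 n) x x' ((extChartAt (𝓡 n) x).symm y) :=
  (hasFDerivAt_extChartAt_comp hy.1 hy.2).fderiv

theorem coordChange_symm_apply {x x' : M} {y : Coord n} (hy : y ∈ overlap x x') :
    (extChartAt (𝓡 n) x').symm (coordChange x x' y) = (extChartAt (𝓡 n) x).symm y :=
  (extChartAt (𝓡 n) x').left_inv hy.2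

theorem coordChange_mem_overlap {x x' : M} {y : Coord n} (hy : y ∈ overlap x x') :
    coordChange x x' y ∈ overlap x' x := by
  refine ⟨(extChartAt (𝓡 n) x').map_source hy.2, ?_⟩
  rw [mem_preimage, coordChange_symm_apply hy]
  exact (extChartAt (𝓡 n) x).map_target hy.1

theorem canonCoord_canon_eq_canonChange {x x' : M} {y : Coord n} (hy : y ∈ overlap x x')
    (v : Coord n) : canonCoord x' (canon x (y, v)) = canonChange x x' (y, v) := by
  have hq : (canon x (y, v)).1 ∈ (extChartAt (𝓡 n) x').source := by rw [proj_canon hy.1]; exact hy.2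
  have hs : (extChartAt (𝓡 n) x).symm y ∈ (extChartAt (𝓡 n) x).source :=
    (extChartAt (𝓡 n) x).map_target hy.1
  rw [canonCoord, extChartAt_cotangent_apply hq, canonChange,
    fderiv_coordChange (coordChange_mem_overlap hy), coordChange_symm_apply hy, canon_eq hy.1]
  refine Prod.ext rfl (congrArg covecL.symm ?_)
  change ((covec v).comp _).comp _ = (covec v).comp _
  rw [ContinuousLinearMap.comp_assoc]
  congr 1
  ext1 u
  rw [ContinuousLinearMap.comp_apply, tangentCoordChange_comp ⟨⟨hy.2, mem_extChartAt_source _⟩, hs⟩]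

theorem comp_canon_eventuallyEq (a : Cotangent n M → ℝ) {x x' : M} {y : Coord n}
    (hy : y ∈ overlap x x') (v : Coord n) :
    a ∘ canon x =ᶠ[𝓝 (y, v)] (a ∘ canon x') ∘ canonChange x x' := by
  filter_upwards [((isOpen_overlap x x').prod isOpen_univ).mem_nhds (mem_prod.2 ⟨hy, mem_univ v⟩)]
    with w hw
  have hq : (canon x w).1 ∈ (extChartAt (𝓡 n) x').source := by
    rw [proj_canon (v := w.2) hw.1.1]; exact hw.1.2
  simp only [Function.comp_apply]
  rw [← canonCoord_canon_eq_canonChange hw.1, canon_canonCoord hq]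

/-- The Poisson bracket may be computed in the canonical coordinates of any preferred chart. -/
theorem poissonBracket_canon {a b : Cotangent n M → ℝ} (ha : ContMDiff (cotModel n) 𝓘(ℝ, ℝ) ∞ a)
    (hb : ContMDiff (cotModel n) 𝓘(ℝ, ℝ) ∞ b) {x : M} {y : Coord n} (hy : y ∈ dom x) (v : Coord n) :
    poissonBracket a b (canon x (y, v)) = canonicalBracket
      (fderiv ℝ (fun w => a (canon x w)) (y, v)) (fderiv ℝ (fun w => b (canon x w)) (y, v)) := by
  -- The bracket at a point is defined in the preferred chart at its base point q, so the chart at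
  -- `x` has to be compared with that one.
  obtain ⟨q, hq⟩ : ∃ q, (extChartAt (𝓡 n) x).symm y = q := ⟨_, rfl⟩
  have hy' : y ∈ overlap x q := ⟨hy, by rw [mem_preimage, hq]; exact mem_extChartAt_source q⟩
  have hz : (canon x (y, v)).1 = q := by rw [proj_canon hy, hq]
  rw [poissonBracket_eq_self, hz, canonCoord_canon_eq_canonChange hy' v]
  obtain ⟨y', v', hw⟩ : ∃ y' v', canonChange x q (y, v) = (y', v') := ⟨_, _, rfl⟩
  have hyy : y' = coordChange x q y := congrArg Prod.fst hw.symm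
  have hy'q : y' ∈ overlap q x := hyy ▸ coordChange_mem_overlap hy'
  have hback : coordChange q x y' = y := by
    rw [hyy, coordChange, Function.comp_apply, coordChange_symm_apply hy',
      (extChartAt (𝓡 n) x).right_inv hy]
  have hw' : canonChange q x (y', v') = (y, v) := by
    rw [← canonCoord_canon_eq_canonChange hy'q, ← hw, ← canonCoord_canon_eq_canonChange hy' v,
      canon_canonCoord (by rw [hz]; exact mem_extChartAt_source q), canonCoord_canon hy]
  rw [hw]
  have hσ : ContDiffAt ℝ ∞ (coordChange x q) y :=
    (contDiffOn_coordChange x q).contDiffAt ((isOpen_overlap x q).mem_nhds hy')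
  have hτ : HasFDerivAt (coordChange q x) (fderiv ℝ (coordChange q x) y') y' :=
    (((contDiffOn_coordChange q x).contDiffAt ((isOpen_overlap q x).mem_nhds hy'q)
      ).differentiableAt (by simp)).hasFDerivAt
  have hdσ : HasFDerivAt (fderiv ℝ (coordChange x q)) (fderiv ℝ (fderiv ℝ (coordChange x q)) y)
      (coordChange q x y') := by
    rw [hback]
    exact ((hσ.fderiv_right (m := ∞) (by simp)).differentiableAt (by simp)).hasFDerivAt
  have hsym := hσ.isSymmSndFDerivAt (by
    rw [minSmoothness_of_isRCLikeNormedField]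
    exact WithTop.coe_le_coe.2 le_top)
  have h1 : HasFDerivAt (fun w : Coord n × Coord n => coordChange q x w.1) _ (y', v') :=
    HasFDerivAt.comp (y', v') (f := Prod.fst) hτ hasFDerivAt_fst
  have h2 : HasFDerivAt (fun w : Coord n × Coord n =>
      fderiv ℝ (coordChange x q) (coordChange q x w.1)) _ (y', v') :=
    HasFDerivAt.comp (y', v') (f := fun w : Coord n × Coord n => coordChange q x w.1) hdσ h1
  have h3 : HasFDerivAt (fun w : Coord n × Coord n => covecL w.2) _ (y', v') :=
    HasFDerivAt.comp (y', v') (f := Prod.snd) (covecL (n := n)).hasFDerivAt hasFDerivAt_snd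
  have h4 := (covecL (n := n)).symm.hasFDerivAt.comp (y', v') (h3.clm_comp h2)
  have hT : HasFDerivAt (canonChange q x) _ (y', v') := h1.prodMk h4
  have hd : ∀ c : Cotangent n M → ℝ, ContMDiff (cotModel n) 𝓘(ℝ, ℝ) ∞ c →
      fderiv ℝ (c ∘ canon q) (y', v')
        = (fderiv ℝ (fun w => c (canon x w)) (y, v)).comp (fderiv ℝ (canonChange q x) (y', v')) := by
    intro c hc
    have hcx : DifferentiableAt ℝ (c ∘ canon x) (canonChange q x (y', v')) := by
      rw [hw']
      exact (contDiffAt_of_prod (isOpen_dom x) (contDiffOn_comp_canon hc x) hy v).differentiableAt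
        (by simp)
    rw [(comp_canon_eventuallyEq c hy'q v').fderiv_eq, fderiv_comp _ hcx hT.differentiableAt, hw']
    rfl
  rw [hd a ha, hd b hb, hT.fderiv]
  -- `L` differentiates the change from the chart at q to the chart at `x`, `S` is its inverse, and
  -- `H` is the second derivative of the inverse change, which appears because momenta are
  -- transformed by a Jacobian depending on position.
  refine canonicalBracket_comp _ _ (L := fderiv ℝ (coordChange q x) y')
    (S := fderiv ℝ (coordChange x q) y) (H := fderiv ℝ (fderiv ℝ (coordChange x q)) y) (v := v')
    (fun u => ?_) (fun u w => hsym.eq u w) (fun w κ => rfl) fun w κ u => ?_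
  · rw [fderiv_coordChange hy'q, fderiv_coordChange hy', hyy, coordChange_symm_apply hy', hq,
      ← ContinuousLinearMap.comp_apply, tangentCoordChange_comp_self (mem_extChartAt_source q)
        (hq ▸ (extChartAt (𝓡 n) x).map_target hy)]
    rfl
  · have hc : ∀ η : Coord n →L[ℝ] ℝ, inner ℝ (covecL.symm η) u = η u := fun η =>
      DFunLike.congr_fun (covecL.apply_symm_apply η) u
    simp only [ContinuousLinearMap.prod_apply, ContinuousLinearMap.comp_apply,
      ContinuousLinearEquiv.coe_coe]
    rw [hc]
    simp [covecL_apply, covec_apply, hback, add_comm]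

theorem contMDiff_poissonBracket {a b : Cotangent n M → ℝ}
    (ha : ContMDiff (cotModel n) 𝓘(ℝ, ℝ) ∞ a) (hb : ContMDiff (cotModel n) 𝓘(ℝ, ℝ) ∞ b) :
    ContMDiff (cotModel n) 𝓘(ℝ, ℝ) ∞ (poissonBracket a b) := by
  refine contMDiff_of_canon fun x => ?_
  have h : ∀ c : Cotangent n M → ℝ, ContMDiff (cotModel n) 𝓘(ℝ, ℝ) ∞ c → ∀ u,
      ContDiffOn ℝ ∞ (fun w => fderiv ℝ (fun w => c (canon x w)) w u) (dom x ×ˢ univ) :=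
    fun c hc u => ((contDiffOn_comp_canon hc x).fderiv_of_isOpen (isOpen_dom_prod x)
      (by simp)).clm_apply contDiffOn_const
  refine ContDiffOn.congr (f := fun w => ∑ i,
    (fderiv ℝ (fun w => a (canon x w)) w (stdVec i, 0) *
      fderiv ℝ (fun w => b (canon x w)) w (0, stdVec i)
    - fderiv ℝ (fun w => b (canon x w)) w (stdVec i, 0) *
      fderiv ℝ (fun w => a (canon x w)) w (0, stdVec i)))
    (ContDiffOn.sum fun i _ => ((h a ha _).mul (h b hb _)).sub ((h b hb _).mul (h a ha _)))
    fun w hw => ?_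
  rw [← Prod.mk.eta (p := w), poissonBracket_canon ha hb hw.1, canonicalBracket,
    apply_momentumGrad, apply_momentumGrad, ← Finset.sum_sub_distrib]

end

section

variable {n : ℕ} {M : Type*} [TopologicalSpace M] [ChartedSpace (Coord n) M]
  [IsManifold (𝓡 n) ∞ M]

/-! ### Lie derivatives and Lie brackets in coordinates -/

theorem mfderiv_extChartAt_eq {x q : M} (hq : q ∈ (extChartAt (𝓡 n) x).source) :
    mfderiv (𝓡 n) 𝓘(ℝ, Coord n) (extChartAt (𝓡 n) x) q = tangentCoordChange (𝓡 n) q x q := by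
  have : IsManifold (𝓡 n) 1 M := IsManifold.of_le (n := ∞) (by simp)
  rw [extChartAt_source] at hq
  exact mfderiv_chartAt_eq_tangentCoordChange hq

theorem mdifferentiableAt_extChartAt_symm {x : M} {y : Coord n} (hy : y ∈ dom x) :
    MDifferentiableAt 𝓘(ℝ, Coord n) (𝓡 n) (extChartAt (𝓡 n) x).symm y :=
  ((contMDiffOn_extChartAt_symm (n := ∞) x).contMDiffAt ((isOpen_dom x).mem_nhds hy)
    ).mdifferentiableAt (by simp)

theorem mfderiv_extChartAt_symm_eq {x : M} {y : Coord n} (hy : y ∈ dom x) :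
    mfderiv 𝓘(ℝ, Coord n) (𝓡 n) (extChartAt (𝓡 n) x).symm y
      = tangentCoordChange (𝓡 n) x ((extChartAt (𝓡 n) x).symm y) ((extChartAt (𝓡 n) x).symm y) := by
  have : IsManifold (𝓡 n) 1 M := IsManifold.of_le (n := ∞) (by simp)
  have hq : (extChartAt (𝓡 n) x).symm y ∈ (extChartAt (𝓡 n) x).source :=
    (extChartAt (𝓡 n) x).map_target hy
  have h1 := mfderivWithin_extChartAt_symm_comp_mfderiv_extChartAt (I := 𝓡 n) hy
  rw [ModelWithCorners.range_eq_univ, mfderivWithin_univ, mfderiv_extChartAt_eq hq] at h1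
  have h2 := tangentCoordChange_comp_self (n := n) (mem_extChartAt_source _) hq
  obtain ⟨D, hD⟩ : ∃ D : Coord n →L[ℝ] Coord n,
    D = mfderiv 𝓘(ℝ, Coord n) (𝓡 n) (extChartAt (𝓡 n) x).symm y := ⟨_, rfl⟩
  rw [← hD] at h1 ⊢
  change D.comp _ = ContinuousLinearMap.id ℝ (Coord n) at h1
  have h3 := congrArg (fun A : Coord n →L[ℝ] Coord n => A.comp (tangentCoordChange (𝓡 n) x
    ((extChartAt (𝓡 n) x).symm y) ((extChartAt (𝓡 n) x).symm y))) h1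
  simp only [ContinuousLinearMap.comp_assoc, h2, ContinuousLinearMap.comp_id,
    ContinuousLinearMap.id_comp] at h3
  exact h3

theorem tangentCoordChange_localVec (u : (q : M) → TangentSpace (𝓡 n) q) {x : M} {y : Coord n}
    (hy : y ∈ dom x) :
    tangentCoordChange (𝓡 n) x ((extChartAt (𝓡 n) x).symm y) ((extChartAt (𝓡 n) x).symm y)
      (localVec u x y) = u ((extChartAt (𝓡 n) x).symm y) :=
  DFunLike.congr_fun (tangentCoordChange_comp_self ((extChartAt (𝓡 n) x).map_target hy)
    (mem_extChartAt_source _)) _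

theorem lieDeriv_extChartAt_symm (u : (q : M) → TangentSpace (𝓡 n) q) {g : M → ℝ}
    (hg : ContMDiff (𝓡 n) 𝓘(ℝ, ℝ) ∞ g) {x : M} {y : Coord n} (hy : y ∈ dom x) :
    lieDeriv u g ((extChartAt (𝓡 n) x).symm y)
      = fderiv ℝ (localFun n g x) y (localVec u x y) := by
  have h1 : fderiv ℝ (localFun n g x) y
      = (mfderiv (𝓡 n) 𝓘(ℝ, ℝ) g ((extChartAt (𝓡 n) x).symm y) : Coord n →L[ℝ] ℝ).comp
        (mfderiv 𝓘(ℝ, Coord n) (𝓡 n) (extChartAt (𝓡 n) x).symm y : Coord n →L[ℝ] Coord n) := by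
    rw [← mfderiv_eq_fderiv]
    exact mfderiv_comp y (hg.mdifferentiableAt (by simp)) (mdifferentiableAt_extChartAt_symm hy)
  have h2 : (mfderiv 𝓘(ℝ, Coord n) (𝓡 n) (extChartAt (𝓡 n) x).symm y : Coord n →L[ℝ] Coord n)
      (localVec u x y) = u ((extChartAt (𝓡 n) x).symm y) := by
    rw [mfderiv_extChartAt_symm_eq hy]
    exact tangentCoordChange_localVec u hy
  exact ((DFunLike.congr_fun h1 (localVec u x y)).trans (congrArg
    (mfderiv (𝓡 n) 𝓘(ℝ, ℝ) g ((extChartAt (𝓡 n) x).symm y) : Coord n →L[ℝ] ℝ) h2)).symm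

theorem mpullback_eq_localVec (u : (q : M) → TangentSpace (𝓡 n) q) {x : M} {y : Coord n}
    (hy : y ∈ dom x) :
    VectorField.mpullback 𝓘(ℝ, Coord n) (𝓡 n) (extChartAt (𝓡 n) x).symm u y = localVec u x y := by
  have hq : (extChartAt (𝓡 n) x).symm y ∈ (extChartAt (𝓡 n) x).source :=
    (extChartAt (𝓡 n) x).map_target hy
  rw [VectorField.mpullback_apply, mfderiv_extChartAt_symm_eq hy]
  have h := ContinuousLinearMap.inverse_eq
    (tangentCoordChange_comp_self (n := n) hq (mem_extChartAt_source _))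
    (tangentCoordChange_comp_self (n := n) (mem_extChartAt_source _) hq)
  exact DFunLike.congr_fun h _

/-- The Lie bracket commutes with pullback along the inverse chart, and on a vector space it is the
commutator of directional derivatives. -/
theorem localVec_mlieBracket (u w : Cₛ^∞⟮𝓡 n; Coord n, (TangentSpace (𝓡 n) : M → Type)⟯) {x : M}
    {y : Coord n} (hy : y ∈ dom x) :
    localVec (VectorField.mlieBracket (𝓡 n) u w) x y
      = fderiv ℝ (localVec w x) y (localVec u x y) - fderiv ℝ (localVec u x) y (localVec w x y) := by
  have hm : minSmoothness ℝ 2 ≤ ((⊤ : ℕ∞) : WithTop ℕ∞) := by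
    rw [minSmoothness_of_isRCLikeNormedField]
    exact WithTop.coe_le_coe.2 le_top
  have : IsManifold (𝓡 n) (minSmoothness ℝ 2) M := IsManifold.of_le hm
  have h1 := VectorField.mpullback_mlieBracket (I := 𝓘(ℝ, Coord n)) (n := ∞)
    (u.contMDiff.mdifferentiableAt (by simp)) (w.contMDiff.mdifferentiableAt (by simp))
    ((contMDiffOn_extChartAt_symm (n := ∞) x).contMDiffAt ((isOpen_dom x).mem_nhds hy)) hm
  rw [mpullback_eq_localVec _ hy] at h1
  have h2 : ∀ s : (q : M) → TangentSpace (𝓡 n) q,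
      VectorField.mpullback 𝓘(ℝ, Coord n) (𝓡 n) (extChartAt (𝓡 n) x).symm s
        =ᶠ[𝓝 y] localVec s x := fun s => by
    filter_upwards [(isOpen_dom x).mem_nhds hy] with y' hy' using mpullback_eq_localVec s hy'
  rw [h1, (h2 u).mlieBracket_vectorField_eq (h2 w)]
  have h3 : ∀ V W : (y : Coord n) → TangentSpace 𝓘(ℝ, Coord n) y,
      VectorField.mlieBracket 𝓘(ℝ, Coord n) V W = VectorField.lieBracket ℝ V W := fun V W => by
    rw [← VectorField.mlieBracketWithin_univ, VectorField.mlieBracketWithin_eq_lieBracketWithin]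
    exact VectorField.lieBracketWithin_univ
  exact congrFun (h3 _ _) y

end

section

variable {n : ℕ} {M : Type*} [TopologicalSpace M] [ChartedSpace (Coord n) M]
  [IsManifold (𝓡 n) ∞ M] {I : Set ℝ} {ξ : ℝ}

/-! ### The kinetic bracket in canonical coordinates -/

theorem inner_covecL_symm (η : Coord n →L[ℝ] ℝ) (u : Coord n) :
    inner ℝ (covecL.symm η) u = η u :=
  DFunLike.congr_fun (covecL.apply_symm_apply η) u

theorem hasFDerivAt_localFun {g : M → ℝ} (hg : ContMDiff (𝓡 n) 𝓘(ℝ, ℝ) ∞ g) {x : M} {y : Coord n}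
    (hy : y ∈ dom x) : HasFDerivAt (localFun n g x) (fderiv ℝ (localFun n g x) y) y :=
  (((contDiffOn_localFun hg x).contDiffAt ((isOpen_dom x).mem_nhds hy)).differentiableAt
    (by simp)).hasFDerivAt

theorem hasFDerivAt_localVec (u : Cₛ^∞⟮𝓡 n; Coord n, (TangentSpace (𝓡 n) : M → Type)⟯) {x : M}
    {y : Coord n} (hy : y ∈ dom x) : HasFDerivAt (localVec u x) (fderiv ℝ (localVec u x) y) y :=
  (((contDiffOn_localVec u x).contDiffAt ((isOpen_dom x).mem_nhds hy)).differentiableAt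
    (by simp)).hasFDerivAt

theorem hasFDerivAt_comp_canon {k : Cotangent n M → ℝ} (hk : ContMDiff (cotModel n) 𝓘(ℝ, ℝ) ∞ k)
    {x : M} {y : Coord n} (hy : y ∈ dom x) (v : Coord n) :
    HasFDerivAt (fun w => k (canon x w)) (fderiv ℝ (fun w => k (canon x w)) (y, v)) (y, v) :=
  ((contDiffAt_of_prod (isOpen_dom x) (contDiffOn_comp_canon hk x) hy v).differentiableAt
    (by simp)).hasFDerivAt

theorem fderiv_rpow_canon (f : PhaseDensity n M I) (σ : ℝ) {x : M} {y : Coord n} (hy : y ∈ dom x)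
    (v : Coord n) : fderiv ℝ (fun w => f.toFun (canon x w) ^ σ) (y, v)
      = (σ * f.toFun (canon x (y, v)) ^ (σ - 1)) •
        fderiv ℝ (fun w => f.toFun (canon x w)) (y, v) :=
  ((hasFDerivAt_comp_canon f.smooth hy v).rpow_const (Or.inl (f.pos _).ne')).fderiv

theorem fderiv_fluidGenerator_canon (X : FluidAlgebra n M) (f : PhaseDensity n M I) {x : M}
    {y : Coord n} (hy : y ∈ dom x) (v w κ : Coord n) :
    fderiv ℝ (fun w => fluidGenerator ξ X f (canon x w)) (y, v) (w, κ)
      = inner ℝ κ (localVec X.1 x y) + inner ℝ v (fderiv ℝ (localVec X.1 x) y w)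
        + (1 + ξ) * (ξ * f.toFun (canon x (y, v)) ^ (ξ - 1)
            * fderiv ℝ (fun w => f.toFun (canon x w)) (y, v) (w, κ) * localFun n X.2 x y
          + f.toFun (canon x (y, v)) ^ ξ * fderiv ℝ (localFun n X.2 x) y w) := by
  have h1 : HasFDerivAt (fun w : Coord n × Coord n => localVec X.1 x w.1) _ (y, v) :=
    HasFDerivAt.comp (y, v) (f := Prod.fst) (hasFDerivAt_localVec X.1 hy) hasFDerivAt_fst
  have h2 : HasFDerivAt (fun w : Coord n × Coord n => localFun n X.2 x w.1) _ (y, v) :=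
    HasFDerivAt.comp (y, v) (f := Prod.fst) (hasFDerivAt_localFun X.2.contMDiff hy) hasFDerivAt_fst
  have h3 := (hasFDerivAt_comp_canon f.smooth hy v).rpow_const (p := ξ) (Or.inl (f.pos _).ne')
  have h4 : HasFDerivAt (fun w : Coord n × Coord n => inner ℝ w.2 (localVec X.1 x w.1)) _ (y, v) :=
    hasFDerivAt_snd.inner ℝ h1
  have h5 := h4.add ((h3.const_mul (1 + ξ)).mul h2)
  have h6 : (fun w => fluidGenerator ξ X f (canon x w)) =ᶠ[𝓝 (y, v)]
      (fun w : Coord n × Coord n => inner ℝ w.2 (localVec X.1 x w.1)) +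
        (fun w => (1 + ξ) * f.toFun (canon x w) ^ ξ) * (fun w => localFun n X.2 x w.1) := by
    filter_upwards [(isOpen_dom_prod x).mem_nhds (mem_prod.2 ⟨hy, mem_univ v⟩)] with w hw
    have e1 := canon_snd_apply (x := x) (y := w.1) hw.1 w.2 X.1
    have e2 := canon_fst_apply (x := x) (y := w.1) hw.1 w.2 X.2
    rw [Prod.mk.eta] at e1 e2
    simp only [Pi.add_apply, Pi.mul_apply]
    rw [fluidGenerator, e1, e2]
  rw [h6.fderiv_eq, h5.fderiv]
  simp
  ring

theorem momentumGrad_fluidGenerator (X : FluidAlgebra n M) (f : PhaseDensity n M I) {x : M}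
    {y : Coord n} (hy : y ∈ dom x) (v : Coord n) :
    momentumGrad (fderiv ℝ (fun w => fluidGenerator ξ X f (canon x w)) (y, v))
      = localVec X.1 x y + ((1 + ξ) * ξ * f.toFun (canon x (y, v)) ^ (ξ - 1) * localFun n X.2 x y) •
        momentumGrad (fderiv ℝ (fun w => f.toFun (canon x w)) (y, v)) := by
  refine ext_inner_right ℝ fun κ => ?_
  rw [inner_momentumGrad, fderiv_fluidGenerator_canon X f hy, inner_add_left, inner_smul_left,
    inner_momentumGrad, real_inner_comm]
  simp
  ring

/-- The components of the vector field `g v - h u` of a pair `(u, g)`, `(v, h)` in the chart at `x`. -/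
def fluxVec (X Y : FluidAlgebra n M) (x : M) (y : Coord n) : Coord n :=
  localFun n X.2 x y • localVec Y.1 x y - localFun n Y.2 x y • localVec X.1 x y

/-- The momentum coefficient that accompanies `fluxVec` in the kinetic bracket. -/
def fluxMap (X Y : FluidAlgebra n M) (x : M) (y : Coord n) : Coord n →L[ℝ] Coord n :=
  localFun n Y.2 x y • ContinuousLinearMap.adjoint (fderiv ℝ (localVec X.1 x) y)
    - localFun n X.2 x y • ContinuousLinearMap.adjoint (fderiv ℝ (localVec Y.1 x) y)

/-- The components of the commutator of the vector fields of `Y` and `X`. -/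
def commVec (X Y : FluidAlgebra n M) (x : M) (y : Coord n) : Coord n :=
  fderiv ℝ (localVec X.1 x) y (localVec Y.1 x y) - fderiv ℝ (localVec Y.1 x) y (localVec X.1 x y)

/-- The components of the function part of the bracket of `Y` and `X`. -/
def commFun (X Y : FluidAlgebra n M) (x : M) (y : Coord n) : ℝ :=
  fderiv ℝ (localFun n X.2 x) y (localVec Y.1 x y)
    - fderiv ℝ (localFun n Y.2 x) y (localVec X.1 x y)

/-- The combination `h ∇g - g ∇h` in the chart at `x`. -/
def wronskian (X Y : FluidAlgebra n M) (x : M) (y : Coord n) : Coord n :=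
  localFun n Y.2 x y • covecL.symm (fderiv ℝ (localFun n X.2 x) y)
    - localFun n X.2 x y • covecL.symm (fderiv ℝ (localFun n Y.2 x) y)

/-- Expand by bilinearity. The two momentum functions bracket to the commutator. In the cross terms,
f · (1+ξ) ξ f^{ξ-1} df = ξ d(f^{1+ξ}) collects every derivative of f into one directional
derivative, and the derivatives of g and h form `commFun`. Between f^ξ g and f^ξ h the brackets {f,
f} and {g, h} vanish, and f^{2ξ} ∂_p f is ∂_p f^{1+2ξ} divided by 1 + 2ξ, which is positive for ξ >
-1/2. -/
theorem mul_poissonBracket_fluidGenerator (hξ : 0 < 1 + 2 * ξ) (X Y : FluidAlgebra n M)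
    (f : PhaseDensity n M I) {x : M} {y : Coord n} (hy : y ∈ dom x) (v : Coord n) :
    f.toFun (canon x (y, v)) *
        poissonBracket (fluidGenerator ξ X f) (fluidGenerator ξ Y f) (canon x (y, v))
      = inner ℝ v (commVec X Y x y) * f.toFun (canon x (y, v))
        + ξ * fderiv ℝ (fun w => f.toFun (canon x w) ^ (1 + ξ)) (y, v)
            (fluxVec X Y x y, fluxMap X Y x y v)
        + (1 + ξ) * commFun X Y x y * f.toFun (canon x (y, v)) ^ (1 + ξ)
        + (1 + ξ) ^ 2 * ξ / (1 + 2 * ξ)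
            * fderiv ℝ (fun w => f.toFun (canon x w) ^ (1 + 2 * ξ)) (y, v)
              (0, wronskian X Y x y) := by
  rw [poissonBracket_canon (contMDiff_fluidGenerator X f) (contMDiff_fluidGenerator Y f) hy,
    canonicalBracket, momentumGrad_fluidGenerator X f hy, momentumGrad_fluidGenerator Y f hy,
    fderiv_fluidGenerator_canon X f hy, fderiv_fluidGenerator_canon Y f hy,
    fderiv_rpow_canon f _ hy, fderiv_rpow_canon f _ hy]
  set D := fderiv ℝ (fun w => f.toFun (canon x w)) (y, v)
  have hF : 0 < f.toFun (canon x (y, v)) := f.pos _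
  set F := f.toFun (canon x (y, v))
  have e1 : F ^ (ξ - 1) = F ^ ξ / F := by rw [Real.rpow_sub_one hF.ne']
  have e2 : F ^ (1 + ξ) = F * F ^ ξ := by rw [Real.rpow_add hF, Real.rpow_one]
  have e3 : F ^ (1 + ξ - 1) = F ^ ξ := by rw [add_sub_cancel_left]
  have e4 : F ^ (1 + 2 * ξ - 1) = F ^ ξ * F ^ ξ := by
    rw [add_sub_cancel_left, two_mul, Real.rpow_add hF]
  have hD : ∀ w κ, D (w, κ) = D (w, 0) + inner ℝ (momentumGrad D) κ := fun w κ => by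
    rw [inner_momentumGrad, ← map_add]
    simp
  have hD2 : ∀ w w', D (w + w', 0) = D (w, 0) + D (w', 0) := fun w w' => by
    rw [← map_add]; simp
  have hD3 : ∀ w w', D (w - w', 0) = D (w, 0) - D (w', 0) := fun w w' => by
    rw [← map_sub]; simp
  have hD4 : ∀ (c : ℝ) w, D (c • w, 0) = c * D (w, 0) := fun c w => by
    rw [← smul_eq_mul, ← map_smul]; simp
  have hD5 : D ((0 : Coord n), (0 : Coord n)) = 0 := map_zero D
  rw [e1, e2]
  simp only [smul_apply, smul_eq_mul, e3, e4]
  have e5 : ∀ t, (1 + ξ) ^ 2 * ξ / (1 + 2 * ξ) * ((1 + 2 * ξ) * (F ^ ξ * F ^ ξ) * t)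
      = (1 + ξ) ^ 2 * ξ * (F ^ ξ * F ^ ξ) * t := fun t => by
    rw [div_mul_eq_mul_div, div_eq_iff hξ.ne']
    ring
  rw [e5]
  rw [hD (fluxVec X Y x y), hD 0]
  simp only [fluxVec, fluxMap, commVec, commFun, wronskian, hD2, hD3, hD4, hD5, inner_sub_right,
    inner_add_right, inner_smul_right, map_add, map_smul, inner_zero_left, sub_apply, smul_apply,
    ContinuousLinearMap.adjoint_inner_right, smul_eq_mul]
  rw [real_inner_comm v, real_inner_comm v, real_inner_comm _ (momentumGrad D),
    real_inner_comm _ (momentumGrad D), inner_covecL_symm, inner_covecL_symm]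
  field_simp
  ring

end

section

variable {n : ℕ} {M : Type*} [TopologicalSpace M] [ChartedSpace (Coord n) M]
  [IsManifold (𝓡 n) ∞ M]

/-! ### Integration by parts in the fibres -/

section Fibre

variable {k : Cotangent n M → ℝ} {x : M} {y : Coord n}

theorem FibreDecay.integrable_fderiv_canon (hd : FibreDecay k)
    (hk : ContMDiff (cotModel n) 𝓘(ℝ, ℝ) ∞ k) (hy : y ∈ dom x) {w : Coord n → ℝ}
    (hw : Continuous w) {c : ℝ} (hc : ∀ v, |w v| ≤ c * (1 + ‖v‖)) (d : Coord n × Coord n) :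
    Integrable fun v => w v * fderiv ℝ (fun z => k (canon x z)) (y, v) d := by
  obtain ⟨N, hN, B, hB, hbd⟩ := hd.exists_bound (singleton_subset_iff.2 hy) isCompact_singleton 1
  have hcont : Continuous fun v => fderiv ℝ (fun z => k (canon x z)) (y, v) d := by
    have h1 : ContDiffOn ℝ ∞ (fderiv ℝ fun z => k (canon x z)) (dom x ×ˢ univ) :=
      (contDiffOn_comp_canon hk x).fderiv_of_isOpen (isOpen_dom_prod x) (by simp)
    exact (h1.clm_apply contDiffOn_const).continuousOn.comp_continuous (by fun_prop)
      fun v => mem_prod.2 ⟨hy, mem_univ _⟩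
  refine ((integrable_growth_mul_decay hw hc hN B).mul_const ‖d‖).mono'
    (hw.mul hcont).aestronglyMeasurable (Eventually.of_forall fun v => ?_)
  rw [norm_mul, Real.norm_eq_abs, mul_assoc]
  gcongr
  refine ((fderiv ℝ (fun z => k (canon x z)) (y, v)).le_opNorm d).trans ?_
  gcongr
  have := hbd y rfl v
  rwa [← norm_iteratedFDeriv_fderiv, norm_iteratedFDeriv_zero] at this

theorem hasFDerivAt_canon_right (hk : ContMDiff (cotModel n) 𝓘(ℝ, ℝ) ∞ k) (hy : y ∈ dom x)
    (v : Coord n) : HasFDerivAt (fun v => k (canon x (y, v)))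
      ((fderiv ℝ (fun z => k (canon x z)) (y, v)).comp (ContinuousLinearMap.inr ℝ _ _)) v :=
  (hasFDerivAt_comp_canon hk hy v).comp v (hasFDerivAt_prodMk_right y v)

/-- Integration by parts in p against an affine weight, without boundary terms because all the
products are integrable. A linear weight yields the trace terms, a constant one the vanishing of
total momentum derivatives. -/
theorem FibreDecay.integral_mul_fderiv_momentum (hd : FibreDecay k)
    (hk : ContMDiff (cotModel n) 𝓘(ℝ, ℝ) ∞ k) (hy : y ∈ dom x) (c : ℝ) (a e : Coord n) :
    ∫ v, (c + inner ℝ v a) * fderiv ℝ (fun z => k (canon x z)) (y, v) (0, e)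
      = -(inner ℝ e a * ∫ v, k (canon x (y, v))) := by
  have hw : Continuous fun v : Coord n => c + inner ℝ v a := by fun_prop
  have hc : ∀ v : Coord n, |c + inner ℝ v a| ≤ (|c| + ‖a‖) * (1 + ‖v‖) := fun v => by
    have h1 := abs_add_le c (inner ℝ v a)
    have h2 := growth_inner a v
    have h3 : |c| ≤ |c| * (1 + ‖v‖) := by
      have := mul_nonneg (abs_nonneg c) (norm_nonneg v)
      linarith
    linarith
  have hder : ∀ v : Coord n, HasFDerivAt (fun v : Coord n => c + inner ℝ v a) (innerSL ℝ a) v :=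
    fun v => by
      have := ((innerSL ℝ a).hasFDerivAt (x := v)).const_add c
      simpa [real_inner_comm] using this
  have hder2 := fun v => hasFDerivAt_canon_right hk hy v
  have e1 : ∀ v, fderiv ℝ (fun z => k (canon x z)) (y, v) (0, e)
      = fderiv ℝ (fun v => k (canon x (y, v))) v e := fun v => by rw [(hder2 v).fderiv]; simp
  have e2 : ∀ v : Coord n, fderiv ℝ (fun v : Coord n => c + inner ℝ v a) v e = inner ℝ e a :=
    fun v => by rw [(hder v).fderiv, innerSL_apply_apply, real_inner_comm]
  have i1 := hd.integrable_fderiv_canon hk hy hw hc (0, e)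
  have i2 := hd.integrable_canon hk hw hc hy
  have i3 := hd.integrable_canon hk (w := fun _ => inner ℝ e a) continuous_const
    (c := |inner ℝ e a|) (fun v => by
      have := mul_nonneg (abs_nonneg (inner ℝ e a)) (norm_nonneg v)
      linarith) hy
  simp only [e1] at i1 ⊢
  rw [integral_mul_fderiv_eq_neg_fderiv_mul_of_integrable (by simpa only [e2] using i3) i1 i2
    (fun v _ => (hder v).differentiableAt) (fun v _ => (hder2 v).differentiableAt)]
  simp only [e2, integral_const_mul]

theorem FibreDecay.integral_fderiv_position (hd : FibreDecay k)
    (hk : ContMDiff (cotModel n) 𝓘(ℝ, ℝ) ∞ k) (hy : y ∈ dom x) (e : Coord n) :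
    ∫ v, fderiv ℝ (fun z => k (canon x z)) (y, v) (e, 0)
      = fderiv ℝ (fun y => ∫ v, k (canon x (y, v))) y e := by
  have h := hasFDerivAt_integral_of_locallyDominated (isOpen_dom x) (contDiffOn_comp_canon hk x)
    continuous_const (hd.locallyDominated continuous_const growth_one x) hy
  have hi := ((hd.locallyDominated continuous_const growth_one x).partialDeriv (isOpen_dom x)
    (contDiffOn_comp_canon hk x)).integrable (contDiffOn_partialDeriv (isOpen_dom x)
      (contDiffOn_comp_canon hk x)) continuous_const hy
  simp only [one_smul] at h hi
  rw [h.fderiv, ContinuousLinearMap.integral_apply hi]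
  rfl

/-- The position part is the derivative of the fibre integral. The momentum part is split along the
standard basis, and each summand integrates by parts to a diagonal entry of `B`, whence the trace.
-/
theorem FibreDecay.integral_fderiv_affine (hd : FibreDecay k)
    (hk : ContMDiff (cotModel n) 𝓘(ℝ, ℝ) ∞ k) (hy : y ∈ dom x) (b : Coord n)
    (B : Coord n →L[ℝ] Coord n) :
    Integrable (fun v => fderiv ℝ (fun z => k (canon x z)) (y, v) (b, B v)) ∧
    ∫ v, fderiv ℝ (fun z => k (canon x z)) (y, v) (b, B v)
      = fderiv ℝ (fun y => ∫ v, k (canon x (y, v))) y b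
        - (∑ i, inner ℝ (stdVec i) (B (stdVec i))) * ∫ v, k (canon x (y, v)) := by
  have h1 : ∀ v, fderiv ℝ (fun z => k (canon x z)) (y, v) (b, B v)
      = 1 * fderiv ℝ (fun z => k (canon x z)) (y, v) (b, 0)
        + ∑ i, (0 + inner ℝ v (ContinuousLinearMap.adjoint B (stdVec i)))
          * fderiv ℝ (fun z => k (canon x z)) (y, v) (0, stdVec i) := fun v => by
    set D := fderiv ℝ (fun z => k (canon x z)) (y, v)
    have e1 : D (b, B v) = D (b, 0) + inner ℝ (momentumGrad D) (B v) := by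
      rw [inner_momentumGrad, ← map_add]
      simp
    rw [e1, one_mul, momentumGrad, sum_inner]
    congr 1
    refine Finset.sum_congr rfl fun i _ => ?_
    rw [ContinuousLinearMap.adjoint_inner_right, inner_smul_left, real_inner_comm]
    simp [mul_comm]
  have i1 := hd.integrable_fderiv_canon hk hy continuous_const growth_one (b, 0)
  have i2 : ∀ i, Integrable fun v =>
      (0 + inner ℝ v (ContinuousLinearMap.adjoint B (stdVec i)))
          * fderiv ℝ (fun z => k (canon x z)) (y, v) (0, stdVec i) := fun i => by
    simp only [zero_add]
    exact hd.integrable_fderiv_canon hk hy (continuous_inner_left _) (growth_inner _) _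
  have i3 := integrable_finsetSum Finset.univ fun i _ => i2 i
  simp only [h1]
  refine ⟨i1.add i3, ?_⟩
  rw [integral_add i1 i3, integral_finsetSum _ fun i _ => i2 i]
  simp only [one_mul, hd.integral_mul_fderiv_momentum hk hy, hd.integral_fderiv_position hk hy]
  rw [Finset.sum_neg_distrib, ← Finset.sum_mul, sub_eq_add_neg]
  simp only [ContinuousLinearMap.adjoint_inner_right, real_inner_comm (stdVec _)]

end Fibre

/-! ### The fibre integral of the kinetic bracket -/

/-- The Euclidean divergence of a vector field. -/
def divergence (Z : Coord n → Coord n) (y : Coord n) : ℝ :=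
  ∑ i, inner ℝ (stdVec i) (fderiv ℝ Z y (stdVec i))

theorem sum_stdVec_apply (η : Coord n →L[ℝ] ℝ) (u : Coord n) :
    ∑ i, inner ℝ (stdVec i) u * η (stdVec i) = η u := by
  conv_rhs => rw [← sum_inner_stdVec u, map_sum]
  simp

theorem divergence_smul {r : Coord n → ℝ} {Z : Coord n → Coord n} {y : Coord n}
    {r' : Coord n →L[ℝ] ℝ} {Z' : Coord n →L[ℝ] Coord n} (hr : HasFDerivAt r r' y)
    (hZ : HasFDerivAt Z Z' y) : divergence (fun y => r y • Z y) y
      = r' (Z y) + r y * ∑ i, inner ℝ (stdVec i) (Z' (stdVec i)) := by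
  have h : HasFDerivAt (fun y => r y • Z y) _ y := hr.smul hZ
  rw [divergence, h.fderiv, Finset.mul_sum, ← sum_stdVec_apply r', ← Finset.sum_add_distrib]
  refine Finset.sum_congr rfl fun i _ => ?_
  simp [inner_add_right, inner_smul_right]
  ring

section Moments

variable {I : Set ℝ} (h0 : (0 : ℝ) ∈ I) {ξ : ℝ} (hξ : ξ ∈ I)

/-- The divergence of gv - hu is dg(v) - dh(u) + g div v - h div u. The first two terms are
`commFun`; the others are minus the trace of `fluxMap`, since passing to adjoints preserves traces.
-/
theorem divergence_smul_fluxVec (X Y : FluidAlgebra n M) {r : Coord n → ℝ} {r' : Coord n →L[ℝ] ℝ}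
    {x : M} {y : Coord n} (hy : y ∈ dom x) (hr : HasFDerivAt r r' y) :
    divergence (fun y => r y • fluxVec X Y x y) y = r' (fluxVec X Y x y)
      + r y * (commFun X Y x y - ∑ i, inner ℝ (stdVec i) (fluxMap X Y x y (stdVec i))) := by
  have h1 := ((hasFDerivAt_localFun X.2.contMDiff hy).smul (hasFDerivAt_localVec Y.1 hy)).sub
    ((hasFDerivAt_localFun Y.2.contMDiff hy).smul (hasFDerivAt_localVec X.1 hy))
  have h2 : HasFDerivAt (fluxVec X Y x) _ y := h1
  rw [divergence_smul hr h2]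
  congr 2
  rw [commFun, ← sum_stdVec_apply (fderiv ℝ (localFun n X.2 x) y),
    ← sum_stdVec_apply (fderiv ℝ (localFun n Y.2 x) y), ← Finset.sum_sub_distrib,
    ← Finset.sum_sub_distrib]
  refine Finset.sum_congr rfl fun i _ => ?_
  simp only [fluxMap, sub_apply, add_apply, smul_apply,
    inner_sub_right, inner_add_right, inner_smul_right, ContinuousLinearMap.adjoint_inner_right,
    ContinuousLinearMap.smulRight_apply]
  rw [real_inner_comm (stdVec i), real_inner_comm (stdVec i) (fderiv ℝ (localVec Y.1 x) y _)]
  ring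

theorem densityComp_pairing_fluidLie (X Y : FluidAlgebra n M) (μ : FluidDual n M) {x : M}
    {y : Coord n} (hy : y ∈ dom x) : densityComp (pairingDensity μ (fluidLie X Y)) x y
      = -(formDensityComp μ.m x y (commVec X Y x y)
        + densityComp (n := n) μ.ρ x y * commFun X Y x y) := by
  have h1 : localFun n (fluidLie X Y).2 x y = -commFun X Y x y := by
    change lieDeriv X.1 Y.2 _ - lieDeriv Y.1 X.2 _ = _
    rw [lieDeriv_extChartAt_symm _ Y.2.contMDiff hy, lieDeriv_extChartAt_symm _ X.2.contMDiff hy,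
      commFun, neg_sub]
  have h2 : localVec (fluidLie X Y).1 x y = -commVec X Y x y := by
    rw [commVec, neg_sub]
    exact localVec_mlieBracket X.1 Y.1 hy
  rw [densityComp_pairingDensity μ _ hy, h1, h2, map_neg]
  ring

/-- The fibre integral of the kinetic bracket is the fluid bracket density up to a divergence. -/
theorem integral_mul_poissonBracket (hξ' : 0 < 1 + 2 * ξ) (X Y : FluidAlgebra n M)
    (f : PhaseDensity n M I) {x : M} {y : Coord n} (hy : y ∈ dom x) :
    ∫ v, f.toFun (canon x (y, v)) *
        poissonBracket (fluidGenerator ξ X f) (fluidGenerator ξ Y f) (canon x (y, v))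
      = -densityComp (pairingDensity (fluidMoments h0 hξ f) (fluidLie X Y)) x y
        + ξ * divergence (fun y =>
          densityComp (n := n) (fluidMoments h0 hξ f).ρ x y • fluxVec X Y x y) y := by
  have hρ : ∀ y ∈ dom x, densityComp (n := n) (fluidMoments h0 hξ f).ρ x y
      = ∫ v, f.toFun (canon x (y, v)) ^ (1 + ξ) := fun y hy => by
    simpa using densityComp_fluidMoments h0 hξ f hy
  have hρ' : HasFDerivAt (densityComp (n := n) (fluidMoments h0 hξ f).ρ x)
      (fderiv ℝ (fun y => ∫ v, f.toFun (canon x (y, v)) ^ (1 + ξ)) y) y := by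
    have h1 := ((((fluidMoments h0 hξ f).smooth_ρ x).contDiffAt
      ((isOpen_dom x).mem_nhds hy)).differentiableAt (by simp)).hasFDerivAt
    have h2 : densityComp (n := n) (fluidMoments h0 hξ f).ρ x
        =ᶠ[𝓝 y] fun y => ∫ v, f.toFun (canon x (y, v)) ^ (1 + ξ) := by
      filter_upwards [(isOpen_dom x).mem_nhds hy] with y hy using hρ y hy
    rwa [h2.fderiv_eq] at h1
  have d1 := f.fibreDecay h0
  obtain ⟨d2, d3⟩ := f.decay ξ hξ
  have i1 := d1.integrable_canon f.smooth (continuous_inner_left (commVec X Y x y))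
    (growth_inner _) hy
  obtain ⟨i2, e2⟩ := d2.integral_fderiv_affine (f.contMDiff_rpow _) hy (fluxVec X Y x y)
    (fluxMap X Y x y)
  have i3 : Integrable fun v => f.toFun (canon x (y, v)) ^ (1 + ξ) := by
    simpa using d2.integrable_canon (f.contMDiff_rpow _) continuous_const growth_one hy
  have i4 : Integrable fun v => fderiv ℝ (fun w => f.toFun (canon x w) ^ (1 + 2 * ξ)) (y, v)
      (0, wronskian X Y x y) := by
    simpa using d3.integrable_fderiv_canon (f.contMDiff_rpow _) hy continuous_const growth_one
      (0, wronskian X Y x y)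
  -- The constant weight 1: a total momentum derivative of f^{1+2ξ} has zero fibre integral. This is
  -- where the decay of f^{1+2ξ} is needed.
  have e4 : ∫ v, fderiv ℝ (fun w => f.toFun (canon x w) ^ (1 + 2 * ξ)) (y, v)
      (0, wronskian X Y x y) = 0 := by
    simpa using d3.integral_mul_fderiv_momentum (f.contMDiff_rpow _) hy 1 0 (wronskian X Y x y)
  simp only [mul_poissonBracket_fluidGenerator hξ' X Y f hy]
  have key : ∀ {a b c d : Coord n → ℝ}, Integrable a → Integrable b → Integrable c → Integrable d →
      ∫ v, (a v + b v + c v + d v) = (∫ v, a v) + (∫ v, b v) + (∫ v, c v) + ∫ v, d v :=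
    fun ha hb hc hd => by
      rw [← integral_add' ha hb, ← integral_add' (ha.add hb) hc,
        ← integral_add' ((ha.add hb).add hc) hd]
      rfl
  rw [key i1 (i2.const_mul ξ) (i3.const_mul _) (i4.const_mul _)]
  simp only [integral_const_mul]
  -- Of the coefficient 1 + ξ of `commFun`, the part ξ completes the divergence of the flux of ρ,
  -- and the part 1 belongs to the fluid bracket.
  rw [e4, e2, densityComp_pairing_fluidLie X Y _ hy, formDensityComp_fluidMoments h0 hξ f hy,
    divergence_smul_fluxVec X Y hy hρ', hρ y hy]
  ring

end Moments

end

section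

variable {n : ℕ} {M : Type*} [TopologicalSpace M] [ChartedSpace (Coord n) M]
  [IsManifold (𝓡 n) ∞ M]

/-! ### The divergence theorem for vector densities -/

/-- Each component is integrated by parts against the constant function 1, whose derivative is zero.
-/
theorem integral_divergence_eq_zero {Θ : Coord n → Coord n} (hΘ : ContDiff ℝ 1 Θ)
    (hc : HasCompactSupport Θ) : ∫ y, divergence Θ y = 0 := by
  have hcont : Continuous (fderiv ℝ Θ) := hΘ.continuous_fderiv (by simp)
  have h1 : ∀ i : Fin n, Integrable fun y => inner ℝ (stdVec i) (fderiv ℝ Θ y (stdVec i)) :=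
    fun i => by
      refine Continuous.integrable_of_hasCompactSupport (by fun_prop) ?_
      exact (hc.fderiv (𝕜 := ℝ)).comp_left
        (g := fun A : Coord n →L[ℝ] Coord n => inner ℝ (stdVec i) (A (stdVec i))) (by simp)
  simp only [divergence]
  rw [integral_finsetSum _ fun i _ => h1 i]
  refine Finset.sum_eq_zero fun i _ => ?_
  have hd : ∀ y, HasFDerivAt (fun y => inner ℝ (stdVec i) (Θ y))
      ((innerSL ℝ (stdVec i)).comp (fderiv ℝ Θ y)) y := fun y =>
    ((innerSL ℝ (stdVec i)).hasFDerivAt).comp y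
      ((hΘ.differentiable (by simp)).differentiableAt.hasFDerivAt)
  have he : ∀ y, inner ℝ (stdVec i) (fderiv ℝ Θ y (stdVec i))
      = fderiv ℝ (fun y => inner ℝ (stdVec i) (Θ y)) y (stdVec i) := fun y => by
    rw [(hd y).fderiv]
    rfl
  have h2 : Integrable fun y => inner ℝ (stdVec i) (Θ y) :=
    Continuous.integrable_of_hasCompactSupport (continuous_const.inner hΘ.continuous)
      (hc.comp_left (g := fun w : Coord n => inner ℝ (stdVec i) w) (by simp))
  have h3 := integral_mul_fderiv_eq_neg_fderiv_mul_of_integrable (μ := volume)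
    (f := fun _ : Coord n => (1 : ℝ)) (g := fun y => inner ℝ (stdVec i) (Θ y)) (v := stdVec i)
    (by simp) (by simpa only [one_mul, ← he] using h1 i) (by simpa only [one_mul] using h2)
    (fun y _ => differentiableAt_const _) (fun y _ => (hd y).differentiableAt)
  simpa [← he] using h3

/-- The components of a vector density in the chart at `x`. -/
def vecDensityComp (Z : (q : M) → TangentSpace (𝓡 n) q) (x : M) (y : Coord n) : Coord n :=
  jac (n := n) x ((extChartAt (𝓡 n) x).symm y) • localVec Z x y

theorem densityComp_lieDeriv (Z : (q : M) → TangentSpace (𝓡 n) q) {χ : M → ℝ}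
    (hχ : ContMDiff (𝓡 n) 𝓘(ℝ, ℝ) ∞ χ) {x : M} {y : Coord n} (hy : y ∈ dom x) :
    densityComp (n := n) (lieDeriv Z χ) x y
      = fderiv ℝ (localFun n χ x) y (vecDensityComp Z x y) := by
  simp only [densityComp]
  rw [lieDeriv_extChartAt_symm Z hχ hy, vecDensityComp, map_smul, smul_eq_mul, mul_comm]

theorem continuousDensity_lieDeriv {Z : (q : M) → TangentSpace (𝓡 n) q}
    (hZ : ∀ x : M, ContDiffOn ℝ ∞ (vecDensityComp Z x) (dom x)) {χ : M → ℝ}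
    (hχ : ContMDiff (𝓡 n) 𝓘(ℝ, ℝ) ∞ χ) : ContinuousDensity n (lieDeriv Z χ) := fun x => by
  have h1 : ContDiffOn ℝ ∞ (fderiv ℝ (localFun n χ x)) (dom x) :=
    (contDiffOn_localFun hχ x).fderiv_of_isOpen (isOpen_dom x) (by simp)
  exact (h1.continuousOn.clm_apply (hZ x).continuousOn).congr
    fun y hy => densityComp_lieDeriv Z hχ hy

theorem lieDeriv_eq_zero (Z : (q : M) → TangentSpace (𝓡 n) q) {χ : M → ℝ} {c : ℝ} {q : M}
    (h : χ =ᶠ[𝓝 q] fun _ => c) : lieDeriv Z χ q = 0 := by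
  rw [lieDeriv, h.mfderiv_eq, mfderiv_const]
  rfl

theorem lieDeriv_eq_zero_of_eq_zero {Z : (q : M) → TangentSpace (𝓡 n) q} {χ : M → ℝ} {q : M}
    (h : Z q = 0) : lieDeriv Z χ q = 0 := by
  rw [lieDeriv, h, map_zero]
  rfl

theorem lieDeriv_sum (Z : (q : M) → TangentSpace (𝓡 n) q) {ι : Type*} (s : Finset ι)
    {χ : ι → M → ℝ} (hχ : ∀ i, ContMDiff (𝓡 n) 𝓘(ℝ, ℝ) ∞ (χ i)) (q : M) :
    lieDeriv Z (fun q => ∑ i ∈ s, χ i q) q = ∑ i ∈ s, lieDeriv Z (χ i) q := by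
  have hy := mem_extChartAt_target (I := 𝓡 n) q
  have h1 : localFun n (fun q => ∑ i ∈ s, χ i q) q = fun y => ∑ i ∈ s, localFun n (χ i) q y := rfl
  have h2 : ∀ {φ : M → ℝ}, ContMDiff (𝓡 n) 𝓘(ℝ, ℝ) ∞ φ → lieDeriv Z φ q
      = fderiv ℝ (localFun n φ q) (extChartAt (𝓡 n) q q) (localVec Z q (extChartAt (𝓡 n) q q)) :=
    fun hφ => by rw [← lieDeriv_extChartAt_symm Z hφ hy, extChartAt_to_inv]
  rw [h2 (contMDiff_finsetSum fun i _ => hχ i), h1,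
    fderiv_fun_sum fun i _ => (hasFDerivAt_localFun (hχ i) hy).differentiableAt]
  simp only [sum_apply, h2 (hχ _)]

section Divergence

variable [T2Space M] [SecondCountableTopology M] [MeasurableSpace M] [BorelSpace M]
  {Z : (q : M) → TangentSpace (𝓡 n) q} {δ : M → ℝ} {c : ℝ}

theorem continuousDensity_mul {χ : M → ℝ} (hχ : Continuous χ) (hδ : ContinuousDensity n δ) :
    ContinuousDensity n fun q => χ q * δ q := fun x => by
  have h : densityComp (n := n) (fun q => χ q * δ q) x
      = fun y => localFun n χ x y * densityComp (n := n) δ x y := by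
    ext y
    simp only [densityComp, localFun]
    ring
  rw [h]
  exact (hχ.comp_continuousOn (continuousOn_extChartAt_symm x)).mul (hδ x)

/-- In the chart, χ δ + c dχ(Z) = c div(χ Z) by the product rule, and the right-hand side integrates
to zero. -/
theorem integral_mul_divergence_of_chart (hδ : ContinuousDensity n δ)
    (hZ : ∀ x : M, ContDiffOn ℝ ∞ (vecDensityComp Z x) (dom x))
    (hdiv : ∀ x : M, ∀ y ∈ dom x, densityComp (n := n) δ x y = c * divergence (vecDensityComp Z x) y)
    {χ : M → ℝ} (hχ : ContMDiff (𝓡 n) 𝓘(ℝ, ℝ) ∞ χ) (hc : HasCompactSupport χ) {x : M}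
    (hx : tsupport χ ⊆ (extChartAt (𝓡 n) x).source) :
    ∫ q, baseDensity n (fun q => χ q * δ q) q ∂(baseMeasure n M)
      = -(c * ∫ q, baseDensity n (lieDeriv Z χ) q ∂(baseMeasure n M)) := by
  set K := extChartAt (𝓡 n) x '' tsupport χ with hK
  have hKc : IsCompact K := hc.isCompact.image_of_continuousOn ((continuousOn_extChartAt x).mono hx)
  have hKx : K ⊆ dom x := by
    rintro _ ⟨q, hq, rfl⟩
    exact (extChartAt (𝓡 n) x).map_source (hx hq)
  have hKq : ∀ y ∈ dom x, y ∉ K → (extChartAt (𝓡 n) x).symm y ∉ tsupport χ := fun y hy hyK hq =>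
    hyK ⟨_, hq, (extChartAt (𝓡 n) x).right_inv hy⟩
  have hint : ∀ η : M → ℝ, ContinuousDensity n η → (∀ q ∉ tsupport χ, η q = 0) →
      IntegrableOn (densityComp (n := n) η x) (dom x) ∧
      ∫ q, baseDensity n η q ∂(baseMeasure n M) = ∫ y in dom x, densityComp (n := n) η x y := by
    intro η hη hs
    have hi : IntegrableOn (densityComp (n := n) η x) (dom x) := by
      refine (((hη x).mono hKx).integrableOn_compact hKc).of_forall_sdiff_eq_zero
        (isOpen_dom x).measurableSet fun y hy => ?_
      simp only [densityComp, hs _ (hKq y hy.1 hy.2), zero_mul]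
    exact ⟨hi, (densityIntegral_of_support hη.measurable (fun q hq => hs q fun h => hq (hx h))
      hi).2⟩
  obtain ⟨i1, e1⟩ := hint _ (continuousDensity_mul hχ.continuous hδ) fun q hq => by
    rw [image_eq_zero_of_notMem_tsupport hq, zero_mul]
  obtain ⟨i2, e2⟩ := hint _ (continuousDensity_lieDeriv hZ hχ) fun q hq =>
    lieDeriv_eq_zero Z (notMem_tsupport_iff_eventuallyEq.1 hq)
  -- Extension by zero of χ Z from the chart domain to ℝⁿ. It stays C¹ because it vanishes off the
  -- compact image of the support of χ.
  set Θ : Coord n → Coord n :=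
    (dom x).indicator fun y => localFun n χ x y • vecDensityComp Z x y with hΘ
  have hΘ0 : ∀ y ∉ K, Θ y = 0 := fun y hy => by
    by_cases hyx : y ∈ dom x
    · rw [hΘ, indicator_of_mem hyx, localFun, image_eq_zero_of_notMem_tsupport (hKq y hyx hy),
        zero_smul]
    · exact indicator_of_notMem hyx _
  have hΘK : ∀ y ∉ K, Θ =ᶠ[𝓝 y] fun _ => 0 := fun y hy => by
    filter_upwards [hKc.isClosed.isOpen_compl.mem_nhds hy] with y' hy' using hΘ0 y' hy'
  have hΘx : ∀ y ∈ dom x, Θ =ᶠ[𝓝 y] fun y => localFun n χ x y • vecDensityComp Z x y :=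
    fun y hy => by
      filter_upwards [(isOpen_dom x).mem_nhds hy] with y' hy' using indicator_of_mem hy' _
  have hΘs : ContDiff ℝ 1 Θ := contDiff_iff_contDiffAt.2 fun y => by
    by_cases hy : y ∈ dom x
    · refine ContDiffAt.congr_of_eventuallyEq ?_ (hΘx y hy)
      exact ((((contDiffOn_localFun hχ x).smul (hZ x)).contDiffAt
        ((isOpen_dom x).mem_nhds hy))).of_le (by simp)
    · exact contDiffAt_const.congr_of_eventuallyEq (hΘK y fun h => hy (hKx h))
  have h0 := integral_divergence_eq_zero hΘs (HasCompactSupport.intro hKc hΘ0)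
  rw [← setIntegral_eq_integral_of_forall_compl_eq_zero (s := dom x) fun y hy => by
    simp only [divergence]
    rw [(hΘK y fun h => hy (hKx h)).fderiv_eq]
    simp] at h0
  have h1 : ∀ y ∈ dom x, densityComp (n := n) (fun q => χ q * δ q) x y
      + c * densityComp (n := n) (lieDeriv Z χ) x y = c * divergence Θ y := fun y hy => by
    have hW : HasFDerivAt (vecDensityComp Z x) (fderiv ℝ (vecDensityComp Z x) y) y :=
      (((hZ x).contDiffAt ((isOpen_dom x).mem_nhds hy)).differentiableAt (by simp)).hasFDerivAt
    have e3 : divergence Θ y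
        = divergence (fun y => localFun n χ x y • vecDensityComp Z x y) y := by
      simp only [divergence]
      rw [(hΘx y hy).fderiv_eq]
    have e4 : densityComp (n := n) (fun q => χ q * δ q) x y
        = localFun n χ x y * densityComp (n := n) δ x y := by
      simp only [densityComp, localFun]
      ring
    rw [e3, divergence_smul (hasFDerivAt_localFun hχ hy) hW, e4, hdiv x y hy,
      densityComp_lieDeriv Z hχ hy, divergence]
    ring
  rw [e1, e2, eq_neg_iff_add_eq_zero, ← integral_const_mul, ← integral_add i1 (i2.const_mul c),
    setIntegral_congr_fun (isOpen_dom x).measurableSet h1, integral_const_mul, h0, mul_zero]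

/-- Integration by parts on `M` against a compactly supported function. -/
theorem integral_mul_divergence (hδ : ContinuousDensity n δ)
    (hZ : ∀ x : M, ContDiffOn ℝ ∞ (vecDensityComp Z x) (dom x))
    (hdiv : ∀ x : M, ∀ y ∈ dom x, densityComp (n := n) δ x y = c * divergence (vecDensityComp Z x) y)
    {χ : M → ℝ} (hχ : ContMDiff (𝓡 n) 𝓘(ℝ, ℝ) ∞ χ) (hc : HasCompactSupport χ) :
    ∫ q, baseDensity n (fun q => χ q * δ q) q ∂(baseMeasure n M)
      = -(c * ∫ q, baseDensity n (lieDeriv Z χ) q ∂(baseMeasure n M)) := by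
  have := ChartedSpace.locallyCompactSpace (Coord n) M
  obtain ⟨ρ, hρ⟩ := SmoothPartitionOfUnity.exists_isSubordinate_chartAt_source_of_isClosed (𝓡 n)
    (isClosed_tsupport χ)
  -- Only finitely many members of the partition of unity meet the compact support of χ, so χ is a
  -- finite sum of functions each supported in one chart.
  have hfin := ρ.locallyFinite.finite_nonempty_inter_compact hc.isCompact
  set s := hfin.toFinset with hs
  set χ' : tsupport χ → M → ℝ := fun i q => ρ i q * χ q with hχ'
  have hsum : χ = fun q => ∑ i ∈ s, χ' i q := funext fun q => by
    by_cases hq : q ∈ tsupport χ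
    · have h1 := ρ.sum_eq_one hq
      rw [finsum_eq_sum_of_support_subset (s := s) _ fun i hi => by
        rw [hs, Finite.coe_toFinset]
        exact ⟨q, hi, hq⟩] at h1
      simp only [hχ', ← Finset.sum_mul, h1, one_mul]
    · simp [hχ', image_eq_zero_of_notMem_tsupport hq]
  have hs' : ∀ i, ContMDiff (𝓡 n) 𝓘(ℝ, ℝ) ∞ (χ' i) := fun i => (ρ i).contMDiff.mul hχ
  have hc' : ∀ i, HasCompactSupport (χ' i) := fun i => hc.mul_left
  have hx' : ∀ i, tsupport (χ' i) ⊆ (extChartAt (𝓡 n) (i : M)).source := fun i => by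
    rw [extChartAt_source]
    exact (tsupport_mul_subset_left (f := ρ i) (g := χ)).trans (hρ i)
  have hi1 : ∀ i, Integrable (baseDensity n fun q => χ' i q * δ q) (baseMeasure n M) := fun i =>
    (continuousDensity_mul (hs' i).continuous hδ).integrable_of_compact (hc' i) fun q hq => by
      rw [image_eq_zero_of_notMem_tsupport hq, zero_mul]
  have hi2 : ∀ i, Integrable (baseDensity n (lieDeriv Z (χ' i))) (baseMeasure n M) := fun i =>
    (continuousDensity_lieDeriv hZ (hs' i)).integrable_of_compact (hc' i) fun q hq =>
      lieDeriv_eq_zero Z (notMem_tsupport_iff_eventuallyEq.1 hq)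
  have e1 : ∀ q, baseDensity n (fun q => χ q * δ q) q
      = ∑ i ∈ s, baseDensity n (fun q => χ' i q * δ q) q := fun q => by
    simp only [baseDensity, ← Finset.sum_mul]
    rw [congrFun hsum q]
  have e2 : ∀ q, baseDensity n (lieDeriv Z χ) q
      = ∑ i ∈ s, baseDensity n (lieDeriv Z (χ' i)) q := fun q => by
    simp only [baseDensity, ← Finset.sum_mul]
    rw [← lieDeriv_sum Z s hs', ← hsum]
  simp only [e1, e2]
  rw [integral_finsetSum _ fun i _ => hi1 i, integral_finsetSum _ fun i _ => hi2 i,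
    Finset.mul_sum, ← Finset.sum_neg_distrib]
  exact Finset.sum_congr rfl fun i _ =>
    integral_mul_divergence_of_chart hδ hZ hdiv (hs' i) (hc' i) (hx' i)

/-- If a vector density has no flux through infinity, its divergence integrates to zero. -/
theorem integral_divergence_eq_zero_of_noFlux (hδ : ContinuousDensity n δ)
    (hZ : ∀ x : M, ContDiffOn ℝ ∞ (vecDensityComp Z x) (dom x))
    (hdiv : ∀ x : M, ∀ y ∈ dom x, densityComp (n := n) δ x y = c * divergence (vecDensityComp Z x) y)
    (hi : Integrable (baseDensity n δ) (baseMeasure n M)) (hflux : NoFluxAtInfinity (n := n) Z) :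
    ∫ q, baseDensity n δ q ∂(baseMeasure n M) = 0 := by
  obtain ⟨χ, h1, h2, h3⟩ := hflux
  have e1 : ∀ k q, baseDensity n (fun q => χ k q * δ q) q = χ k q * baseDensity n δ q :=
    fun k q => by simp only [baseDensity]; ring
  -- The same sequence is computed twice. Dominated convergence gives the integral of δ; integration
  -- by parts gives -c times the integral of dχₖ(Z), which tends to 0 by the flux condition.
  have t1 : Tendsto (fun k => ∫ q, baseDensity n (fun q => χ k q * δ q) q ∂(baseMeasure n M)) atTop
      (𝓝 (∫ q, baseDensity n δ q ∂(baseMeasure n M))) := by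
    refine tendsto_integral_of_dominated_convergence (fun q => ‖baseDensity n δ q‖)
      (fun k => (continuousDensity_mul (h1 k).1.continuous hδ).measurable.aestronglyMeasurable)
      hi.norm (fun k => Eventually.of_forall fun q => ?_) (Eventually.of_forall fun q => ?_)
    · rw [e1, norm_mul]
      refine mul_le_of_le_one_left (norm_nonneg _) ?_
      rw [Real.norm_eq_abs, abs_of_nonneg ((h1 k).2.2 q).1]
      exact ((h1 k).2.2 q).2
    · refine tendsto_const_nhds.congr' ?_
      filter_upwards [h2 {q} isCompact_singleton] with k hk
      rw [e1, hk q rfl, one_mul]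
  have t2 : Tendsto (fun k => ∫ q, baseDensity n (lieDeriv Z (χ k)) q ∂(baseMeasure n M)) atTop
      (𝓝 0) := by
    refine squeeze_zero_norm (fun k => ?_) (by simpa using (ENNReal.tendsto_toReal (by simp)).comp h3)
    have hm := (continuousDensity_lieDeriv hZ (h1 k).1).measurable
    have habs : baseDensity n (fun q => |lieDeriv Z (χ k) q|)
        = fun q => |baseDensity n (lieDeriv Z (χ k)) q| := funext fun q => by
      simp only [baseDensity, abs_mul, jac, abs_abs]
    refine (norm_integral_le_lintegral_norm _).trans (le_of_eq ?_)
    rw [Function.comp_apply, densityMeasure_univ (by rw [habs]; exact hm.abs), habs]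
    rfl
  have t3 : Tendsto (fun k => ∫ q, baseDensity n (fun q => χ k q * δ q) q ∂(baseMeasure n M)) atTop
      (𝓝 0) := by
    have := (t2.const_mul c).neg
    rw [mul_zero, neg_zero] at this
    exact this.congr fun k =>
      (integral_mul_divergence hδ hZ hdiv (h1 k).1 (h1 k).2.1).symm
  exact tendsto_nhds_unique t1 t3

end Divergence

end

section

variable {n : ℕ} {M : Type*} [TopologicalSpace M] [ChartedSpace (Coord n) M]
  [IsManifold (𝓡 n) ∞ M] {I : Set ℝ} {ξ : ℝ}

/-! ### The bracket of two fluid functionals on the kinetic side -/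

/-- The kinetic bracket density of the generators of `X` and `Y`. -/
def bracketIntegrand (ξ : ℝ) (X Y : FluidAlgebra n M) (f : PhaseDensity n M I)
    (z : Cotangent n M) : ℝ :=
  f.toFun z * poissonBracket (fluidGenerator ξ X f) (fluidGenerator ξ Y f) z

theorem contMDiff_bracketIntegrand (X Y : FluidAlgebra n M) (f : PhaseDensity n M I) :
    ContMDiff (cotModel n) 𝓘(ℝ, ℝ) ∞ (bracketIntegrand ξ X Y f) :=
  f.smooth.mul (contMDiff_poissonBracket (contMDiff_fluidGenerator X f)
    (contMDiff_fluidGenerator Y f))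

theorem poissonBracket_eq_zero {a b : Cotangent n M → ℝ} {z : Cotangent n M}
    (h : a =ᶠ[𝓝 z] fun _ => 0) : poissonBracket a b z = 0 := by
  have ht : Tendsto (extChartAt (cotModel n) z).symm (𝓝 (extChartAt (cotModel n) z z)) (𝓝 z) := by
    have := continuousAt_extChartAt_symm (I := cotModel n) z
    rwa [ContinuousAt, extChartAt_to_inv] at this
  have h1 : a ∘ (extChartAt (cotModel n) z).symm =ᶠ[𝓝 (extChartAt (cotModel n) z z)]
      fun _ => 0 := ht.eventually h
  simp only [poissonBracket]
  rw [h1.fderiv_eq]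
  simp

theorem contDiffOn_fderiv_localVec (u : Cₛ^∞⟮𝓡 n; Coord n, (TangentSpace (𝓡 n) : M → Type)⟯)
    (x : M) : ContDiffOn ℝ ∞ (fderiv ℝ (localVec (n := n) u x)) (dom x) :=
  (contDiffOn_localVec u x).fderiv_of_isOpen (isOpen_dom x) (by simp)

theorem contDiffOn_fderiv_localFun {g : M → ℝ} (hg : ContMDiff (𝓡 n) 𝓘(ℝ, ℝ) ∞ g) (x : M) :
    ContDiffOn ℝ ∞ (fderiv ℝ (localFun n g x)) (dom x) :=
  (contDiffOn_localFun hg x).fderiv_of_isOpen (isOpen_dom x) (by simp)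

theorem contDiffOn_fluxVec (X Y : FluidAlgebra n M) (x : M) :
    ContDiffOn ℝ ∞ (fluxVec X Y x) (dom x) :=
  ((contDiffOn_localFun X.2.contMDiff x).smul (contDiffOn_localVec Y.1 x)).sub
    ((contDiffOn_localFun Y.2.contMDiff x).smul (contDiffOn_localVec X.1 x))

theorem continuousOn_fluxMap (X Y : FluidAlgebra n M) (x : M) :
    ContinuousOn (fluxMap X Y x) (dom x) := by
  have h : ∀ u : Cₛ^∞⟮𝓡 n; Coord n, (TangentSpace (𝓡 n) : M → Type)⟯,
      ContinuousOn (fun y => ContinuousLinearMap.adjoint (fderiv ℝ (localVec u x) y)) (dom x) :=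
    fun u => (ContinuousLinearMap.adjoint (𝕜 := ℝ) (E := Coord n)
      (F := Coord n)).continuous.comp_continuousOn (contDiffOn_fderiv_localVec u x).continuousOn
  exact ((contDiffOn_localFun Y.2.contMDiff x).continuousOn.smul (h X.1)).sub
    ((contDiffOn_localFun X.2.contMDiff x).continuousOn.smul (h Y.1))

theorem continuousOn_commVec (X Y : FluidAlgebra n M) (x : M) :
    ContinuousOn (commVec X Y x) (dom x) :=
  (((contDiffOn_fderiv_localVec X.1 x).clm_apply (contDiffOn_localVec Y.1 x)).sub
    ((contDiffOn_fderiv_localVec Y.1 x).clm_apply (contDiffOn_localVec X.1 x))).continuousOn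

theorem continuousOn_commFun (X Y : FluidAlgebra n M) (x : M) :
    ContinuousOn (commFun X Y x) (dom x) :=
  (((contDiffOn_fderiv_localFun X.2.contMDiff x).clm_apply (contDiffOn_localVec Y.1 x)).sub
    ((contDiffOn_fderiv_localFun Y.2.contMDiff x).clm_apply
      (contDiffOn_localVec X.1 x))).continuousOn

theorem continuousOn_wronskian (X Y : FluidAlgebra n M) (x : M) :
    ContinuousOn (wronskian X Y x) (dom x) := by
  have h : ∀ g : C^∞⟮𝓡 n, M; 𝓘(ℝ, ℝ), ℝ⟯,
      ContinuousOn (fun y => covecL.symm (fderiv ℝ (localFun n g x) y)) (dom x) := fun g =>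
    (covecL (n := n)).symm.continuous.comp_continuousOn
      (contDiffOn_fderiv_localFun g.contMDiff x).continuousOn
  exact ((contDiffOn_localFun Y.2.contMDiff x).continuousOn.smul (h X.2)).sub
    ((contDiffOn_localFun X.2.contMDiff x).continuousOn.smul (h Y.2))

/-- The direction of differentiation grows at most linearly in the momentum, uniformly over `C`,
which is the growth that `FibreDecay` tolerates for first derivatives. -/
theorem integrableOn_fderiv_of_decay {k : Cotangent n M → ℝ} (hd : FibreDecay k)
    (hk : ContMDiff (cotModel n) 𝓘(ℝ, ℝ) ∞ k) {x : M} {C : Set (Coord n)} (hCx : C ⊆ dom x)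
    (hC : IsCompact C) {b : Coord n → Coord n} {B : Coord n → Coord n →L[ℝ] Coord n}
    {d : Coord n → Coord n} (hb : ContinuousOn b (dom x)) (hB : ContinuousOn B (dom x))
    (hd' : ContinuousOn d (dom x)) :
    IntegrableOn (fun w : Coord n × Coord n =>
      fderiv ℝ (fun w => k (canon x w)) w (b w.1, B w.1 w.2 + d w.1)) (C ×ˢ univ) := by
  have hfst : MapsTo Prod.fst (C ×ˢ (univ : Set (Coord n))) (dom x) := fun w hw => hCx hw.1
  have hD : ContinuousOn (fderiv ℝ fun w => k (canon x w)) (C ×ˢ univ) :=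
    ((contDiffOn_comp_canon hk x).fderiv_of_isOpen (m := ∞) (isOpen_dom_prod x)
      (by simp)).continuousOn.mono (prod_mono hCx subset_rfl)
  obtain ⟨A1, h1⟩ := hC.exists_bound_of_continuousOn (hb.mono hCx)
  obtain ⟨A2, h2⟩ := hC.exists_bound_of_continuousOn (hB.mono hCx)
  obtain ⟨A3, h3⟩ := hC.exists_bound_of_continuousOn (hd'.mono hCx)
  have hv : ContinuousOn (fun w : Coord n × Coord n => (b w.1, B w.1 w.2 + d w.1)) (C ×ˢ univ) :=
    (hb.comp continuousOn_fst hfst).prodMk (((hB.comp continuousOn_fst hfst).clm_apply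
      continuousOn_snd).add (hd'.comp continuousOn_fst hfst))
  refine integrableOn_of_decay hd hCx hC (hD.clm_apply hv) 1
    (A := |A1| + (|A2| + |A3|)) (by positivity) fun y hy v => ?_
  rw [← norm_iteratedFDeriv_fderiv, norm_iteratedFDeriv_zero, ← Real.norm_eq_abs, mul_comm]
  refine (ContinuousLinearMap.le_opNorm _ _).trans ?_
  gcongr
  have n1 := (h1 y hy).trans (le_abs_self A1)
  have n2 := (h2 y hy).trans (le_abs_self A2)
  have n3 := (h3 y hy).trans (le_abs_self A3)
  have n4 : ‖B y v + d y‖ ≤ |A2| * ‖v‖ + |A3| :=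
    (norm_add_le _ _).trans (add_le_add (((B y).le_opNorm v).trans (by gcongr)) n3)
  have n5 := norm_nonneg v
  have n6 := mul_nonneg (abs_nonneg A1) n5
  have n7 := mul_nonneg (abs_nonneg A3) n5
  have n8 := abs_nonneg A1
  have n9 := abs_nonneg A2
  have n10 := abs_nonneg A3
  have n11 := mul_nonneg (abs_nonneg A2) n5
  refine max_le ?_ ?_
  · change ‖b y‖ ≤ _
    linarith
  · change ‖B y v + d y‖ ≤ _
    linarith

theorem integrableOn_mul_of_decay {k : Cotangent n M → ℝ} (hd : FibreDecay k)
    (hk : ContMDiff (cotModel n) 𝓘(ℝ, ℝ) ∞ k) {x : M} {C : Set (Coord n)} (hCx : C ⊆ dom x)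
    (hC : IsCompact C) {a : Coord n → Coord n} {s : Coord n → ℝ} (ha : ContinuousOn a (dom x))
    (hs : ContinuousOn s (dom x)) :
    IntegrableOn (fun w : Coord n × Coord n =>
      (inner ℝ w.2 (a w.1) + s w.1) * k (canon x w)) (C ×ˢ univ) := by
  have hfst : MapsTo Prod.fst (C ×ˢ (univ : Set (Coord n))) (dom x) := fun w hw => hCx hw.1
  have hk' := (contDiffOn_comp_canon hk x).continuousOn.mono (prod_mono hCx (subset_refl univ))
  obtain ⟨A1, h1⟩ := hC.exists_bound_of_continuousOn (ha.mono hCx)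
  obtain ⟨A2, h2⟩ := hC.exists_bound_of_continuousOn (hs.mono hCx)
  refine integrableOn_of_decay hd hCx hC
    (((continuousOn_snd.inner (ha.comp continuousOn_fst hfst)).add
      (hs.comp continuousOn_fst hfst)).mul hk') 0 (A := |A1| + |A2|) (by positivity)
    fun y hy v => ?_
  rw [norm_iteratedFDeriv_zero, abs_mul, Real.norm_eq_abs]
  gcongr
  have n1 := (h1 y hy).trans (le_abs_self A1)
  have n2 := (h2 y hy).trans (le_abs_self A2)
  rw [Real.norm_eq_abs] at n2
  have n5 := norm_nonneg v
  have n3 := (abs_real_inner_le_norm v (a y)).trans (mul_le_mul_of_nonneg_left n1 n5)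
  have n4 := mul_nonneg (abs_nonneg A2) n5
  have n6 := abs_nonneg A1
  refine (abs_add_le _ _).trans ?_
  change |inner ℝ v (a y)| + |s y| ≤ _
  linarith

theorem CompactlySupported.union {X Y : FluidAlgebra n M} (hX : CompactlySupported X)
    (hY : CompactlySupported Y) : ∃ K : Set M, IsCompact K ∧
      (∀ q ∉ K, X.1 q = 0 ∧ X.2 q = 0) ∧ ∀ q ∉ K, Y.1 q = 0 ∧ Y.2 q = 0 := by
  obtain ⟨K, hK, h⟩ := hX
  obtain ⟨K', hK', h'⟩ := hY
  exact ⟨K ∪ K', hK.union hK', fun q hq => h q fun hk => hq (Or.inl hk),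
    fun q hq => h' q fun hk => hq (Or.inr hk)⟩

/-! ### The Poisson map property -/

section Main

variable [T2Space M] [SecondCountableTopology M] [MeasurableSpace M] [BorelSpace M]

/-- Over the complement of the support of X one generator vanishes near each point, hence so does
the bracket. Over a compact part of a chart, each of the four terms of the pointwise identity is
integrable by decay; bounding the bracket directly would involve f^ξ, which need not decay. -/
theorem integrable_bracketIntegrand (h0 : (0 : ℝ) ∈ I) (hξ : ξ ∈ I) (hξ' : 0 < 1 + 2 * ξ)
    {X : FluidAlgebra n M} (hX : CompactlySupported X) (Y : FluidAlgebra n M)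
    (f : PhaseDensity n M I) : Integrable (bracketIntegrand ξ X Y f) (liouville n M) := by
  obtain ⟨K, hK, hKX⟩ := hX
  refine integrable_liouville_of_chart (contMDiff_bracketIntegrand X Y f).continuous hK
    (fun z hz => ?_) fun x C hCx hC => ?_
  · rw [bracketIntegrand, poissonBracket_eq_zero, mul_zero]
    filter_upwards [(hK.isClosed.isOpen_compl.preimage continuous_proj_cotangent).mem_nhds hz]
      with w hw
    rw [fluidGenerator, (hKX _ hw).1, (hKX _ hw).2]
    simp
  have i1 := integrableOn_mul_of_decay (f.fibreDecay h0) f.smooth hCx hC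
    (continuousOn_commVec X Y x) (continuousOn_const (c := (0 : ℝ)))
  have i2 := integrableOn_fderiv_of_decay (f.decay ξ hξ).1 (f.contMDiff_rpow _) hCx hC
    (contDiffOn_fluxVec X Y x).continuousOn (continuousOn_fluxMap X Y x)
    (continuousOn_const (c := (0 : Coord n)))
  have i3 := integrableOn_mul_of_decay (f.decay ξ hξ).1 (f.contMDiff_rpow _) hCx hC
    (continuousOn_const (c := (0 : Coord n)))
    ((continuousOn_const (c := 1 + ξ)).mul (continuousOn_commFun X Y x))
  have i4 := integrableOn_fderiv_of_decay (f.decay ξ hξ).2 (f.contMDiff_rpow _) hCx hC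
    (continuousOn_const (c := (0 : Coord n))) (continuousOn_const (c := 0))
    (continuousOn_wronskian X Y x)
  refine (((i1.add (i2.const_mul ξ)).add i3).add (i4.const_mul
    ((1 + ξ) ^ 2 * ξ / (1 + 2 * ξ)))).congr_fun (fun w hw => ?_) (hC.measurableSet.prod .univ)
  rw [bracketIntegrand, ← Prod.mk.eta (p := w), mul_poissonBracket_fluidGenerator hξ' X Y f
    (hCx hw.1)]
  simp

/-- Smooth plateau functions along a compact exhaustion: once `K` lies inside a plateau, dχₖ
vanishes near `K` and Z vanishes elsewhere, so the flux is eventually zero. -/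
theorem noFluxAtInfinity_of_compact {Z : (q : M) → TangentSpace (𝓡 n) q} {K : Set M}
    (hK : IsCompact K) (hZ : ∀ q ∉ K, Z q = 0) : NoFluxAtInfinity (n := n) Z := by
  have := ChartedSpace.locallyCompactSpace (Coord n) M
  set E := CompactExhaustion.choice M
  have hχ : ∀ k, ∃ χ : C^∞⟮𝓡 n, M; 𝓘(ℝ, ℝ), ℝ⟯, EqOn χ 0 (interior (E (k + 1)))ᶜ ∧
      EqOn χ 1 (E k) ∧ ∀ q, χ q ∈ Icc (0 : ℝ) 1 := fun k =>
    exists_contMDiffMap_zero_one_of_isClosed (𝓡 n) isOpen_interior.isClosed_compl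
      (E.isCompact k).isClosed
      (disjoint_compl_left_iff_subset.2 (E.subset_interior_succ k))
  choose χ h0 h1 h2 using hχ
  refine ⟨fun k => χ k, fun k => ⟨(χ k).contMDiff, ?_, h2 k⟩, fun C hC => ?_, ?_⟩
  · exact HasCompactSupport.intro (E.isCompact (k + 1)) fun q hq =>
      h0 k fun h => hq (interior_subset h)
  · obtain ⟨N, hN⟩ := E.exists_superset_of_isCompact hC
    filter_upwards [eventually_ge_atTop N] with k hk q hq using h1 k (E.subset hk (hN hq))
  · obtain ⟨N, hN⟩ := E.exists_superset_of_isCompact hK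
    refine tendsto_const_nhds.congr' ?_
    -- One index beyond N, so that `K` lies in the interior of the plateau and χₖ is constant near
    -- every point of `K`.
    filter_upwards [eventually_ge_atTop (N + 1)] with k hk
    refine (densityMeasure_eq_zero MeasurableSet.univ fun q _ => ?_).symm
    by_cases hq : q ∈ K
    · rw [lieDeriv_eq_zero (c := 1) Z, abs_zero]
      have hmem : interior (E k) ∈ 𝓝 q := isOpen_interior.mem_nhds
        (interior_mono (E.subset hk) (E.subset_interior_succ N (hN hq)))
      filter_upwards [hmem] with p hp using h1 k (interior_subset hp)
    · rw [lieDeriv_eq_zero_of_eq_zero (hZ q hq), abs_zero]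

theorem fluidLie_eq_zero {X : FluidAlgebra n M} (Y : FluidAlgebra n M) {K : Set M}
    (hK : IsCompact K) (hX : ∀ q ∉ K, X.1 q = 0 ∧ X.2 q = 0) {q : M} (hq : q ∉ K) :
    (fluidLie X Y).1 q = 0 ∧ (fluidLie X Y).2 q = 0 := by
  have hn : Kᶜ ∈ 𝓝 q := hK.isClosed.isOpen_compl.mem_nhds hq
  constructor
  · change VectorField.mlieBracket (𝓡 n) X.1 Y.1 q = 0
    have h1 : (X.1 : (q : M) → TangentSpace (𝓡 n) q) =ᶠ[𝓝 q] 0 := by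
      filter_upwards [hn] with p hp using (hX p hp).1
    have h2 : (Y.1 : (q : M) → TangentSpace (𝓡 n) q) =ᶠ[𝓝 q] Y.1 := EventuallyEq.rfl
    exact (h1.mlieBracket_vectorField_eq h2).trans
      (congrFun VectorField.mlieBracket_zero_left q)
  · change lieDeriv X.1 Y.2 q - lieDeriv Y.1 X.2 q = 0
    rw [lieDeriv_eq_zero (c := 0) Y.1 (by filter_upwards [hn] with p hp using (hX p hp).2),
      lieDeriv_eq_zero_of_eq_zero (hX q hq).1, sub_zero]

variable (h0 : (0 : ℝ) ∈ I) (hξ : ξ ∈ I)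

theorem densityIntegrable_pairing_fluidLie {X : FluidAlgebra n M} (hX : CompactlySupported X)
    (Y : FluidAlgebra n M) (μ : FluidDual n M) :
    DensityIntegrable n (pairingDensity μ (fluidLie X Y)) := by
  obtain ⟨K, hK, hKX⟩ := hX
  have hc := continuousDensity_pairingDensity μ (fluidLie X Y)
  refine (densityIntegrable_iff hc.measurable).2 (hc.integrable_of_compact hK fun q hq => ?_)
  obtain ⟨h1, h2⟩ := fluidLie_eq_zero Y hK hKX hq
  rw [pairingDensity, h1, h2, map_zero, mul_zero, add_zero]

/-- The flux of the entropy density `ρ` between two elements of the fluid algebra. -/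
def entropyFlux (ρ : M → ℝ) (X Y : FluidAlgebra n M) (q : M) : TangentSpace (𝓡 n) q :=
  ρ q • (X.2 q • Y.1 q - Y.2 q • X.1 q)

theorem vecDensityComp_entropyFlux (ρ : M → ℝ) (X Y : FluidAlgebra n M) (x : M) :
    vecDensityComp (entropyFlux ρ X Y) x
      = fun y => densityComp (n := n) ρ x y • fluxVec X Y x y := by
  ext1 y
  have h : localVec (entropyFlux ρ X Y) x y
      = ρ ((extChartAt (𝓡 n) x).symm y) • fluxVec X Y x y := by
    have := ((tangentCoordChange (𝓡 n) ((extChartAt (𝓡 n) x).symm y) x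
      ((extChartAt (𝓡 n) x).symm y)).map_smul (ρ ((extChartAt (𝓡 n) x).symm y))
        (show Coord n from X.2 ((extChartAt (𝓡 n) x).symm y) • Y.1 ((extChartAt (𝓡 n) x).symm y)
          - Y.2 ((extChartAt (𝓡 n) x).symm y) • X.1 ((extChartAt (𝓡 n) x).symm y)))
    refine this.trans (congrArg _ ?_)
    refine (map_sub _ _ _).trans ?_
    exact congrArg₂ _ (map_smul _ _ _) (map_smul _ _ _)
  rw [vecDensityComp, h, smul_smul, densityComp, mul_comm]

/-- The sum of the fibre-integrated kinetic bracket and the density paired with the Lie bracket is ξ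
times the divergence of the entropy flux. Both summands are integrable, so the divergence theorem
makes their integrals opposite. -/
theorem integral_bracketIntegrand (hξ' : 0 < 1 + 2 * ξ) (X Y : FluidAlgebra n M)
    (f : PhaseDensity n M I)
    (hk : Integrable (bracketIntegrand ξ X Y f) (liouville n M))
    (hp : DensityIntegrable n (pairingDensity (fluidMoments h0 hξ f) (fluidLie X Y)))
    (hflux : NoFluxAtInfinity (n := n) (entropyFlux (fluidMoments h0 hξ f).ρ X Y)) :
    ∫ z, bracketIntegrand ξ X Y f z ∂(liouville n M)
      = -pairing (fluidMoments h0 hξ f) (fluidLie X Y) := by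
  set μ := fluidMoments h0 hξ f
  set P := pairingDensity μ (fluidLie X Y)
  have hPm := (continuousDensity_pairingDensity μ (fluidLie X Y)).measurable
  have hP := (densityIntegrable_iff hPm).1 hp
  obtain ⟨hb, hbe⟩ := integral_liouville hk
  set δ : M → ℝ := fun q => (∫ v, bracketIntegrand ξ X Y f (cotPoint q v)) + P q with hδ
  have hZ : ∀ x : M, ContDiffOn ℝ ∞ (vecDensityComp (entropyFlux μ.ρ X Y) x) (dom x) := fun x => by
    rw [vecDensityComp_entropyFlux]
    exact (μ.smooth_ρ x).smul (contDiffOn_fluxVec X Y x)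
  have hdiv : ∀ x : M, ∀ y ∈ dom x, densityComp (n := n) δ x y
      = ξ * divergence (vecDensityComp (entropyFlux μ.ρ X Y) x) y := fun x y hy => by
    have e1 : densityComp (n := n) δ x y
        = densityComp (n := n) (fun q => ∫ v, bracketIntegrand ξ X Y f (cotPoint q v)) x y
          + densityComp (n := n) P x y := by
      simp only [densityComp, hδ, add_mul]
    rw [e1, densityComp_fibreIntegral _ hy, vecDensityComp_entropyFlux]
    simp only [bracketIntegrand]
    rw [integral_mul_poissonBracket h0 hξ hξ' X Y f hy]
    ring
  -- Continuity is read off from the divergence formula, which avoids proving it for the fibre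
  -- integral of the bracket.
  have hδc : ContinuousDensity n δ := fun x => by
    refine ContinuousOn.congr ?_ (hdiv x)
    have h1 : ContDiffOn ℝ ∞ (fderiv ℝ (vecDensityComp (entropyFlux μ.ρ X Y) x)) (dom x) :=
      (hZ x).fderiv_of_isOpen (isOpen_dom x) (by simp)
    exact continuousOn_const.mul (continuousOn_finsetSum _ fun i _ =>
      continuousOn_const.inner (h1.continuousOn.clm_apply continuousOn_const))
  have hδb : baseDensity n δ = baseDensity n (fun q => ∫ v, bracketIntegrand ξ X Y f (cotPoint q v))
      + baseDensity n P := by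
    ext q
    simp only [baseDensity, Pi.add_apply, hδ, add_mul]
  have h1 := integral_divergence_eq_zero_of_noFlux hδc hZ hdiv (hδb ▸ hb.add hP) hflux
  rw [hδb, integral_add' hb hP, ← hbe, ← densityIntegral_eq hPm hP] at h1
  rw [pairing]
  linarith

theorem isPoissonMap_fluidMoments (hξ' : 0 < 1 + 2 * ξ) :
    IsPoissonMap (fluidMoments (n := n) (M := M) h0 hξ) := by
  intro F G f hF hG
  have hF' := Classical.epsilon_spec hF
  have hG' := Classical.epsilon_spec hG
  have kF := hasKineticDeriv_comp_fluidMoments h0 hξ hF'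
  have kG := hasKineticDeriv_comp_fluidMoments h0 hξ hG'
  set X : FluidAlgebra n M := fluidDeriv F (fluidMoments h0 hξ f) with hX
  set Y : FluidAlgebra n M := fluidDeriv G (fluidMoments h0 hξ f) with hY
  have hk : kineticIntegrand (F ∘ fluidMoments h0 hξ) (G ∘ fluidMoments h0 hξ) f
      = bracketIntegrand ξ X Y f := funext fun z => by
    rw [kineticIntegrand, kineticDeriv_eq kF, kineticDeriv_eq kG]
    rfl
  refine ⟨⟨_, kF⟩, ⟨_, kG⟩, fun hXc hYc => ⟨?_, ?_, ?_⟩, fun hd => ?_⟩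
  · rw [hk]
    exact integrable_bracketIntegrand h0 hξ hξ' hXc Y f
  · exact densityIntegrable_pairing_fluidLie hXc Y _
  · obtain ⟨K, hK, hKX, hKY⟩ := hXc.union hYc
    refine noFluxAtInfinity_of_compact hK fun q hq => ?_
    rw [← hX, ← hY, (hKX q hq).2, (hKY q hq).2, zero_smul, zero_smul, sub_zero, smul_zero]
  · rw [kineticBracket, fluidBracket, hk]
    exact integral_bracketIntegrand h0 hξ hξ' X Y f (hk ▸ hd.kinetic) hd.fluid hd.flux

end Main

end

end KineticFluid

end

open KineticFluid
theorem proposition2 (n : ℕ) (M : Type*) [TopologicalSpace M] [T2Space M]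
    [SecondCountableTopology M] [MeasurableSpace M] [BorelSpace M]
    [ChartedSpace (Coord n) M] [IsManifold (𝓡 n) ∞ M]
    (I : Set ℝ) (hI : I.OrdConnected) (h0 : (0 : ℝ) ∈ I) (hI' : I ⊆ Ioi (-1 / 2))
    (ξ : ℝ) (hξ : ξ ∈ I) :
    ∃ J : PhaseDensity n M I → FluidDual n M,
      (∀ (f : PhaseDensity n M I) (q : M),
        Integrable (fun v : Coord n => f.toFun (cotPoint q v) • covec v) ∧
        Integrable (fun v : Coord n => f.toFun (cotPoint q v) ^ (1 + ξ)) ∧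
        (J f).m q = ∫ v : Coord n, f.toFun (cotPoint q v) • covec v ∧
        (J f).ρ q = ∫ v : Coord n, f.toFun (cotPoint q v) ^ (1 + ξ)) ∧
      (∀ (f : PhaseDensity n M I) (X : FluidAlgebra n M), CompactlySupported X →
        DensityIntegrable n (pairingDensity (J f) X) ∧
        Integrable (fun z : Cotangent n M =>
          z.2 (X.1 z.1) * f.toFun z + f.toFun z ^ (1 + ξ) * X.2 z.1) (liouville n M) ∧
        pairing (J f) X = ∫ z : Cotangent n M,
          (z.2 (X.1 z.1) * f.toFun z + f.toFun z ^ (1 + ξ) * X.2 z.1) ∂(liouville n M)) ∧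
      IsPoissonMap J := by
  refine ⟨fluidMoments h0 hξ, fun f q => ⟨integrable_momentum_cotPoint f h0 q,
    integrable_mass_cotPoint f hξ q, rfl, rfl⟩, fun f X hX => ?_, ?_⟩
  · obtain ⟨h1, h2⟩ := pairing_fluidMoments h0 hξ X hX f
    exact ⟨h1, integrable_momentIntegrand X hX f h0 hξ, h2⟩
  · have h : -1 / 2 < ξ := hI' hξ
    exact isPoissonMap_fluidMoments h0 hξ (by linarith)
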